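/- Let $k$ be an algebraically closed field of characteristic $p>0$, let $N\ge 0$ and let $q_0,\dots,q_N$ be positive integers. Put $d=q_0+\cdots+q_N$, $A=k[x_0,\dots,x_N]$, $x=x_0\cdots x_N$, and let $\Lambda=\{\alpha_1,\dots,\alpha_m\}$ be the finite set of all $\alpha\in\mathbb Z_{\ge 0}^{N+1}$ with $\sum_j q_j\alpha_j=d$. Let $s=(s_1,\dots,s_m)$ be indeterminates, let $G(s)=\sum_i s_i x^{\alpha_i}\in k[s][x_0,\dots,x_N]$, let $\widetilde G=\sum_i s_i x^{\alpha_i}\in W(k)[s][x_0,\dots,x_N]$, let $\phi$ be the endomorphism of $W(k)[s][x_0,\dots,x_N]$ which is the Witt vector Frobenius on $W(k)$ and sends $s_i\mapsto s_i^p$, $x_j\mapsto x_j^p$, and let $\Delta(G)(s,0)\in k[s][x_0,\dots,x_N]$ be the reduction modulo $p$ of $\frac1p(\widetilde G^{\,p}-\phi(\widetilde G))$. For $n\ge 1$ put $$G_n(s,0)=G(s)^{\,p^n-p^{n-1}-\cdots-p-2}\,\Delta(G)(s,0)^{\,p^{n-2}+\cdots+p+1}$$ (so $G_1=G^{p-2}$),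 and let $H_n(s,0)\in k[s]$ be the coefficient of $x^{p^n-1}$ in $G(s)G_n(s,0)$. Let $\mathcal L_n$ be the $n\times m$ Jacobian matrix $\bigl(\partial H_i(s,0)/\partial s_j\bigr)_{1\le i\le n,\,1\le j\le m}$, and let $Z_n\subseteq k^m$ be the set of common zeros of $H_1(s,0),\dots,H_n(s,0)$ and of all $n\times n$ minors of $\mathcal L_n$. For $b\in k^m$ put $\tau(b)=\inf\{n\ge 1: b\in Z_n\}$ (with $\inf\emptyset=\infty$) and $G(b)=\sum_i b_i x^{\alpha_i}\in A$. For a regular local ring $R$ of characteristic $p$ with fraction field $K$ and a $\mathbb Q$-divisor $D$ on $\operatorname{Spec}R$, let $W_n(R)(pD)\subseteq W_n(K)$ be the group of all $(a_0,\dots,a_{n-1})$ such that, for every $i$, either $a_i=0$ or $\operatorname{div}(a_i)+p^{i}\cdot pD\ge 0$. For effective $D$, the pair $(R,D)$ is called $n$-quasi-$F$-split if there is a homomorphism of $W_n(R)$-modules $F_*W_n(R)(pD)\to R$ whose composition with the Frobenius $F\colon W_n(R)\to F_*W_n(R)(pD)$ is the restriction $W_n(R)\to R$. For a nonzero $f\in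 R$ the non-splitting index is $$\mathrm{ns}(f)=\inf\Bigl\{n\ge 1 : \bigl(R,(1-\tfrac{2}{p^n})\operatorname{div}(f)\bigr)\text{ is not } n\text{-quasi-}F\text{-split}\Bigr\}\in\mathbb Z_{\ge1}\cup\{\infty\}.$$ Theorem. For every $b\in k^m$ with $b\ne 0$ one has $$\tau(b)=\mathrm{ns}(G(b)),$$ where $G(b)$ is regarded as an element of the local ring $R=A_{(x_0,\dots,x_N)}$. -/

import Mathlib

noncomputable section

namespace NonSplit

open MvPolynomial

/-! ### Divisorial Witt sheaves and quasi-F-splitting of pairs -/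

section Witt

variable (p : ℕ) [hp : Fact p.Prime]

theorem teichmuller_mul_coeff {L : Type*} [CommRing L] [CharP L p] (i : ℕ) :
    ∀ (g : L) (x : WittVector p L),
      (WittVector.teichmuller p g * x).coeff i = g ^ p ^ i * x.coeff i := by
  induction i with
  | zero => intro g x; simp [WittVector.mul_coeff_zero]
  | succ i ih =>
    intro g x
    have hdec : ∀ y : WittVector p L, y = WittVector.teichmuller p (y.coeff 0) +
        WittVector.verschiebung (WittVector.mk p fun j => y.coeff (j + 1)) := by
      intro y
      ext j
      rw [WittVector.coeff_add_of_disjoint]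
      · cases j with
        | zero => simp [WittVector.verschiebung_coeff_zero]
        | succ j =>
          rw [WittVector.teichmuller_coeff_pos _ _ _ (Nat.succ_pos _), zero_add,
            WittVector.verschiebung_coeff_succ, WittVector.coeff_mk]
      · intro j
        cases j with
        | zero => right; simp
        | succ j => left; exact WittVector.teichmuller_coeff_pos _ _ _ (Nat.succ_pos _)
    have hF : WittVector.frobenius (WittVector.teichmuller p g)
        = WittVector.teichmuller p (g ^ p) := by
      ext j
      rw [WittVector.coeff_frobenius_charP]
      cases j with
      | zero => rw [WittVector.teichmuller_coeff_zero, WittVector.teichmuller_coeff_zero]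
      | succ j =>
        rw [WittVector.teichmuller_coeff_pos _ _ _ (Nat.succ_pos _),
          WittVector.teichmuller_coeff_pos _ _ _ (Nat.succ_pos _), zero_pow hp.out.ne_zero]
    have key : WittVector.teichmuller p g * x = WittVector.teichmuller p (g * x.coeff 0) +
        WittVector.verschiebung (WittVector.teichmuller p (g ^ p) *
          WittVector.mk p fun j => x.coeff (j + 1)) := by
      conv_lhs => rw [hdec x]
      rw [mul_add, ← map_mul, mul_comm (WittVector.teichmuller p (g ^ p)), ← hF,
        WittVector.verschiebung_mul_frobenius, mul_comm (WittVector.verschiebung _)]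
    rw [key, WittVector.coeff_add_of_disjoint]
    · rw [WittVector.teichmuller_coeff_pos _ _ _ (Nat.succ_pos _), zero_add,
        WittVector.verschiebung_coeff_succ, ih, ← pow_mul, pow_succ' p i,
        WittVector.coeff_mk]
    · intro j
      cases j with
      | zero => right; simp
      | succ j => left; exact WittVector.teichmuller_coeff_pos _ _ _ (Nat.succ_pos _)

variable {p}

variable {R : Type*} [CommRing R] [IsDomain R]

/-- For a normal domain `R`, `f ∈ R` nonzero and `v > 0`, the set of `a ∈ Frac R` with
`div(a) + (u/v) div(f) ≥ 0`, that is `v div(a) + u div(f) ≥ 0`, that is `a ^ v * f ^ u ∈ R`. -/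
def divSections (f : R) (u v : ℕ) : Set (FractionRing R) :=
  {a | a ^ v * algebraMap R (FractionRing R) f ^ u ∈ (algebraMap R (FractionRing R)).range}

/-- The scaling by a `v`-th root of `f ^ u` in an algebraic closure turns the sections into
integral elements. -/
theorem exists_scaling [IsIntegrallyClosed R] (f : R) (u : ℕ) {v : ℕ} (hv : 0 < v) :
    ∃ g : AlgebraicClosure (FractionRing R), ∀ (j : ℕ) (a : FractionRing R),
      a ∈ divSections f (j * u) v ↔
        IsIntegral R (g ^ j * algebraMap _ (AlgebraicClosure (FractionRing R)) a) := by
  obtain ⟨g, hg⟩ := IsAlgClosed.exists_pow_nat_eq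
    (algebraMap (FractionRing R) (AlgebraicClosure (FractionRing R))
      (algebraMap R (FractionRing R) f ^ u)) hv
  refine ⟨g, fun j a => ?_⟩
  have h1 : (g ^ j * algebraMap _ (AlgebraicClosure (FractionRing R)) a) ^ v =
      algebraMap (FractionRing R) (AlgebraicClosure (FractionRing R))
        (a ^ v * algebraMap R (FractionRing R) f ^ (j * u)) := by
    rw [mul_pow, ← pow_mul, mul_comm j v, pow_mul, hg, map_mul, map_pow, map_pow, map_pow,
      ← pow_mul, mul_comm u j, mul_comm]
  rw [← IsIntegral.pow_iff hv, h1,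
    isIntegral_algebraMap_iff (FaithfulSMul.algebraMap_injective _ _),
    IsIntegrallyClosed.isIntegral_iff]
  rfl

variable [CharP R p]

theorem charP_closure {p : ℕ} {R : Type*} [CommRing R] [IsDomain R] [CharP R p] : CharP (AlgebraicClosure (FractionRing R)) p :=
  haveI : CharP (FractionRing R) p :=
    charP_of_injective_algebraMap (IsFractionRing.injective R (FractionRing R)) p
  charP_of_injective_algebraMap
    (FaithfulSMul.algebraMap_injective (FractionRing R) (AlgebraicClosure (FractionRing R))) p

/-- The Witt vectors over `L` whose first `n` components lie in the subring `B`. -/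
def wittSubring {L : Type*} [CommRing L] (B : Subring L) (n : ℕ) : Subring (WittVector p L) :=
  ((WittVector.truncate n).comp (WittVector.map B.subtype)).range.comap (WittVector.truncate n)

theorem mem_wittSubring {L : Type*} [CommRing L] (B : Subring L) (n : ℕ) (x : WittVector p L) :
    x ∈ wittSubring B n ↔ ∀ i < n, x.coeff i ∈ B := by
  constructor
  · rintro ⟨y, hy⟩ i hi
    have := congrArg (TruncatedWittVector.coeff ⟨i, hi⟩) hy
    simp only [RingHom.comp_apply, WittVector.coeff_truncate, WittVector.map_coeff] at this
    rw [← this]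
    exact (y.coeff i).2
  · intro h
    refine ⟨WittVector.mk p fun i => if hi : i < n then ⟨x.coeff i, h i hi⟩ else 0, ?_⟩
    ext i
    simp [WittVector.coeff_truncate, WittVector.map_coeff]

theorem exists_witt_scaling [IsIntegrallyClosed R] (n : ℕ) (f : R) (u : ℕ) {v : ℕ} (hv : 0 < v) :
    ∃ g : WittVector p (AlgebraicClosure (FractionRing R)),
      ∀ x : WittVector p (FractionRing R),
        (∀ i : Fin n, (WittVector.truncate n x).coeff i ∈ divSections f (p ^ (i : ℕ) * u) v) ↔
          g * WittVector.map (algebraMap _ (AlgebraicClosure (FractionRing R))) x ∈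
            wittSubring (integralClosure R (AlgebraicClosure (FractionRing R))).toSubring n := by
  have := charP_closure (p := p) (R := R)
  obtain ⟨g, hg⟩ := exists_scaling f u hv
  refine ⟨WittVector.teichmuller p g, fun x => ?_⟩
  rw [mem_wittSubring]
  constructor
  · intro h i hi
    rw [teichmuller_mul_coeff, WittVector.map_coeff]
    have := h ⟨i, hi⟩
    rw [WittVector.coeff_truncate] at this
    exact (hg _ _).1 this
  · intro h i
    have := h i i.2
    rw [teichmuller_mul_coeff, WittVector.map_coeff] at this
    rw [WittVector.coeff_truncate]
    exact (hg _ _).2 this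

/-- The Frobenius `F : W_n(R) → W_n(Frac R)` for `R` of characteristic `p`:
it raises every component to the `p`-th power. -/
def wittFrob (p : ℕ) {n : ℕ} {R : Type*} [CommRing R] (c : TruncatedWittVector p n R) :
    TruncatedWittVector p n (FractionRing R) :=
  TruncatedWittVector.mk p fun i => algebraMap R (FractionRing R) (c.coeff i ^ p)

/-- `W_n(R)(E)` for the `ℚ`-divisor `E = (u/v) div(f)` on a normal domain `R`: the group of
`(a_0, …, a_{n-1}) ∈ W_n(Frac R)` with `div(a_i) + p^i E ≥ 0` for all `i`. -/
def wittDivSections (p : ℕ) [Fact p.Prime] {R : Type*} [CommRing R] [IsDomain R]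
    [IsIntegrallyClosed R] [CharP R p] (n : ℕ) (f : R) (u : ℕ) {v : ℕ} (hv : 0 < v) :
    AddSubgroup (TruncatedWittVector p n (FractionRing R)) where
  carrier := {w | ∀ i : Fin n, w.coeff i ∈ divSections f (p ^ (i : ℕ) * u) v}
  zero_mem' := by
    intro i
    rw [TruncatedWittVector.coeff_zero]
    exact ⟨0, by simp [zero_pow hv.ne']⟩
  add_mem' := by
    intro a b ha hb
    obtain ⟨x, rfl⟩ := WittVector.truncate_surjective p n _ a
    obtain ⟨y, rfl⟩ := WittVector.truncate_surjective p n _ b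
    obtain ⟨g, hg⟩ := exists_witt_scaling (p := p) n f u hv
    rw [Set.mem_ofPred_eq, hg] at ha hb
    rw [Set.mem_ofPred_eq, ← map_add, hg, map_add, mul_add]
    exact add_mem ha hb
  neg_mem' := by
    intro a ha
    obtain ⟨x, rfl⟩ := WittVector.truncate_surjective p n _ a
    obtain ⟨g, hg⟩ := exists_witt_scaling (p := p) n f u hv
    rw [Set.mem_ofPred_eq, hg] at ha
    rw [Set.mem_ofPred_eq, ← map_neg, hg, map_neg, mul_neg]
    exact neg_mem ha

variable [IsIntegrallyClosed R]

theorem wittFrob_mem (n : ℕ) (f : R) (u : ℕ) {v : ℕ} (hv : 0 < v)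
    (c : TruncatedWittVector p n R) : wittFrob p c ∈ wittDivSections p n f u hv :=
  fun i => ⟨(c.coeff i ^ p) ^ v * f ^ (p ^ (i : ℕ) * u), by
    simp [wittFrob]⟩

theorem wittFrob_mul_mem (n : ℕ) (f : R) (u : ℕ) {v : ℕ} (hv : 0 < v)
    (c : TruncatedWittVector p n R) {w : TruncatedWittVector p n (FractionRing R)}
    (hw : w ∈ wittDivSections p n f u hv) : wittFrob p c * w ∈ wittDivSections p n f u hv := by
  obtain ⟨x, rfl⟩ := WittVector.truncate_surjective p n _ w
  obtain ⟨g, hg⟩ := exists_witt_scaling (p := p) n f u hv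
  have hx := (hg x).1 hw
  have hc : wittFrob p c = WittVector.truncate n
      (WittVector.mk p fun i => if h : i < n then
        algebraMap R (FractionRing R) (c.coeff ⟨i, h⟩ ^ p) else 0) := by
    ext i
    simp [wittFrob, WittVector.coeff_truncate]
  rw [hc, ← map_mul]
  refine (hg _).2 ?_
  rw [map_mul, mul_left_comm]
  refine mul_mem ?_ hx
  rw [mem_wittSubring]
  intro i hi
  rw [WittVector.map_coeff]
  rw [WittVector.coeff_mk, dif_pos hi]
  exact (isIntegral_algebraMap (A := FractionRing R)).algebraMap

/-- The pair `(R, (u/v) div(f))`, for a normal domain `R` of characteristic `p`, is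
`n`-quasi-`F`-split: writing `D = (u/v) div(f)`, there is a homomorphism of `W_n(R)`-modules
`σ : F_* W_n(R)(pD) → R` such that
`W_n(R) --F--> F_* W_n(R)(pD) --σ--> R` is the restriction `W_n(R) → R`. Here `W_n(R)` acts on
`F_* W_n(R)(pD)` through the Frobenius and on `R` through the restriction. By the universal
property this is a retraction of `R → Q`, where `Q` is the pushout of `F` along the restriction. -/
def IsQuasiFSplitPair (p : ℕ) [Fact p.Prime] {R : Type*} [CommRing R] [IsDomain R]
    [IsIntegrallyClosed R] [CharP R p] {n : ℕ} (hn : 0 < n) (f : R) (u : ℕ) {v : ℕ}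
    (hv : 0 < v) : Prop :=
  ∃ σ : wittDivSections p n f (p * u) hv →+ R,
    (∀ (c : TruncatedWittVector p n R) (w : wittDivSections p n f (p * u) hv),
      σ ⟨wittFrob p c * w, wittFrob_mul_mem n f (p * u) hv c w.2⟩ = c.coeff ⟨0, hn⟩ * σ w) ∧
    ∀ c : TruncatedWittVector p n R,
      σ ⟨wittFrob p c, wittFrob_mem n f (p * u) hv c⟩ = c.coeff ⟨0, hn⟩

/-- The non-splitting index: the infimum of all `n ≥ 1` such that the pair
`(R, (1 - 2 / p ^ n) div(f))` is not `n`-quasi-`F`-split (note `1 - 2/p^n = (p^n - 2)/p^n`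
and `p ^ n ≥ 2`). -/
def nsIndex (p : ℕ) [hp : Fact p.Prime] {R : Type*} [CommRing R] [IsDomain R]
    [IsIntegrallyClosed R] [CharP R p] (f : R) : ℕ∞ :=
  sInf {m : ℕ∞ | ∃ (n : ℕ) (hn : 0 < n), m = n ∧
    ¬ IsQuasiFSplitPair p hn f (p ^ n - 2) (v := p ^ n) (pow_pos hp.out.pos n)}

end Witt

/-! ### The local ring at the origin of affine space -/

section LocalRing

/-- The maximal ideal `(x_0, …, x_N)` of `k[x_0, …, x_N]`, as the kernel of evaluation at `0`. -/
def originIdeal (N : ℕ) (k : Type*) [Field k] : Ideal (MvPolynomial (Fin (N + 1)) k) :=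
  RingHom.ker (constantCoeff : MvPolynomial (Fin (N + 1)) k →+* k)

instance instPrimeOriginIdeal (N : ℕ) (k : Type*) [Field k] : (originIdeal N k).IsPrime :=
  RingHom.ker_isPrime _

/-- `k[x_0, …, x_N]` localized at `(x_0, …, x_N)`. -/
abbrev OriginRing (N : ℕ) (k : Type*) [Field k] : Type _ :=
  Localization.AtPrime (originIdeal N k)

variable (N : ℕ) (k : Type*) [Field k]

instance instDomainOriginRing : IsDomain (OriginRing N k) :=
  IsLocalization.isDomain_localization (Ideal.primeCompl_le_nonZeroDivisors _)

instance instIntegrallyClosedOriginRing : IsIntegrallyClosed (OriginRing N k) :=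
  isIntegrallyClosed_of_isLocalization _ (originIdeal N k).primeCompl
    (Ideal.primeCompl_le_nonZeroDivisors _)

instance instCharPOriginRing (p : ℕ) [CharP k p] : CharP (OriginRing N k) p :=
  charP_of_injective_algebraMap
    (IsLocalization.injective (OriginRing N k) (Ideal.primeCompl_le_nonZeroDivisors
      (originIdeal N k))) p

end LocalRing

/-! ### The universal weighted hypersurface and the polynomials `H_n(s,0)` -/

section Universal

variable {N : ℕ} (q : Fin (N + 1) → ℕ+)

/-- The exponents `α` with `q_0 α_0 + ⋯ + q_N α_N = d`, where `d = q_0 + ⋯ + q_N`. -/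
def Lam : Type :=
  {α : Fin (N + 1) →₀ ℕ // ∑ j, (q j : ℕ) * α j = ∑ j, (q j : ℕ)}

instance instFiniteLam : Finite (Lam q) := by
  have h := Finsupp.finite_of_nat_weight_eq (fun j => (q j : ℕ)) (fun j => (q j).ne_zero)
    (∑ j, (q j : ℕ))
  refine Set.Finite.to_subtype (h.subset ?_)
  intro α hα
  have hα' : ∑ j, (q j : ℕ) * α j = ∑ j, (q j : ℕ) := hα
  rw [Set.mem_ofPred_eq, Finsupp.weight_apply, Finsupp.sum_fintype _ _ (by simp), ← hα']
  exact Finset.sum_congr rfl fun j _ => by simp [mul_comm]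

instance instFintypeLam : Fintype (Lam q) := Fintype.ofFinite _

/-- `G(s) = ∑ s_α x^α`, in `K[s][x]`, over any coefficient ring `K`. -/
def univG (K : Type*) [CommRing K] : MvPolynomial (Fin (N + 1)) (MvPolynomial (Lam q) K) :=
  ∑ α : Lam q, monomial α.1 (X α)

/-- `G(b) = ∑ b_α x^α`. -/
def specG {K : Type*} [CommRing K] (b : Lam q → K) : MvPolynomial (Fin (N + 1)) K :=
  ∑ α : Lam q, monomial α.1 (b α)

variable (p : ℕ) [hp : Fact p.Prime] (k : Type*) [Field k]

/-- The Frobenius lift `φ` of `W(k)[s][x]`: the Witt vector Frobenius on `W(k)`,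
`s_α ↦ s_α^p` and `x_j ↦ x_j^p`. -/
def phi : MvPolynomial (Fin (N + 1)) (MvPolynomial (Lam q) (WittVector p k)) →+*
    MvPolynomial (Fin (N + 1)) (MvPolynomial (Lam q) (WittVector p k)) :=
  eval₂Hom (C.comp (eval₂Hom (C.comp WittVector.frobenius) fun α => X α ^ p)) fun j => X j ^ p

theorem exists_delta :
    ∃ D : MvPolynomial (Fin (N + 1)) (MvPolynomial (Lam q) (WittVector p k)),
      univG q (WittVector p k) ^ p - phi q p k (univG q (WittVector p k)) = (p : ℕ) • D := by
  have hsum : ∀ (T : Finset (Lam q))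
      (h : Lam q → MvPolynomial (Fin (N + 1)) (MvPolynomial (Lam q) (WittVector p k))),
      ∃ D, (∑ α ∈ T, h α) ^ p - ∑ α ∈ T, h α ^ p = (p : ℕ) • D := by
    classical
    intro T h
    induction T using Finset.induction_on with
    | empty => exact ⟨0, by simp [hp.out.ne_zero]⟩
    | insert a T ha ih =>
      obtain ⟨D, hD⟩ := ih
      obtain ⟨r, hr⟩ := exists_add_pow_prime_eq hp.out (h a) (∑ α ∈ T, h α)
      refine ⟨D + h a * (∑ α ∈ T, h α) * r, ?_⟩
      rw [Finset.sum_insert ha, Finset.sum_insert ha, hr, smul_add, ← hD, nsmul_eq_mul]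
      ring
  obtain ⟨D, hD⟩ := hsum Finset.univ fun α => monomial α.1 (X α)
  refine ⟨D, ?_⟩
  rw [← hD, univG, map_sum]
  congr 1
  refine Finset.sum_congr rfl fun α _ => ?_
  rw [phi, coe_eval₂Hom, eval₂_monomial, monomial_pow, monomial_eq, Finsupp.prod_fintype _ _
    (by simp), Finsupp.prod_fintype _ _ (by simp)]
  simp [← pow_mul]

/-- `Δ(G)(s,0)`: the reduction to `k[s][x]` of `(G̃^p - φ(G̃)) / p`, where
`G̃ = ∑ s_α x^α ∈ W(k)[s][x]`. The quotient exists, and it is unique if `k` has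
characteristic `p`, because then `p` is not a zero divisor in `W(k)`. -/
def deltaG : MvPolynomial (Fin (N + 1)) (MvPolynomial (Lam q) k) :=
  MvPolynomial.map (MvPolynomial.map WittVector.constantCoeff)
    (Classical.choose (exists_delta q p k))

/-- `G_n(s,0) = G^(p^n - p^(n-1) - ⋯ - p - 2) * Δ(G)^(p^(n-2) + ⋯ + p + 1)` for `n ≥ 1`,
so `G_1 = G^(p-2)`. The exponents are nonnegative, so the subtraction does not truncate. -/
def polyG (n : ℕ) : MvPolynomial (Fin (N + 1)) (MvPolynomial (Lam q) k) :=
  univG q k ^ (p ^ n - (∑ i ∈ Finset.Ico 1 n, p ^ i) - 2) *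
    deltaG q p k ^ (∑ i ∈ Finset.range (n - 1), p ^ i)

/-- `H_n(s,0) ∈ k[s]`: the coefficient of `(x_0 ⋯ x_N)^(p^n - 1)` in `G(s) G_n(s,0)`. -/
def polyH (n : ℕ) : MvPolynomial (Lam q) k :=
  coeff (Finsupp.equivFunOnFinite.symm fun _ => p ^ n - 1) (univG q k * polyG q p k n)

/-- The Jacobian matrix `(∂H_i/∂s_α)` of `H_1(s,0), …, H_n(s,0)`. -/
def jacobianL (n : ℕ) : Matrix (Fin n) (Lam q) (MvPolynomial (Lam q) k) :=
  fun i α => pderiv α (polyH q p k ((i : ℕ) + 1))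

/-- `Z_n ⊆ k^m`: the common zeros of `H_1(s,0), …, H_n(s,0)` and of the ideal generated by the
`n × n` minors of their Jacobian matrix. -/
def locusZ (n : ℕ) : Set (Lam q → k) :=
  zeroLocus k
    (Ideal.span (Set.range fun i : Fin n => polyH q p k ((i : ℕ) + 1)) ⊔
      Ideal.span (Set.range fun e : Fin n ↪ Lam q => ((jacobianL q p k n).submatrix id e).det))

variable {k}

/-- `τ(b)`: the least `n ≥ 1` with `b ∈ Z_n`, and `∞` if there is none. -/
def tau (b : Lam q → k) : ℕ∞ :=
  sInf {m : ℕ∞ | ∃ n : ℕ, 0 < n ∧ m = n ∧ b ∈ locusZ q p k n}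

end Universal

end NonSplit

end

/-! Write `f = G(b)`, `Δ = Δ(G)(b,0)`, `K = Frac R`, and let `u` be the `p⁻¹`-linear trace on `K`
that sends `x ^ (p - 1)` to `1`. The theorem is a Fedder-type criterion for the pairs, followed by
linear algebra on the Jacobian rows.

A splitting extends to an additive map `σ : W(K) → K` that is Frobenius-semilinear and kills `p` and
`V ^ n`. A ring section `K → W(K) / p`, with `x_j ↦ [x_j]`, turns `σ` on `V ^ i W(K)` into a `p ^
(-(i+1))`-linear map on `K` modulo deeper terms, so duality gives `τ_i` with `σ (V ^ i w) = u ^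
(i+1) (τ_i y)` for every lift `w` of `y`. Since `V F = p`, one has `u (τ_i) = 0` for `i > 0`;
conversely every such sequence comes from a functional (`exists_functional`).

To control poles along `f`, write `[f] = S + V δ` with `S` a lift of `f`. Then `δ ≡ Z + V ([f ^ (p²
- p)] δ)` modulo `p`, with `Z` a lift of `Δ` (`dvd_delta_sub`), and this is where `Δ` enters.
Integrality on the divisorial sections becomes `τ_i = f ^ (p ^ (i+1) - 2) r_i` with `r_i` integral,
`r_i ∈ f R - u (f ^ (p-2) Δ r_{i+1})` and `u (f ^ (p-2) r_{i+1}) = 0`; the splitting becomes the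
condition that `u (f ^ (p-2) r_0)` is a unit (`isQuasiFSplitPair_iff_chain`). The allowed pole
orders are rounded correctly only for squarefree `f`, but for `n > 1` a chain forces `f` to be
squarefree (`StarCond.trace_of_sq_dvd`). Clearing denominators makes the `r_i` polynomials.

Put `g_n = G_{n+1}(b,0)` and `θ_n(a) = u ^ (n+1) (g_n a)`. The chain relation gives `θ_i(r_j) =
θ_i(f d) - θ_{i+1}(r_{j+1})`. The polynomial `g_n` is weighted homogeneous, and its degree is
exactly `d` less than that of `x ^ (p ^ (n+1) - 1)`. So `θ_n(a)` has constant term depending only on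
the degree `d` part of `a`, linearly in its coefficients up to a `p`-power root. The coefficients of
this linear form are those of the row `-∂H_{n+1}/∂s_α (b)` once `H_1, …, H_n` vanish at `b`
(`eval_pderiv_polyH`).

If some `H_{h+1}(b)` with `h ≤ n` is nonzero, `a = f` yields a chain of length `n + 1`. If `H_1, …,
H_n` vanish at `b`, such a chain exists exactly when the last of the first `n + 1` rows is not in
the span of the others (`exists_polyChain_iff`). Hence failure at `n` puts `b` in `Z_n`, while `b ∈
Z_n` gives failure at some `m ≤ n`, and the two infima agree. -/

namespace NonSplit
open WittVector

/-! ### Congruences modulo `p` and `p²` in Witt vectors -/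

section WittCongruences

variable {p : ℕ} [hp : Fact p.Prime] {L : Type*} [CommRing L]

theorem verschiebung_sq (x : WittVector p L) :
    verschiebung x ^ 2 = (p : WittVector p L) * verschiebung (x ^ 2) := by
  rw [sq, ← verschiebung_mul_frobenius, frobenius_verschiebung, ← mul_assoc, ← sq,
    ← nsmul_eq_mul, ← map_nsmul, nsmul_eq_mul, mul_comm]

theorem verschiebung_nat_mul (m : ℕ) (x : WittVector p L) :
    verschiebung ((m : WittVector p L) * x) = (m : WittVector p L) * verschiebung x := by
  rw [← nsmul_eq_mul, map_nsmul, nsmul_eq_mul]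

theorem verschiebung_pow_succ (x : WittVector p L) (j : ℕ) :
    verschiebung x ^ (j + 1) = (p : WittVector p L) ^ j * verschiebung (x ^ (j + 1)) := by
  induction j with
  | zero => simp
  | succ j ih =>
    rw [pow_succ, ih, mul_assoc, ← verschiebung_mul_frobenius, frobenius_verschiebung,
      ← mul_assoc, ← pow_succ, mul_comm (x ^ (j + 1 + 1)), verschiebung_nat_mul, ← mul_assoc,
      ← pow_succ]

theorem exists_verschiebung_eq {w : WittVector p L} (h : w.coeff 0 = 0) :
    ∃ w', w = verschiebung w' ∧ ∀ i, w'.coeff i = w.coeff (i + 1) := by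
  refine ⟨WittVector.mk p fun i => w.coeff (i + 1), ?_, fun i => rfl⟩
  ext i
  cases i with
  | zero => rw [h, verschiebung_coeff_zero]
  | succ i => rw [verschiebung_coeff_succ, coeff_mk]

theorem iterate_verschiebung_add (i : ℕ) (x y : WittVector p L) :
    verschiebung^[i] (x + y) = verschiebung^[i] x + verschiebung^[i] y :=
  iterate_map_add _ _ _ _

theorem iterate_verschiebung_nat_mul (i m : ℕ) (x : WittVector p L) :
    verschiebung^[i] ((m : WittVector p L) * x) = (m : WittVector p L) * verschiebung^[i] x := by
  induction i with
  | zero => rfl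
  | succ i ih => rw [Function.iterate_succ_apply', ih, verschiebung_nat_mul,
      Function.iterate_succ_apply']

theorem exists_eq_teichmuller_add (w : WittVector p L) :
    ∃ w', w = teichmuller p (w.coeff 0) + verschiebung w' ∧
      ∀ i, w'.coeff i = w.coeff (i + 1) := by
  refine ⟨WittVector.mk p fun i => w.coeff (i + 1), ?_, fun i => rfl⟩
  ext i
  rw [coeff_add_of_disjoint]
  · cases i with
    | zero => simp
    | succ i =>
      rw [teichmuller_coeff_pos _ _ _ (Nat.succ_pos _), verschiebung_coeff_succ, coeff_mk,
        zero_add]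
  · intro i
    cases i with
    | zero => right; simp
    | succ i => left; exact teichmuller_coeff_pos _ _ _ (Nat.succ_pos _)

variable [CharP L p]

theorem frobenius_teichmuller (c : L) :
    frobenius (teichmuller p c) = teichmuller p (c ^ p) := by
  ext j
  rw [coeff_frobenius_charP]
  cases j with
  | zero => rw [teichmuller_coeff_zero, teichmuller_coeff_zero]
  | succ j =>
    rw [teichmuller_coeff_pos _ _ _ (Nat.succ_pos _),
      teichmuller_coeff_pos _ _ _ (Nat.succ_pos _), zero_pow hp.out.ne_zero]

theorem teichmuller_mul_iterate_verschiebung (c : L) (w : WittVector p L) (i : ℕ) :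
    teichmuller p c * verschiebung^[i] w = verschiebung^[i] (teichmuller p (c ^ p ^ i) * w) := by
  induction i generalizing c with
  | zero => simp
  | succ i ih =>
    rw [Function.iterate_succ_apply', mul_comm, ← verschiebung_mul_frobenius,
      frobenius_teichmuller, mul_comm, ih, Function.iterate_succ_apply', ← pow_mul, pow_succ']

/-- With `w = [w_0] + V v`, both sides reduce to `[w_0] ^ p`: `F V = p`, and `(V v) ^ 2` is a
multiple of `p`. So `F` acts on `W(L) / p` as the `p`-th power map. -/
theorem dvd_pow_sub_frobenius (w : WittVector p L) :
    (p : WittVector p L) ∣ w ^ p - frobenius w := by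
  obtain ⟨v, hv, -⟩ := exists_eq_teichmuller_add w
  obtain ⟨r, hr⟩ := exists_add_pow_prime_eq hp.out (teichmuller p (w.coeff 0)) (verschiebung v)
  obtain ⟨m, hm⟩ : ∃ m, p = m + 2 := ⟨p - 2, by have := hp.out.two_le; omega⟩
  have h1 : (p : WittVector p L) ∣ verschiebung v ^ p := by
    have : verschiebung v ^ p = verschiebung v ^ 2 * verschiebung v ^ m := by
      rw [← pow_add]; congr 1; omega
    rw [this, verschiebung_sq, mul_assoc]
    exact dvd_mul_right _ _
  obtain ⟨t, ht⟩ := h1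
  conv_rhs => rw [hv]
  rw [hr, map_add, frobenius_teichmuller, map_pow, frobenius_verschiebung, ht]
  refine ⟨t + teichmuller p (w.coeff 0) * verschiebung v * r - v, ?_⟩
  ring

theorem dvd_iterate_verschiebung_frobenius (i : ℕ) (w : WittVector p L) :
    verschiebung^[i + 1] (frobenius w) = (p : WittVector p L) * verschiebung^[i] w := by
  rw [Function.iterate_succ_apply, verschiebung_frobenius, mul_comm, iterate_verschiebung_nat_mul]

theorem dvd_verschiebung_pow (w : WittVector p L) :
    (p : WittVector p L) ^ 2 ∣ verschiebung w ^ p := by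
  obtain ⟨t, ht⟩ := dvd_pow_sub_frobenius w
  obtain ⟨m, hm⟩ : ∃ m, p = m + 1 + 1 := ⟨p - 2, by have := hp.out.two_le; omega⟩
  have h1 : verschiebung w ^ p = (p : WittVector p L) ^ (m + 1) * verschiebung (w ^ p) := by
    have := verschiebung_pow_succ w (m + 1)
    rwa [← hm] at this
  -- `w ^ p ≡ F w` and `V F = p` supply one more factor `p`, which is indispensable for `p = 2`.
  have h2 : verschiebung (w ^ p) = (p : WittVector p L) * (w + verschiebung t) := by
    rw [sub_eq_iff_eq_add.1 ht, map_add, verschiebung_nat_mul, verschiebung_frobenius]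
    ring
  rw [h1, h2]
  refine ⟨(p : WittVector p L) ^ m * (w + verschiebung t), by ring⟩

/-- In the binomial expansion, the terms with at least two factors `V w` are divisible by `p` once
through `(V w) ^ 2` and once through the binomial coefficient; the pure power of `V w` is handled by
`dvd_verschiebung_pow`. -/
theorem dvd_sub_verschiebung_pow (a w : WittVector p L) :
    (p : WittVector p L) ^ 2 ∣ (a - verschiebung w) ^ p -
      (a ^ p - (p : WittVector p L) * (a ^ (p - 1) * verschiebung w)) := by
  obtain ⟨m, hm⟩ : ∃ m, p = m + 1 := ⟨p - 1, by have := hp.out.two_le; omega⟩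
  have hs : (a - verschiebung w) ^ p = ∑ j ∈ Finset.range m,
      a ^ j * (-verschiebung w) ^ (p - j) * (p.choose j) +
      a ^ (p - 1) * (-verschiebung w) * p + a ^ p := by
    have h0 := add_pow a (-verschiebung w) p
    rw [Finset.sum_range_succ, Finset.sum_congr (congrArg Finset.range hm) (fun _ _ => rfl),
      Finset.sum_range_succ] at h0
    have e1 : p - m = 1 := by omega
    have e2 : p.choose m = p := by
      rw [hm]; exact Nat.choose_succ_self_right m
    rw [sub_eq_add_neg, h0, e1, e2, show p - 1 = m by omega]
    simp
  have hd : (p : WittVector p L) ^ 2 ∣ ∑ j ∈ Finset.range m,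
      a ^ j * (-verschiebung w) ^ (p - j) * (p.choose j) := by
    refine Finset.dvd_sum fun j hj => ?_
    rw [Finset.mem_range] at hj
    rcases Nat.eq_zero_or_pos j with rfl | hj0
    · simp only [pow_zero, Nat.sub_zero, Nat.choose_zero_right, Nat.cast_one, mul_one, one_mul]
      rw [neg_pow]
      exact (dvd_verschiebung_pow w).mul_left _
    · have h1 : (p : WittVector p L) ∣ (p.choose j : WittVector p L) :=
        Nat.cast_dvd_cast (hp.out.dvd_choose_self hj0.ne' (by omega))
      have h2 : (p : WittVector p L) ∣ (-verschiebung w) ^ (p - j) := by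
        obtain ⟨l, hl⟩ : ∃ l, p - j = 2 + l := ⟨p - j - 2, by omega⟩
        rw [hl, pow_add, neg_sq, verschiebung_sq, mul_assoc]
        exact dvd_mul_right _ _
      rw [sq]
      exact mul_dvd_mul (h2.mul_left _) h1
  obtain ⟨t, ht⟩ := hd
  refine ⟨t, ?_⟩
  rw [hs, ht]
  ring

/-- If `[f] = S + V δ` and `p Z = S ^ p - F S`, then `δ ≡ Z + V ([f ^ (p² - p)] δ)` modulo `p`. -/
theorem dvd_delta_sub [IsDomain L] {f : L} {S δ Z : WittVector p L}
    (hf : teichmuller p f = S + verschiebung δ)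
    (hZ : (p : WittVector p L) * Z = S ^ p - frobenius S) :
    (p : WittVector p L) ∣ δ - (Z + verschiebung (teichmuller p (f ^ (p * (p - 1))) * δ)) := by
  obtain ⟨t, ht⟩ := dvd_sub_verschiebung_pow (teichmuller p f) δ
  have hS : S = teichmuller p f - verschiebung δ := by rw [hf]; ring
  rw [← hS] at ht
  have hFS : frobenius S = teichmuller p f ^ p - δ * p := by
    rw [hS, map_sub, frobenius_teichmuller, frobenius_verschiebung, map_pow]
  have hV : verschiebung (teichmuller p (f ^ (p * (p - 1))) * δ) =
      teichmuller p f ^ (p - 1) * verschiebung δ := by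
    have := teichmuller_mul_iterate_verschiebung (f ^ (p - 1)) δ 1
    simp only [Function.iterate_one, pow_one] at this
    rw [mul_comm p, pow_mul, ← this, map_pow]
  refine ⟨-t, ?_⟩
  -- There is no `p`-torsion, so it suffices to compare after multiplication by `p`, where `p Z = S
  -- ^ p - F S` can be expanded modulo `p²`.
  apply mul_left_cancel₀ (p_nonzero p L)
  rw [hV]
  have e : S ^ p = teichmuller p f ^ p - (p : WittVector p L) * (teichmuller p f ^ (p - 1) *
      verschiebung δ) + (p : WittVector p L) ^ 2 * t := by rw [← ht]; ring
  rw [mul_sub, mul_add, hZ, hFS, e]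
  ring

end WittCongruences
end NonSplit

namespace NonSplit
set_option linter.unusedSectionVars false
open WittVector

/-! ### Duality for `p⁻¹`-linear maps on a field -/

section Trace

variable {p : ℕ} [hp : Fact p.Prime] {K : Type*} [Field K]

/-- A `p⁻¹`-linear trace on `K` which preserves the subring `B`, together with dual bases of `K`
over `K ^ p` which lie in `B`. -/
structure TraceData (p : ℕ) {K : Type*} [Field K] (B : Subring K) where
  /-- the trace -/
  u : K →+ K
  map_pow_mul : ∀ c y, u (c ^ p * y) = c * u y
  map_mem : ∀ y ∈ B, u y ∈ B
  /-- the index type of the bases -/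
  ι : Type
  fin : Fintype ι
  /-- the basis -/
  e : ι → K
  /-- the dual basis -/
  e' : ι → K
  e_mem : ∀ i, e i ∈ B
  e'_mem : ∀ i, e' i ∈ B
  expand : ∀ y, y = ∑ i, u (e' i * y) ^ p * e i

attribute [instance] TraceData.fin

namespace TraceData

variable {B : Subring K} (T : TraceData p B)

theorem iterate_add (m : ℕ) (y z : K) : T.u^[m] (y + z) = T.u^[m] y + T.u^[m] z :=
  iterate_map_add _ _ _ _

theorem iterate_zero_apply (m : ℕ) : T.u^[m] 0 = 0 := iterate_map_zero _ _

theorem iterate_pow_mul (m : ℕ) (c y : K) : T.u^[m] (c ^ p ^ m * y) = c * T.u^[m] y := by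
  induction m generalizing c y with
  | zero => simp
  | succ m ih =>
    rw [Function.iterate_succ_apply, pow_succ, pow_mul, T.map_pow_mul, ih,
      Function.iterate_succ_apply]

theorem iterate_mem (m : ℕ) {y : K} (hy : y ∈ B) : T.u^[m] y ∈ B := by
  induction m generalizing y with
  | zero => exact hy
  | succ m ih => rw [Function.iterate_succ_apply]; exact ih (T.map_mem _ hy)

theorem eq_zero_of_forall {z : K} (h : ∀ y, T.u (y * z) = 0) : z = 0 := by
  rw [T.expand z]
  simp [h, hp.out.ne_zero]

theorem iterate_eq_zero {m : ℕ} {z : K} (h : ∀ y, T.u^[m] (y * z) = 0) : z = 0 := by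
  induction m generalizing z with
  | zero => simpa using h 1
  | succ m ih =>
    refine T.eq_zero_of_forall fun y => ih fun c => ?_
    rw [← T.map_pow_mul, ← Function.iterate_succ_apply, ← mul_assoc]
    exact h _

/-- The coordinates of `z` in the basis `e` are the values `u (e' i * z)`, so integrality of the
pairing with all of `B` already forces `z ∈ B`. -/
theorem iterate_mem_of_forall {m : ℕ} {z : K} (h : ∀ y ∈ B, T.u^[m] (y * z) ∈ B) : z ∈ B := by
  induction m generalizing z with
  | zero => simpa using h 1 B.one_mem
  | succ m ih =>
    have h1 : ∀ y ∈ B, T.u (y * z) ∈ B := fun y hy => ih fun c hc => by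
      rw [← T.map_pow_mul, ← Function.iterate_succ_apply, ← mul_assoc]
      exact h _ (B.mul_mem (B.pow_mem hc _) hy)
    rw [T.expand z]
    exact B.sum_mem fun i _ => B.mul_mem (B.pow_mem (h1 _ (T.e'_mem i)) _) (T.e_mem i)

/-- Iterated traces generate all `p ^ (-m)`-linear functionals. One root is split off at a time: `χ`
is the adjoint determined by `u (z * χ y) = ψ (z ^ p ^ m * y)`, and it is linear over one root less.
-/
theorem exists_dual [CharP K p] (m : ℕ) (ψ : K →+ K)
    (hψ : ∀ c y, ψ (c ^ p ^ m * y) = c * ψ y) : ∃ t, ∀ y, ψ y = T.u^[m] (t * y) := by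
  induction m generalizing ψ with
  | zero => exact ⟨ψ 1, fun y => by simpa [mul_comm] using hψ y 1⟩
  | succ m ih =>
    let χ : K →+ K := ∑ i, (((AddMonoidHom.mulRight (T.e' i)).comp
      (frobenius K p).toAddMonoidHom).comp ψ).comp (AddMonoidHom.mulLeft (T.e i ^ p ^ m))
    have hχ : ∀ y, χ y = ∑ i, ψ (T.e i ^ p ^ m * y) ^ p * T.e' i := fun y => by
      simp [χ, frobenius_def]
    have hu : ∀ z y, T.u (z * χ y) = ψ (z ^ p ^ m * y) := by
      intro z y
      conv_rhs => rw [T.expand z]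
      rw [sum_pow_char_pow, Finset.sum_mul, map_sum, hχ, Finset.mul_sum, map_sum]
      refine Finset.sum_congr rfl fun i _ => ?_
      rw [mul_pow, ← pow_mul, ← pow_succ', mul_assoc, hψ, mul_left_comm, T.map_pow_mul, mul_comm z,
        mul_comm]
    obtain ⟨t, ht⟩ := ih χ fun c y => by
      refine sub_eq_zero.1 (T.eq_zero_of_forall fun z => ?_)
      rw [mul_sub, map_sub, hu, ← mul_assoc z c, hu, mul_pow, mul_assoc, sub_self]
    refine ⟨t, fun y => ?_⟩
    rw [Function.iterate_succ_apply', ← ht, ← one_mul (χ y), hu, one_pow, one_mul]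

end TraceData

end Trace

/-! ### Ring sections of `W(K) / p → K` -/

section Section

variable {p : ℕ} [hp : Fact p.Prime] {K : Type*} [Field K]

/-- The Witt vectors with all components in `B`. -/
noncomputable def wittOver (p : ℕ) [Fact p.Prime] {K : Type*} [CommRing K] (B : Subring K) :
    Subring (WittVector p K) := (WittVector.map B.subtype).range

theorem mem_wittOver {B : Subring K} {w : WittVector p K} :
    w ∈ wittOver p B ↔ ∀ i, w.coeff i ∈ B := by
  constructor
  · rintro ⟨y, rfl⟩ i
    rw [map_coeff]
    exact (y.coeff i).2
  · intro h
    refine ⟨WittVector.mk p fun i => ⟨w.coeff i, h i⟩, ?_⟩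
    ext i
    simp [map_coeff]

theorem teichmuller_mem_wittOver {B : Subring K} {c : K} (hc : c ∈ B) :
    teichmuller p c ∈ wittOver p B := by
  rw [mem_wittOver]
  intro i
  cases i with
  | zero => rwa [teichmuller_coeff_zero]
  | succ i => rw [teichmuller_coeff_pos _ _ _ (Nat.succ_pos _)]; exact B.zero_mem

theorem frobenius_mem_wittOver [CharP K p] {B : Subring K} {w : WittVector p K}
    (hw : w ∈ wittOver p B) : WittVector.frobenius w ∈ wittOver p B := by
  rw [mem_wittOver] at hw ⊢
  intro i
  rw [coeff_frobenius_charP]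
  exact B.pow_mem (hw i) _

/-- A multiplicative section `s` of `W(K) / p → K` such that elements of the subring `B` have
lifts with components in `B`. -/
structure SectionData (p : ℕ) [Fact p.Prime] {K : Type*} [Field K] (B : Subring K) where
  /-- the section -/
  s : K →+* WittVector p K ⧸ Ideal.span {(p : WittVector p K)}
  coeff_zero : ∀ y w, Ideal.Quotient.mk _ w = s y → w.coeff 0 = y
  exists_lift : ∀ y ∈ B, ∃ w ∈ wittOver p B, Ideal.Quotient.mk _ w = s y

namespace SectionData

variable {B : Subring K} (s : SectionData p B)

/-- `w` represents `s y`. -/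
def IsLift (w : WittVector p K) (y : K) : Prop := Ideal.Quotient.mk _ w = s.s y

variable {s}

theorem IsLift.coeff_zero {w : WittVector p K} {y : K} (h : s.IsLift w y) : w.coeff 0 = y :=
  s.coeff_zero y w h

theorem IsLift.mul {w w' : WittVector p K} {y y' : K} (h : s.IsLift w y) (h' : s.IsLift w' y') :
    s.IsLift (w * w') (y * y') := by
  unfold IsLift at *; rw [map_mul, map_mul, h, h']

theorem IsLift.add {w w' : WittVector p K} {y y' : K} (h : s.IsLift w y) (h' : s.IsLift w' y') :
    s.IsLift (w + w') (y + y') := by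
  unfold IsLift at *; rw [map_add, map_add, h, h']

theorem isLift_one : s.IsLift 1 1 := by
  unfold IsLift; rw [map_one, map_one]

theorem IsLift.dvd_sub {w w' : WittVector p K} {y : K} (h : s.IsLift w y) (h' : s.IsLift w' y) :
    (p : WittVector p K) ∣ w - w' := by
  rw [← Ideal.mem_span_singleton, ← Ideal.Quotient.eq]
  exact h.trans h'.symm

theorem IsLift.of_dvd_sub {w w' : WittVector p K} {y : K} (h : s.IsLift w y)
    (h' : (p : WittVector p K) ∣ w - w') : s.IsLift w' y := by
  rw [← Ideal.mem_span_singleton, ← Ideal.Quotient.eq] at h'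
  exact h'.symm.trans h

theorem isLift_zero_of_dvd {w : WittVector p K} (h : (p : WittVector p K) ∣ w) :
    s.IsLift w 0 := by
  unfold IsLift
  rw [map_zero, Ideal.Quotient.eq_zero_iff_mem, Ideal.mem_span_singleton]
  exact h

variable (s) in
theorem exists_isLift (y : K) : ∃ w, s.IsLift w y := Ideal.Quotient.mk_surjective _

theorem IsLift.frobenius [CharP K p] {w : WittVector p K} {y : K} (h : s.IsLift w y) :
    s.IsLift (WittVector.frobenius w) (y ^ p) := by
  refine IsLift.of_dvd_sub (w := w ^ p) ?_ (dvd_pow_sub_frobenius w)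
  unfold IsLift at *; rw [map_pow, map_pow, h]

variable (s) in
-- If `w = [c] + V v` lifts `c`, then `F w = [c ^ p] + p v` lifts `c ^ p`. Thus every section agrees
-- with the Teichmüller map on `p`-th powers.
theorem isLift_teichmuller_pow [CharP K p] (c : K) : s.IsLift (teichmuller p (c ^ p)) (c ^ p) := by
  obtain ⟨w, hw⟩ := s.exists_isLift c
  obtain ⟨v, hv, -⟩ := exists_eq_teichmuller_add w
  refine hw.frobenius.of_dvd_sub ⟨v, ?_⟩
  conv_lhs => rw [hv]
  rw [map_add, frobenius_teichmuller, frobenius_verschiebung, hw.coeff_zero]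
  ring

variable (s) in
theorem isLift_teichmuller_pow_pow [CharP K p] (c : K) (i : ℕ) :
    s.IsLift (teichmuller p (c ^ p ^ (i + 1))) (c ^ p ^ (i + 1)) := by
  have := s.isLift_teichmuller_pow (c ^ p ^ i)
  rwa [← pow_mul, ← pow_succ] at this

end SectionData

end Section

/-! ### Functionals on Witt vectors and their representing sequences -/

section Functional

variable {p : ℕ} [hp : Fact p.Prime] {K : Type*} [Field K]

/-- Additive maps `W(K) → K` which are `W_n(K)`-linear maps `F_* W_n(K) → K`. -/
structure IsWittFunctional (n : ℕ) (σ : WittVector p K →+ K) : Prop where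
  semilinear : ∀ c w, σ (teichmuller p (c ^ p) * w) = c * σ w
  map_p_mul : ∀ w, σ ((p : WittVector p K) * w) = 0
  map_verschiebung : ∀ w, σ (verschiebung^[n] w) = 0

variable {B : Subring K} {n : ℕ} {σ : WittVector p K →+ K}

theorem IsWittFunctional.map_verschiebung_of_le (h : IsWittFunctional n σ) {m : ℕ} (hm : n ≤ m)
    (w : WittVector p K) : σ (verschiebung^[m] w) = 0 := by
  obtain ⟨l, rfl⟩ := Nat.exists_eq_add_of_le hm
  rw [Function.iterate_add_apply]
  exact h.map_verschiebung _

theorem IsWittFunctional.congr (h : IsWittFunctional n σ) (i : ℕ) {w w' : WittVector p K}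
    (hw : (p : WittVector p K) ∣ w - w') : σ (verschiebung^[i] w) = σ (verschiebung^[i] w') := by
  obtain ⟨t, ht⟩ := hw
  rw [sub_eq_iff_eq_add.1 ht, iterate_verschiebung_add, iterate_verschiebung_nat_mul, map_add,
    h.map_p_mul, zero_add]

variable [CharP K p]

theorem IsWittFunctional.semilinear_iterate (h : IsWittFunctional n σ) (i : ℕ) (c : K)
    (w : WittVector p K) : σ (verschiebung^[i] (teichmuller p (c ^ p ^ (i + 1)) * w)) =
      c * σ (verschiebung^[i] w) := by
  rw [← h.semilinear, teichmuller_mul_iterate_verschiebung, ← pow_mul, ← pow_succ']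

/-- The sequence `τ` represents `σ`. -/
def Represents (T : TraceData p B) (s : SectionData p B) (σ : WittVector p K →+ K) (n : ℕ)
    (τ : ℕ → K) : Prop :=
  ∀ i < n, ∀ w y, s.IsLift w y → σ (verschiebung^[i] w) = T.u^[i + 1] (τ i * y)

/-- Because `σ` kills `p`, the value `σ (V ^ i w)` depends only on `w` modulo `p`. Composed with the
section it is a `p ^ (-(i+1))`-linear map on `K`, to which duality applies. -/
theorem IsWittFunctional.exists_represents (h : IsWittFunctional n σ) (T : TraceData p B)
    (s : SectionData p B) : ∃ τ, Represents T s σ n τ := by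
  choose l hl using s.exists_isLift
  have key : ∀ i, ∃ t, ∀ w y, s.IsLift w y → σ (verschiebung^[i] w) = T.u^[i + 1] (t * y) := by
    intro i
    let ψ : K →+ K := AddMonoidHom.mk' (fun y => σ (verschiebung^[i] (l y))) fun y z => by
      rw [h.congr i ((hl (y + z)).dvd_sub ((hl y).add (hl z))), iterate_verschiebung_add, map_add]
    obtain ⟨t, ht⟩ := T.exists_dual (i + 1) ψ fun c y => by
      change σ _ = c * σ _
      rw [h.congr i ((hl _).dvd_sub ((s.isLift_teichmuller_pow_pow c i).mul (hl y))),
        h.semilinear_iterate]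
    refine ⟨t, fun w y hw => ?_⟩
    rw [← ht, h.congr i (hw.dvd_sub (hl y))]
    rfl
  choose τ hτ using key
  exact ⟨τ, fun i _ => hτ i⟩

/-- `V ^ (i+1) F = p V ^ i` is killed by `σ`, while `F [y]` lifts `y ^ p`; nondegeneracy of the
iterated trace concludes. -/
theorem Represents.trace_eq_zero {T : TraceData p B} {s : SectionData p B} {τ : ℕ → K}
    (h : IsWittFunctional n σ) (hτ : Represents T s σ n τ) {i : ℕ} (hi : i + 1 < n) :
    T.u (τ (i + 1)) = 0 := by
  refine T.iterate_eq_zero (m := i + 1) fun y => ?_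
  rw [← T.map_pow_mul, ← Function.iterate_succ_apply, mul_comm,
    ← hτ (i + 1) hi _ _ (s.isLift_teichmuller_pow y), ← frobenius_teichmuller,
    dvd_iterate_verschiebung_frobenius, h.map_p_mul]

theorem Represents.map_one {T : TraceData p B} {s : SectionData p B} {τ : ℕ → K}
    (hn : 0 < n) (hτ : Represents T s σ n τ) : σ 1 = T.u (τ 0) := by
  simpa using hτ 0 hn 1 1 SectionData.isLift_one

/-- The data `[f] = S + V δ`, `p Z = S ^ p - F S` with `S` a lift of `f` and `Z` a lift of `Δ`. -/
structure IsDelta (s : SectionData p B) (f Δ : K) (δ : WittVector p K) : Prop where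
  mem : δ ∈ wittOver p B
  exists_lift : ∃ S Z, s.IsLift S f ∧ s.IsLift Z Δ ∧ teichmuller p f = S + verschiebung δ ∧
    (p : WittVector p K) * Z = S ^ p - WittVector.frobenius S

/-- `[f] w = S w + V (δ F w)`, and modulo `p` the factor `δ` is `Z` plus a term in the image of `V`.
The terms with `S` and `Z` together produce `τ_i f + u (τ_{i+1} Δ)`; everything else lies two steps
deeper in the `V`-filtration. -/
theorem Represents.teichmuller_mul {T : TraceData p B} {s : SectionData p B} {τ : ℕ → K}
    {f Δ : K} {δ : WittVector p K} (hδ : IsDelta s f Δ δ)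
    (h : IsWittFunctional n σ) (hτ : Represents T s σ n τ) {i : ℕ} (hi : i + 1 < n)
    {w : WittVector p K} {y : K} (hw : s.IsLift w y) :
    σ (verschiebung^[i] (teichmuller p f * w)) =
      T.u^[i + 1] (y * (τ i * f + T.u (τ (i + 1) * Δ))) +
        σ (verschiebung^[i + 2] (teichmuller p (f ^ (p * (p - 1))) *
          (δ * WittVector.frobenius (WittVector.frobenius w)))) := by
  obtain ⟨S, Z, hS, hZ, hf, hSZ⟩ := hδ.exists_lift
  obtain ⟨t, ht⟩ := dvd_delta_sub hf hSZ
  have e1 : teichmuller p f * w = S * w + verschiebung (δ * WittVector.frobenius w) := by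
    rw [hf, add_mul, verschiebung_mul_frobenius]
  have e2 : σ (verschiebung^[i + 1] (δ * WittVector.frobenius w)) =
      σ (verschiebung^[i + 1] (Z * WittVector.frobenius w + verschiebung
        (teichmuller p (f ^ (p * (p - 1))) *
          (δ * WittVector.frobenius (WittVector.frobenius w))))) := by
    refine h.congr _ ⟨t * WittVector.frobenius w, ?_⟩
    rw [← mul_assoc, verschiebung_mul_frobenius, ← mul_assoc, ← ht]
    ring
  rw [e1, iterate_verschiebung_add, map_add, hτ i (by omega) _ _ (hS.mul hw),
    ← Function.iterate_succ_apply, e2, iterate_verschiebung_add, map_add,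
    hτ (i + 1) hi _ _ (hZ.mul hw.frobenius), ← Function.iterate_succ_apply, ← add_assoc]
  congr 1
  rw [mul_add, T.iterate_add, ← T.map_pow_mul, ← Function.iterate_succ_apply]
  congr 2 <;> ring_nf

end Functional
end NonSplit

namespace NonSplit
set_option linter.unusedSectionVars false
open WittVector

/-! ### Integrality along `f` in terms of the representing sequence -/

section Criterion

variable {p : ℕ} [hp : Fact p.Prime] {K : Type*} [Field K] [CharP K p] {B : Subring K}

/-- A sequence `τ` with `u (τ i) = 0` for `0 < i < n` represents a functional. -/
theorem exists_functional_aux (T : TraceData p B) (s : SectionData p B) (n : ℕ) :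
    ∀ (m : ℕ) (τ : ℕ → K), (∀ i, i + 1 < n → T.u (τ (i + 1)) = 0) →
      ∃ Θ : WittVector p K →+ K,
        (∀ c w, Θ (teichmuller p (c ^ p ^ (m + 1)) * w) = c * Θ w) ∧
        (∀ w, Θ ((p : WittVector p K) * w) = 0) ∧ (∀ w, Θ (verschiebung^[n] w) = 0) ∧
        (∀ i < n, ∀ w y, s.IsLift w y → Θ (verschiebung^[i] w) = T.u^[m + 1 + i] (τ i * y)) ∧
        ((n = 0 ∨ T.u (τ 0) = 0) → ∀ w, Θ (WittVector.frobenius w) = 0) := by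
  induction n with
  | zero => exact fun m τ _ => ⟨0, by simp⟩
  | succ n ih =>
    intro m τ hτ
    -- On `V W(K)` the functional must be linear over one more `p`-th root, hence `m + 1` together
    -- with the shifted sequence.
    obtain ⟨Θ', h1, h2, h3, h4, h5⟩ := ih (m + 1) (fun i => τ (i + 1))
      (fun i hi => hτ (i + 1) (by omega))
    replace h5 := h5 (by
      rcases Nat.eq_zero_or_pos n with h | h
      · exact Or.inl h
      · exact Or.inr (hτ 0 (by omega)))
    choose l hl using s.exists_isLift
    have hsplit : ∀ w : WittVector p K, ∃ v, w = l (w.coeff 0) + verschiebung v := by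
      intro w
      have : (w - l (w.coeff 0)).coeff 0 = 0 := by
        have := map_sub (WittVector.constantCoeff (p := p) (R := K)) w (l (w.coeff 0))
        simp only [WittVector.constantCoeff_apply] at this
        rw [this, (hl _).coeff_zero, sub_self]
      obtain ⟨v, hv, -⟩ := exists_verschiebung_eq this
      exact ⟨v, by rw [← hv]; ring⟩
    choose r hr using hsplit
    -- Changing the lift `x` by `p t = V F t` changes `v` by `F t`. The vanishing of `Θ'` on the
    -- image of `F`, that is the trace condition on the shifted sequence, makes `Θ` well defined.
    have huniq : ∀ w x v, s.IsLift x (w.coeff 0) → w = x + verschiebung v → Θ' (r w) = Θ' v := by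
      intro w x v hx hw
      obtain ⟨t, ht⟩ := hx.dvd_sub (hl (w.coeff 0))
      have : verschiebung (r w) = verschiebung (v + WittVector.frobenius t) := by
        have h := hr w
        rw [map_add, verschiebung_frobenius, mul_comm, ← ht, ← add_right_inj (l (w.coeff 0)), ← h]
        conv_lhs => rw [hw]
        ring
      rw [verschiebung_injective p K this, map_add, h5, add_zero]
    let Θ : WittVector p K →+ K := AddMonoidHom.mk'
      (fun w => T.u^[m + 1] (τ 0 * w.coeff 0) + Θ' (r w)) fun w w' => by
        have hc : (w + w').coeff 0 = w.coeff 0 + w'.coeff 0 := by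
          simpa only [WittVector.constantCoeff_apply] using
            map_add (WittVector.constantCoeff (p := p) (R := K)) w w'
        rw [huniq (w + w') (l (w.coeff 0) + l (w'.coeff 0)) (r w + r w')
          (by rw [hc]; exact (hl _).add (hl _))
          (by rw [map_add]; conv_lhs => rw [hr w, hr w']
              ring), hc, mul_add, T.iterate_add, map_add]
        ring
    have hΘ : ∀ w, Θ w = T.u^[m + 1] (τ 0 * w.coeff 0) + Θ' (r w) := fun w => rfl
    have hV : ∀ w, Θ (verschiebung w) = Θ' w := fun w => by
      rw [hΘ, huniq _ 0 w (by
        rw [verschiebung_coeff_zero]; exact SectionData.isLift_zero_of_dvd (dvd_zero _)) (by simp),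
        verschiebung_coeff_zero, mul_zero, T.iterate_zero_apply, zero_add]
    have hVi : ∀ i w, Θ (verschiebung^[i + 1] w) = Θ' (verschiebung^[i] w) := fun i w => by
      rw [Function.iterate_succ_apply', hV]
    refine ⟨Θ, ?_, ?_, ?_, ?_, ?_⟩
    · intro c w
      have hc : (teichmuller p (c ^ p ^ (m + 1)) * w).coeff 0 = c ^ p ^ (m + 1) * w.coeff 0 := by
        rw [mul_coeff_zero, teichmuller_coeff_zero]
      have hT := teichmuller_mul_iterate_verschiebung (c ^ p ^ (m + 1)) (r w) 1
      rw [Function.iterate_one, pow_one, ← pow_mul, ← pow_succ] at hT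
      rw [hΘ, hΘ, huniq _ (teichmuller p (c ^ p ^ (m + 1)) * l (w.coeff 0))
        (teichmuller p (c ^ p ^ (m + 1 + 1)) * r w)
        (by rw [hc]; exact (s.isLift_teichmuller_pow_pow c m).mul (hl _))
        (by rw [← hT]; conv_lhs => rw [hr w]
            ring), h1, hc, mul_left_comm, T.iterate_pow_mul, mul_add]
    · intro w
      rw [mul_comm, ← verschiebung_frobenius, hV, h5]
    · intro w
      rw [hVi, h3]
    · intro i hi w y hw
      cases i with
      | zero =>
        rw [Function.iterate_zero_apply, hΘ, huniq w w 0 (by rwa [hw.coeff_zero]) (by simp),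
          map_zero, add_zero, hw.coeff_zero, add_zero]
      | succ i =>
        rw [hVi, h4 i (by omega) w y hw, show m + 1 + (i + 1) = m + 1 + 1 + i by omega]
    · intro h w
      have h0 : T.u (τ 0) = 0 := h.resolve_left (Nat.succ_ne_zero _)
      obtain ⟨v, hv, -⟩ := exists_eq_teichmuller_add w
      rw [hΘ, huniq _ (teichmuller p (w.coeff 0 ^ p)) (WittVector.frobenius v)
        (by rw [coeff_frobenius_charP]; exact s.isLift_teichmuller_pow _)
        (by
          conv_lhs => rw [hv]
          rw [map_add, frobenius_teichmuller, frobenius_verschiebung, verschiebung_frobenius]),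
        h5, add_zero, coeff_frobenius_charP, Function.iterate_succ_apply, mul_comm,
        T.map_pow_mul, h0, mul_zero, T.iterate_zero_apply]

theorem exists_functional (T : TraceData p B) (s : SectionData p B) (n : ℕ) (τ : ℕ → K)
    (hτ : ∀ i, i + 1 < n → T.u (τ (i + 1)) = 0) :
    ∃ Θ : WittVector p K →+ K, IsWittFunctional n Θ ∧ Represents T s Θ n τ := by
  obtain ⟨Θ, h1, h2, h3, h4, -⟩ := exists_functional_aux T s n 0 τ hτ
  refine ⟨Θ, ⟨by simpa using h1, h2, h3⟩, fun i hi w y hw => ?_⟩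
  rw [h4 i hi w y hw, zero_add, add_comm]

/-- The order of the pole along `f` that is allowed in the `i`-th component. -/
def poleOrder (p n i : ℕ) : ℕ := if i + 1 < n then p ^ (i + 1) - 1 else p ^ (i + 1) - 2

theorem le_poleOrder (p n i : ℕ) : p ^ (i + 1) - 2 ≤ poleOrder p n i := by
  unfold poleOrder; split_ifs <;> omega

/-- `σ` takes values in `B` on the Witt vectors with poles bounded by `poleOrder`. -/
def IsIntegralOn (B : Subring K) (σ : WittVector p K →+ K) (f : K) (n : ℕ) : Prop :=
  ∀ i < n, ∀ w ∈ wittOver p B,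
    σ (verschiebung^[i] (teichmuller p ((f ^ poleOrder p n i)⁻¹) * w)) ∈ B

/-- The conditions on `τ` for the functional to take integral values. -/
structure StarCond (T : TraceData p B) (f Δ : K) (n : ℕ) (τ : ℕ → K) : Prop where
  top : ∀ i, i + 1 = n → ∃ r ∈ B, τ i = f ^ (p ^ (i + 1) - 2) * r
  step : ∀ i, i + 1 < n → ∃ r ∈ B, τ i * f + T.u (τ (i + 1) * Δ) = f ^ p ^ (i + 1) * r
  trace_eq_zero : ∀ i, i + 1 < n → T.u (τ (i + 1)) = 0

variable {n : ℕ} {σ : WittVector p K →+ K} {T : TraceData p B} {s : SectionData p B} {τ : ℕ → K}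
  {f Δ : K} {δ : WittVector p K}

theorem inv_mul_iterate (c : K) (m : ℕ) (y z : K) :
    c * T.u^[m] (y * z) = T.u^[m] (y * (c ^ p ^ m * z)) := by
  rw [← T.iterate_pow_mul, mul_left_comm]

/-- Below the top level the pole is `f ^ (-(p ^ (i+1) - 1)) = (f⁻¹) ^ p ^ (i+1) * f`: semilinearity
extracts `f⁻¹`, and `teichmuller_mul` expands the remaining `[f]`. The error term again has an
allowed pole, at level `i + 2`. -/
theorem Represents.pole_expansion (hδ : IsDelta s f Δ δ) (hf : f ≠ 0) (hfB : f ∈ B)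
    (h : IsWittFunctional n σ) (hτ : Represents T s σ n τ) {i : ℕ} (hi : i + 1 < n)
    {w : WittVector p K} {y : K} (hw : s.IsLift w y) (hwB : w ∈ wittOver p B) :
    ∃ w' ∈ wittOver p B, σ (verschiebung^[i] (teichmuller p ((f ^ poleOrder p n i)⁻¹) * w)) =
      T.u^[i + 1] (y * ((f⁻¹) ^ p ^ (i + 1) * (τ i * f + T.u (τ (i + 1) * Δ)))) +
      σ (verschiebung^[i + 2] (teichmuller p ((f ^ poleOrder p n (i + 2))⁻¹) * w')) := by
  have e1 : (f ^ poleOrder p n i)⁻¹ = (f⁻¹) ^ p ^ (i + 1) * f := by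
    have : p ^ (i + 1) = poleOrder p n i + 1 := by
      rw [poleOrder, if_pos hi]
      have : 0 < p ^ (i + 1) := pow_pos hp.out.pos _
      omega
    rw [this, inv_pow, pow_succ, mul_inv, mul_assoc, inv_mul_cancel₀ hf, mul_one]
  -- The excess power of `f` in the error term. It is nonnegative because the gain `p (p - 1) ≥ 2`
  -- covers the largest defect `p ^ (i+3) - poleOrder`.
  set c := poleOrder p n (i + 2) + p * (p - 1) - p ^ (i + 2 + 1) with hc
  have hc' : c + p ^ (i + 2 + 1) = poleOrder p n (i + 2) + p * (p - 1) := by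
    have h1 := le_poleOrder p n (i + 2)
    have h2 : 2 * 1 ≤ p * (p - 1) :=
      Nat.mul_le_mul hp.out.two_le (by have := hp.out.two_le; omega)
    omega
  have e2 : (f⁻¹) ^ p ^ (i + 2 + 1) * f ^ (p * (p - 1)) =
      (f ^ poleOrder p n (i + 2))⁻¹ * f ^ c := by
    rw [inv_pow, inv_mul_eq_div, inv_mul_eq_div, div_eq_div_iff (pow_ne_zero _ hf)
      (pow_ne_zero _ hf), ← pow_add, ← pow_add, hc', add_comm]
  refine ⟨teichmuller p (f ^ c) * (δ * WittVector.frobenius (WittVector.frobenius w)),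
    mul_mem (teichmuller_mem_wittOver (B.pow_mem hfB _)) (mul_mem hδ.mem
      (frobenius_mem_wittOver (frobenius_mem_wittOver hwB))), ?_⟩
  rw [e1, map_mul, mul_assoc, h.semilinear_iterate, hτ.teichmuller_mul hδ h hi hw, mul_add,
    inv_mul_iterate, ← h.semilinear_iterate (i + 2), ← mul_assoc (teichmuller p _) (teichmuller p _),
    ← map_mul, e2, map_mul (teichmuller p), mul_assoc (teichmuller p _) (teichmuller p _)]

/-- At the top level `σ` kills the next step of the filtration, so `[c]` may be replaced by any lift
of `c`. -/
theorem Represents.top_expansion (h : IsWittFunctional n σ) (hτ : Represents T s σ n τ) {i : ℕ}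
    (hi : i + 1 = n) {w : WittVector p K} {y : K} (hw : s.IsLift w y) (c : K) :
    σ (verschiebung^[i] (teichmuller p c * w)) = T.u^[i + 1] (y * (c * τ i)) := by
  obtain ⟨l, hl⟩ := s.exists_isLift c
  obtain ⟨v, hv, -⟩ := exists_eq_teichmuller_add l
  rw [hl.coeff_zero] at hv
  have : teichmuller p c * w + verschiebung (v * WittVector.frobenius w) = l * w := by
    rw [hv, verschiebung_mul_frobenius]; ring
  have h2 := congrArg (fun x => σ (verschiebung^[i] x)) this
  simp only [iterate_verschiebung_add, map_add] at h2
  rw [← Function.iterate_succ_apply, h.map_verschiebung_of_le (m := i.succ) (by omega), add_zero,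
    hτ i (by omega) _ _ (hl.mul hw)] at h2
  rw [h2]
  congr 1
  ring

/-- The error term of `pole_expansion` is itself a value of `σ` on an allowed pole. The leading term
is therefore integral for every `y ∈ B`, and duality over `B` makes its coefficient integral. -/
theorem IsIntegralOn.starCond (hδ : IsDelta s f Δ δ) (hf : f ≠ 0) (hfB : f ∈ B)
    (h : IsWittFunctional n σ) (hτ : Represents T s σ n τ) (hσ : IsIntegralOn B σ f n) :
    StarCond T f Δ n τ where
  top i hi := by
    refine ⟨(f ^ poleOrder p n i)⁻¹ * τ i, T.iterate_mem_of_forall (m := i + 1) fun y hy => ?_, ?_⟩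
    · obtain ⟨w, hwB, hw⟩ := s.exists_lift y hy
      rw [← hτ.top_expansion h hi hw]
      exact hσ i (by omega) w hwB
    · rw [poleOrder, if_neg (by omega), mul_inv_cancel_left₀ (pow_ne_zero _ hf)]
  step i hi := by
    refine ⟨(f⁻¹) ^ p ^ (i + 1) * (τ i * f + T.u (τ (i + 1) * Δ)),
      T.iterate_mem_of_forall (m := i + 1) fun y hy => ?_, ?_⟩
    · obtain ⟨w, hwB, hw⟩ := s.exists_lift y hy
      obtain ⟨w', hwB', hw'⟩ := hτ.pole_expansion hδ hf hfB h hi hw hwB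
      rw [← sub_eq_iff_eq_add] at hw'
      rw [← hw']
      refine B.sub_mem (hσ i (by omega) w hwB) ?_
      by_cases hi2 : i + 2 < n
      · exact hσ _ hi2 _ hwB'
      · rw [h.map_verschiebung_of_le (by omega)]
        exact B.zero_mem
    · rw [inv_pow, mul_inv_cancel_left₀ (pow_ne_zero _ hf)]
  trace_eq_zero i hi := hτ.trace_eq_zero h hi

/-- Descending induction on the level, with `w = l + V v` and `l` an integral lift of the zeroth
component: `l` is treated by the expansions, `v` by the next level. -/
theorem StarCond.isIntegralOn (hδ : IsDelta s f Δ δ) (hf : f ≠ 0) (hfB : f ∈ B)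
    (h : IsWittFunctional n σ) (hτ : Represents T s σ n τ) (hs : StarCond T f Δ n τ) :
    IsIntegralOn B σ f n := by
  suffices H : ∀ m i, n = i + m → i < n → ∀ w ∈ wittOver p B,
      σ (verschiebung^[i] (teichmuller p ((f ^ poleOrder p n i)⁻¹) * w)) ∈ B from
    fun i hi => H (n - i) i (by omega) hi
  intro m
  induction m using Nat.strong_induction_on with
  | _ m ih =>
  intro i him hi w hwB
  have ih' : ∀ j, i < j → ∀ w ∈ wittOver p B,
      σ (verschiebung^[j] (teichmuller p ((f ^ poleOrder p n j)⁻¹) * w)) ∈ B := by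
    intro j hj w hwB
    by_cases hjn : j < n
    · exact ih (n - j) (by omega) j (by omega) hjn w hwB
    · rw [h.map_verschiebung_of_le (by omega)]
      exact B.zero_mem
  have hy : w.coeff 0 ∈ B := mem_wittOver.1 hwB 0
  obtain ⟨l, hlB, hl⟩ := s.exists_lift _ hy
  have hl0 : (w - l).coeff 0 = 0 := by
    have := map_sub (WittVector.constantCoeff (p := p) (R := K)) w l
    simp only [WittVector.constantCoeff_apply] at this
    rw [this, s.coeff_zero _ _ hl, sub_self]
  obtain ⟨v, hv, hvc⟩ := exists_verschiebung_eq hl0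
  have hvB : v ∈ wittOver p B := by
    rw [mem_wittOver]
    intro j
    rw [hvc]
    exact mem_wittOver.1 (sub_mem hwB hlB) _
  have hT := teichmuller_mul_iterate_verschiebung ((f ^ poleOrder p n i)⁻¹) v 1
  rw [Function.iterate_one, pow_one] at hT
  have hw : w = l + verschiebung v := by rw [← hv]; ring
  rw [hw, mul_add, hT, iterate_verschiebung_add, ← Function.iterate_succ_apply, map_add]
  refine B.add_mem ?_ ?_
  · by_cases hi1 : i + 1 < n
    · obtain ⟨w', hwB', hw'⟩ := hτ.pole_expansion hδ hf hfB h hi1 hl hlB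
      rw [hw']
      refine B.add_mem (T.iterate_mem _ (B.mul_mem hy ?_)) (ih' _ (by omega) _ hwB')
      obtain ⟨r, hr, hr'⟩ := hs.step i hi1
      rwa [hr', inv_pow, inv_mul_cancel_left₀ (pow_ne_zero _ hf)]
    · rw [hτ.top_expansion h (by omega) hl]
      refine T.iterate_mem _ (B.mul_mem hy ?_)
      obtain ⟨r, hr, hr'⟩ := hs.top i (by omega)
      rwa [hr', poleOrder, if_neg (by omega), inv_mul_cancel_left₀ (pow_ne_zero _ hf)]
  · by_cases hi1 : i + 1 < n
    -- Passing `[f ^ (-poleOrder)]` through `V` multiplies the pole by `p`, giving `p ^ (i+2) - p`,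
    -- which is still at most the order allowed at level `i + 1`.
    · set c := poleOrder p n (i + 1) - p * poleOrder p n i with hc
      have hc' : c + poleOrder p n i * p = poleOrder p n (i + 1) := by
        have h1 := le_poleOrder p n (i + 1)
        have h2 : poleOrder p n i * p = p ^ (i + 1 + 1) - p := by
          rw [poleOrder, if_pos hi1, Nat.sub_mul, one_mul, ← pow_succ]
        have := hp.out.two_le
        rw [mul_comm] at hc
        omega
      have e : ((f ^ poleOrder p n i)⁻¹) ^ p = (f ^ poleOrder p n (i + 1))⁻¹ * f ^ c := by
        rw [inv_pow, ← pow_mul, inv_mul_eq_div, eq_div_iff (pow_ne_zero _ hf), inv_mul_eq_div,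
          div_eq_iff (pow_ne_zero _ hf), ← pow_add, hc']
      rw [e, map_mul, mul_assoc]
      exact ih' (i + 1) (by omega) _
        (mul_mem (teichmuller_mem_wittOver (B.pow_mem hfB _)) hvB)
    · rw [h.map_verschiebung_of_le (by omega)]
      exact B.zero_mem

end Criterion
end NonSplit

namespace NonSplit
set_option linter.unusedSectionVars false
open WittVector

/-! ### Removing powers of `f`: chains, and why `f` must be squarefree -/

section Chain

variable {p : ℕ} [hp : Fact p.Prime] {K : Type*} [Field K] [CharP K p] {B : Subring K}
  {n : ℕ} {T : TraceData p B} {s : SectionData p B} {τ : ℕ → K} {f Δ : K} {δ : WittVector p K}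

theorem trace_pole (i : ℕ) (z : K) :
    T.u (f ^ (p ^ (i + 1 + 1) - 2) * z) = f ^ (p ^ (i + 1) - 1) * T.u (f ^ (p - 2) * z) := by
  have : p ^ (i + 1 + 1) - 2 = (p ^ (i + 1) - 1) * p + (p - 2) := by
    have h1 := hp.out.two_le
    have h2 : p ≤ p ^ (i + 1) * p := Nat.le_mul_of_pos_left _ (pow_pos hp.out.pos _)
    rw [Nat.sub_mul, one_mul, pow_succ p (i + 1)]
    omega
  rw [this, pow_add, pow_mul, mul_assoc, T.map_pow_mul]

theorem pow_pole (i : ℕ) : f ^ (p ^ (i + 1) - 1) = f ^ (p ^ (i + 1) - 2) * f := by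
  have h2 : 2 ≤ p ^ (i + 1) := hp.out.two_le.trans (Nat.le_self_pow (Nat.succ_ne_zero _) _)
  rw [← pow_succ]
  congr 1
  omega

theorem pow_pole' (i : ℕ) : f ^ p ^ (i + 1) = f ^ (p ^ (i + 1) - 1) * f := by
  have h2 : 0 < p ^ (i + 1) := pow_pos hp.out.pos _
  rw [← pow_succ]
  congr 1
  omega

/-- The conditions on `r` which say that `τ i = f ^ (p ^ (i + 1) - 2) * r i` satisfies
`StarCond`. -/
structure ChainCond (T : TraceData p B) (f Δ : K) (n : ℕ) (r : ℕ → K) : Prop where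
  mem : ∀ i < n, r i ∈ B
  step : ∀ i, i + 1 < n → ∃ d ∈ B, r i = f * d - T.u (f ^ (p - 2) * Δ * r (i + 1))
  trace_eq_zero : ∀ i, i + 1 < n → T.u (f ^ (p - 2) * r (i + 1)) = 0

/-- After the substitution `τ_i = f ^ (p ^ (i+1) - 2) r_i` the step condition is divisible by `f ^
(p ^ (i+1) - 1)`. Integrality of `r_i` then descends from the top index. -/
theorem StarCond.exists_chain (hf : f ≠ 0) (hfB : f ∈ B) (hΔ : Δ ∈ B) (h : StarCond T f Δ n τ) :
    ∃ r, ChainCond T f Δ n r ∧ τ 0 = f ^ (p - 2) * r 0 := by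
  have hr : ∀ i, τ i = f ^ (p ^ (i + 1) - 2) * (τ i / f ^ (p ^ (i + 1) - 2)) := fun i => by
    rw [mul_div_cancel₀ _ (pow_ne_zero _ hf)]
  set r : ℕ → K := fun i => τ i / f ^ (p ^ (i + 1) - 2) with hrdef
  change ∀ i, τ i = f ^ (p ^ (i + 1) - 2) * r i at hr
  have hstep : ∀ i, i + 1 < n → ∃ d ∈ B, r i = f * d - T.u (f ^ (p - 2) * Δ * r (i + 1)) := by
    intro i hi
    obtain ⟨d, hd, he⟩ := h.step i hi
    refine ⟨d, hd, ?_⟩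
    rw [hr i, hr (i + 1), mul_assoc (f ^ _) (r (i + 1)), trace_pole, pow_pole', pow_pole] at he
    have h0 : f ^ (p ^ (i + 1) - 2) * f ≠ 0 := mul_ne_zero (pow_ne_zero _ hf) hf
    apply mul_left_cancel₀ h0
    rw [mul_comm (r (i + 1)) Δ, ← mul_assoc] at he
    linear_combination he
  refine ⟨r, ⟨?_, hstep, ?_⟩, ?_⟩
  · suffices H : ∀ m i, i + m + 1 = n → r i ∈ B from fun i hi => H (n - i - 1) i (by omega)
    intro m
    induction m with
    | zero =>
      intro i hi
      obtain ⟨d, hd, he⟩ := h.top i hi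
      rw [mul_left_cancel₀ (pow_ne_zero _ hf) ((hr i).symm.trans he)]
      exact hd
    | succ m ih =>
      intro i hi
      obtain ⟨d, hd, he⟩ := hstep i (by omega)
      rw [he]
      exact B.sub_mem (B.mul_mem hfB hd) (T.map_mem _ (B.mul_mem (B.mul_mem (B.pow_mem hfB _) hΔ)
        (ih (i + 1) (by omega))))
  · intro i hi
    have := h.trace_eq_zero i hi
    rw [hr (i + 1), trace_pole] at this
    exact (mul_eq_zero.1 this).resolve_left (pow_ne_zero _ hf)
  · simpa using hr 0

theorem ChainCond.starCond {r : ℕ → K} (h : ChainCond T f Δ n r) :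
    StarCond T f Δ n fun i => f ^ (p ^ (i + 1) - 2) * r i where
  top i hi := ⟨r i, h.mem i (by omega), rfl⟩
  step i hi := by
    obtain ⟨d, hd, he⟩ := h.step i hi
    refine ⟨d, hd, ?_⟩
    rw [mul_assoc (f ^ _) (r (i + 1)), trace_pole, pow_pole', pow_pole, he,
      mul_comm (r (i + 1)) Δ, ← mul_assoc (f ^ (p - 2))]
    ring
  trace_eq_zero i hi := by
    rw [trace_pole, h.trace_eq_zero i hi, mul_zero]

/-- If `f = g² h`, then `Δ` is divisible by `g ^ p` up to a `p`-th power. -/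
theorem IsDelta.of_sq_dvd (hδ : IsDelta s f Δ δ) {g h : K} (hg : g ∈ B) (hh : h ∈ B)
    (hf : f = g * g * h) :
    ∃ a ∈ B, ∃ c ∈ B, ∃ z, Δ = g ^ p * (2 * a) + (g * g) ^ p * c + z ^ p := by
  obtain ⟨S, Z, hS, hZ, hfS, hSZ⟩ := hδ.exists_lift
  obtain ⟨t, ht⟩ := dvd_delta_sub hfS hSZ
  -- The correction term in `dvd_delta_sub` lies in the image of `V`, so it is invisible in
  -- component zero.
  have hΔ : Δ = δ.coeff 0 := by
    have := congrArg (WittVector.constantCoeff (p := p) (R := K)) ht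
    simp only [map_sub, map_add, map_mul, WittVector.constantCoeff_apply, hZ.coeff_zero,
      verschiebung_coeff_zero, coeff_p_zero] at this
    linear_combination -this
  have hlift : ∀ g ∈ B, ∃ l e, s.IsLift l g ∧ e ∈ wittOver p B ∧
      teichmuller p g = l + verschiebung e := by
    intro g hg
    obtain ⟨l, hlB, hl⟩ := s.exists_lift g hg
    have h0 : (teichmuller p g - l).coeff 0 = 0 := by
      have := map_sub (WittVector.constantCoeff (p := p) (R := K)) (teichmuller p g) l
      simp only [WittVector.constantCoeff_apply] at this
      rw [this, s.coeff_zero _ _ hl, teichmuller_coeff_zero, sub_self]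
    obtain ⟨e, he, hec⟩ := exists_verschiebung_eq h0
    refine ⟨l, e, hl, ?_, by rw [← he]; ring⟩
    rw [mem_wittOver]
    intro i
    rw [hec]
    exact mem_wittOver.1 (sub_mem (teichmuller_mem_wittOver hg) hlB) _
  obtain ⟨l, e, hl, heB, he⟩ := hlift g hg
  obtain ⟨l', e', hl', heB', he'⟩ := hlift h hh
  rw [hf] at hS
  obtain ⟨t', ht'⟩ := hS.dvd_sub ((hl.mul hl).mul hl')
  have hVV : ∀ x y : WittVector p K, verschiebung x * verschiebung y =
      (p : WittVector p K) * verschiebung (x * y) := fun x y => by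
    rw [← verschiebung_mul_frobenius, frobenius_verschiebung, ← mul_assoc, mul_comm,
      verschiebung_nat_mul]
  -- In `[g] ^ 2 [h]`, with `[g] = l + V e` and `[h] = l' + V e'`, all products of two `V`-terms are
  -- multiples of `p`. They are collected in `p X = V F X`, which contributes only a `p`-th power to
  -- `Δ`.
  set X := l' * verschiebung (e * e) + 2 * l * verschiebung (e * e') +
    verschiebung (e * e) * verschiebung e' - t' with hX
  have hδX : verschiebung δ = verschiebung (2 * (e * WittVector.frobenius (l * l')) +
      e' * WittVector.frobenius (l * l) + WittVector.frobenius X) := by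
    have h2 := verschiebung_nat_mul 2 (e * WittVector.frobenius (l * l'))
    rw [Nat.cast_ofNat] at h2
    rw [map_add, map_add, h2, verschiebung_mul_frobenius, verschiebung_mul_frobenius,
      verschiebung_frobenius]
    rw [hf, map_mul, map_mul, he, he'] at hfS
    have h3 := hVV e e
    have h4 := hVV e e'
    linear_combination -hfS - ht' + (l' + verschiebung e') * h3 + 2 * l * h4
  have hδ0 := congrArg (WittVector.constantCoeff (p := p) (R := K))
    (verschiebung_injective p K hδX)
  simp only [map_add, map_mul, map_ofNat, WittVector.constantCoeff_apply, coeff_frobenius_charP,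
    hl.coeff_zero, hl'.coeff_zero] at hδ0
  refine ⟨e.coeff 0 * h ^ p, B.mul_mem (mem_wittOver.1 heB 0) (B.pow_mem hh _), e'.coeff 0,
    mem_wittOver.1 heB' 0, X.coeff 0, ?_⟩
  rw [hΔ, hδ0]
  ring

/-- Shows that a square factor `g²` of `f` obstructs splitting when `n > 1`. In the decomposition of
`Δ` the `p`-th power drops out by the trace condition on `r_1`; the rest makes `τ 0` a multiple of
`g ^ p`, and `u` extracts a factor `g`. -/
theorem StarCond.trace_of_sq_dvd (hδ : IsDelta s f Δ δ) (hf0 : f ≠ 0) (hΔ : Δ ∈ B) (hn : 1 < n)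
    (h : StarCond T f Δ n τ) {g e : K} (hg : g ∈ B) (he : e ∈ B) (hf : f = g * g * e) :
    ∃ q ∈ B, T.u (τ 0) = g * q := by
  have hfB : f ∈ B := hf ▸ B.mul_mem (B.mul_mem hg hg) he
  obtain ⟨r, hr, hr0⟩ := h.exists_chain hf0 hfB hΔ
  obtain ⟨d, hd, hd'⟩ := hr.step 0 hn
  have hu := hr.trace_eq_zero 0 hn
  obtain ⟨a, ha, c, hc, z, hΔ'⟩ := hδ.of_sq_dvd hg he hf
  have hp2 := hp.out.two_le
  have hrB := hr.mem (0 + 1) hn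
  set r1 := r (0 + 1)
  have e1 : T.u (f ^ (p - 2) * Δ * r1) = g * (2 * T.u (f ^ (p - 2) * a * r1)) +
      g * g * T.u (f ^ (p - 2) * c * r1) := by
    have : f ^ (p - 2) * Δ * r1 = g ^ p * (f ^ (p - 2) * a * r1 + f ^ (p - 2) * a * r1) +
        (g * g) ^ p * (f ^ (p - 2) * c * r1) + z ^ p * (f ^ (p - 2) * r1) := by
      rw [hΔ']; ring
    rw [this, map_add, map_add, T.map_pow_mul, T.map_pow_mul, T.map_pow_mul, hu, map_add]
    ring
  have hfp : f ^ (p - 2) * f = g ^ p * (g ^ (p - 2) * e ^ (p - 1)) := by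
    obtain ⟨m, hm⟩ : ∃ m, p = m + 2 := ⟨p - 2, by omega⟩
    rw [hf, hm, Nat.add_sub_cancel, show m + 2 - 1 = m + 1 by omega]
    ring
  set A := T.u (f ^ (p - 2) * a * r1)
  set C := T.u (f ^ (p - 2) * c * r1)
  have hA : A ∈ B := T.map_mem _ (B.mul_mem (B.mul_mem (B.pow_mem hfB _) ha) hrB)
  have hC : C ∈ B := T.map_mem _ (B.mul_mem (B.mul_mem (B.pow_mem hfB _) hc) hrB)
  obtain ⟨q, hq, hq'⟩ : ∃ q ∈ B, f ^ (p - 2) * (g * (2 * A) + g * g * C) = g ^ p * q := by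
    -- The factor `f ^ (p-2)` contributes `g ^ (2p - 4)`, and `2p - 3 ≥ p` only for `p ≥ 3`. For `p
    -- = 2` the term linear in `g` has coefficient `2 = 0`, and `g * g` remains.
    rcases hp2.eq_or_lt with h2 | h2
    · refine ⟨C, hC, ?_⟩
      have : (2 : K) = 0 := by
        have := CharP.cast_eq_zero K p
        rwa [← h2, Nat.cast_ofNat] at this
      rw [← h2, this]
      ring
    · obtain ⟨m, hm⟩ : ∃ m, p = m + 3 := ⟨p - 3, by omega⟩
      refine ⟨g ^ m * e ^ (m + 1) * (2 * A + g * C), ?_, ?_⟩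
      · have h2B : (2 : K) * A ∈ B := by rw [two_mul]; exact B.add_mem hA hA
        exact B.mul_mem (B.mul_mem (B.pow_mem hg _) (B.pow_mem he _))
          (B.add_mem h2B (B.mul_mem hg hC))
      · rw [hf, hm, show m + 3 - 2 = m + 1 by omega]
        ring
  refine ⟨T.u (g ^ (p - 2) * e ^ (p - 1) * d - q), T.map_mem _ (B.sub_mem
    (B.mul_mem (B.mul_mem (B.pow_mem hg _) (B.pow_mem he _)) hd) hq), ?_⟩
  rw [← T.map_pow_mul, mul_sub, ← hq', hr0, hd', e1, ← mul_assoc (g ^ p), ← hfp]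
  congr 1
  ring

end Chain
end NonSplit

namespace NonSplit
set_option linter.unusedSectionVars false
open WittVector

/-! ### Splittings of pairs as functionals on `W(Frac R)` -/

section Bridge

variable {p : ℕ} [hp : Fact p.Prime] {R : Type*} [CommRing R] [IsDomain R] [IsIntegrallyClosed R]
  [CharP R p]

local notation "𝔎" => FractionRing R

instance instCharPFractionRing : CharP (FractionRing R) p :=
  charP_of_injective_algebraMap (IsFractionRing.injective R (FractionRing R)) p

/-- The image of `R` in its fraction field. -/
noncomputable abbrev baseSubring (R : Type*) [CommRing R] [IsDomain R] :
    Subring (FractionRing R) := (algebraMap R (FractionRing R)).range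

/-- Witt vectors over `Frac R` whose truncation lies in `wittDivSections`. -/
def IsSection (n : ℕ) (f : R) (u v : ℕ) (w : WittVector p (FractionRing R)) : Prop :=
  ∀ i < n, w.coeff i ∈ divSections f (p ^ i * u) v

theorem isSection_iff {n : ℕ} {f : R} {u v : ℕ} (hv : 0 < v) {w : WittVector p (FractionRing R)} :
    IsSection n f u v w ↔ WittVector.truncate n w ∈ wittDivSections p n f u hv := by
  constructor
  · intro h i
    rw [WittVector.coeff_truncate]
    exact h i i.2
  · intro h i hi
    have := h ⟨i, hi⟩
    rwa [WittVector.coeff_truncate] at this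

theorem mem_divSections_of_mem {f : R} {u v : ℕ} {a : FractionRing R} (ha : a ∈ baseSubring R) :
    a ∈ divSections f u v :=
  mul_mem (pow_mem ha v) (pow_mem (RingHom.mem_range_self _ f) u)

theorem wittFrob_truncate {n : ℕ} (c : WittVector p R) :
    wittFrob p (WittVector.truncate n c) =
      WittVector.truncate n (WittVector.frobenius (WittVector.map (algebraMap R 𝔎) c)) := by
  ext i
  simp [wittFrob, WittVector.coeff_truncate, coeff_frobenius_charP, map_coeff]

theorem exists_denominator (n : ℕ) (w : WittVector p (FractionRing R)) :
    ∃ c : R, c ≠ 0 ∧ ∀ i < n, algebraMap R 𝔎 c * w.coeff i ∈ baseSubring R := by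
  induction n with
  | zero => exact ⟨1, one_ne_zero, by simp⟩
  | succ n ih =>
    obtain ⟨c, hc, h⟩ := ih
    obtain ⟨⟨a, b⟩, hab⟩ := IsLocalization.surj (nonZeroDivisors R) (w.coeff n)
    refine ⟨c * b, mul_ne_zero hc (nonZeroDivisors.ne_zero b.2), fun i hi => ?_⟩
    rcases Nat.lt_succ_iff_lt_or_eq.1 hi with hi | rfl
    · rw [map_mul, mul_right_comm]
      exact mul_mem (h i hi) (RingHom.mem_range_self _ _)
    · rw [map_mul, mul_assoc, mul_comm (algebraMap R 𝔎 b), hab]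
      exact mul_mem (RingHom.mem_range_self _ _) (RingHom.mem_range_self _ _)

theorem exists_isSection (n : ℕ) (f : R) (u v : ℕ) (w : WittVector p (FractionRing R)) :
    ∃ c : R, c ≠ 0 ∧ IsSection n f u v (teichmuller p (algebraMap R 𝔎 c ^ p) * w) := by
  obtain ⟨c, hc, h⟩ := exists_denominator n w
  refine ⟨c, hc, fun i hi => mem_divSections_of_mem ?_⟩
  rw [teichmuller_mul_coeff, ← pow_mul]
  obtain ⟨m, hm⟩ : ∃ m, p * p ^ i = m + 1 :=
    Nat.exists_eq_succ_of_ne_zero (mul_ne_zero hp.out.ne_zero (pow_ne_zero _ hp.out.ne_zero))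
  rw [hm, pow_succ, mul_assoc]
  exact mul_mem (pow_mem (RingHom.mem_range_self _ _) _) (h i hi)

/-- Multiplication by `[c ^ p] = F [c]` clears denominators, and `σ` is linear for it. So `σ`
extends uniquely by `w ↦ c⁻¹ σ ([c ^ p] w)`. -/
theorem IsQuasiFSplitPair.exists_functional {n : ℕ} (hn : 0 < n) {f : R} {u v : ℕ} (hv : 0 < v)
    (h : IsQuasiFSplitPair p hn f u hv) :
    ∃ σ : WittVector p (FractionRing R) →+ FractionRing R, IsWittFunctional n σ ∧ σ 1 = 1 ∧
      ∀ w, IsSection n f (p * u) v w → σ w ∈ baseSubring R := by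
  classical
  obtain ⟨σ, h1, h2⟩ := h
  have hsec := fun w : WittVector p (FractionRing R) =>
    isSection_iff (n := n) (f := f) (u := p * u) hv (w := w)
  let σ₀ : WittVector p 𝔎 → 𝔎 := fun w =>
    if hw : IsSection n f (p * u) v w then algebraMap R 𝔎 (σ ⟨_, (hsec w).1 hw⟩) else 0
  have hσ₀ : ∀ w (hw : IsSection n f (p * u) v w),
      σ₀ w = algebraMap R 𝔎 (σ ⟨_, (hsec w).1 hw⟩) := fun w hw => dif_pos hw
  have hmul : ∀ (c : WittVector p R) w, IsSection n f (p * u) v w →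
      IsSection n f (p * u) v (WittVector.frobenius (WittVector.map (algebraMap R 𝔎) c) * w) ∧
      σ₀ (WittVector.frobenius (WittVector.map (algebraMap R 𝔎) c) * w) =
        algebraMap R 𝔎 (c.coeff 0) * σ₀ w := by
    intro c w hw
    have hm := wittFrob_mul_mem n f (p * u) hv (WittVector.truncate n c) ((hsec w).1 hw)
    have hw' : IsSection n f (p * u) v
        (WittVector.frobenius (WittVector.map (algebraMap R 𝔎) c) * w) := by
      rw [hsec, map_mul, ← wittFrob_truncate]
      exact hm
    refine ⟨hw', ?_⟩
    rw [hσ₀ _ hw', hσ₀ _ hw, ← map_mul]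
    have := h1 (WittVector.truncate n c) ⟨_, (hsec w).1 hw⟩
    rw [WittVector.coeff_truncate] at this
    rw [← this]
    congr 3
    rw [map_mul, wittFrob_truncate]
  have hadd : ∀ w w', IsSection n f (p * u) v w → IsSection n f (p * u) v w' →
      IsSection n f (p * u) v (w + w') ∧ σ₀ (w + w') = σ₀ w + σ₀ w' := by
    intro w w' hw hw'
    have hs : IsSection n f (p * u) v (w + w') := by
      rw [hsec, map_add]
      exact add_mem ((hsec w).1 hw) ((hsec w').1 hw')
    refine ⟨hs, ?_⟩
    rw [hσ₀ _ hs, hσ₀ _ hw, hσ₀ _ hw', ← map_add, ← map_add]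
    congr 3
    exact map_add _ _ _
  have hteich : ∀ c : R, WittVector.frobenius (WittVector.map (algebraMap R 𝔎) (teichmuller p c)) =
      teichmuller p (algebraMap R 𝔎 c ^ p) := fun c => by
    rw [map_teichmuller, frobenius_teichmuller]
  have hscale : ∀ (c : R) w, IsSection n f (p * u) v w →
      IsSection n f (p * u) v (teichmuller p (algebraMap R 𝔎 c ^ p) * w) ∧
      σ₀ (teichmuller p (algebraMap R 𝔎 c ^ p) * w) = algebraMap R 𝔎 c * σ₀ w := by
    intro c w hw
    have := hmul (teichmuller p c) w hw
    rwa [hteich, teichmuller_coeff_zero] at this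
  have hinj := IsFractionRing.injective R (FractionRing R)
  have hne : ∀ {c : R}, c ≠ 0 → algebraMap R 𝔎 c ≠ 0 := fun hc =>
    (map_ne_zero_iff _ hinj).2 hc
  choose d hd0 hd using exists_isSection (p := p) n f (p * u) v
  have huniq : ∀ (c : R) w, c ≠ 0 →
      IsSection n f (p * u) v (teichmuller p (algebraMap R 𝔎 c ^ p) * w) →
      (algebraMap R 𝔎 (d w))⁻¹ * σ₀ (teichmuller p (algebraMap R 𝔎 (d w) ^ p) * w) =
        (algebraMap R 𝔎 c)⁻¹ * σ₀ (teichmuller p (algebraMap R 𝔎 c ^ p) * w) := by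
    intro c w hc hs
    rw [inv_mul_eq_iff_eq_mul₀ (hne (hd0 w)), mul_left_comm, eq_inv_mul_iff_mul_eq₀ (hne hc),
      ← (hscale c _ (hd w)).2, ← (hscale (d w) _ hs).2]
    congr 1
    ring
  let σK : WittVector p 𝔎 →+ 𝔎 := AddMonoidHom.mk'
    (fun w => (algebraMap R 𝔎 (d w))⁻¹ * σ₀ (teichmuller p (algebraMap R 𝔎 (d w) ^ p) * w))
    fun w w' => by
      have e : ∀ x : WittVector p 𝔎, teichmuller p (algebraMap R 𝔎 (d w * d w') ^ p) * x =
          teichmuller p (algebraMap R 𝔎 (d w) ^ p) * (teichmuller p (algebraMap R 𝔎 (d w') ^ p) *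
            x) := fun x => by
        rw [map_mul, mul_pow, map_mul, mul_assoc]
      have hs : IsSection n f (p * u) v (teichmuller p (algebraMap R 𝔎 (d w * d w') ^ p) * w) := by
        rw [e, mul_left_comm]
        exact (hscale _ _ (hd w)).1
      have hs' : IsSection n f (p * u) v
          (teichmuller p (algebraMap R 𝔎 (d w * d w') ^ p) * w') := by
        rw [e]
        exact (hscale _ _ (hd w')).1
      have h0 := mul_ne_zero (hd0 w) (hd0 w')
      have hs2 := hadd _ _ hs hs'
      rw [← mul_add] at hs2
      rw [huniq _ _ h0 hs, huniq _ _ h0 hs', huniq _ _ h0 hs2.1, hs2.2, mul_add]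
  have hσK : ∀ (c : R) w, c ≠ 0 →
      IsSection n f (p * u) v (teichmuller p (algebraMap R 𝔎 c ^ p) * w) →
      σK w = (algebraMap R 𝔎 c)⁻¹ * σ₀ (teichmuller p (algebraMap R 𝔎 c ^ p) * w) := huniq
  have hσK' : ∀ w, IsSection n f (p * u) v w → σK w = σ₀ w := by
    intro w hw
    rw [hσK 1 w one_ne_zero (by simpa using hw)]
    simp
  have hsemiR : ∀ (c : R) w, σK (teichmuller p (algebraMap R 𝔎 c ^ p) * w) =
      algebraMap R 𝔎 c * σK w := by
    intro c w
    have := hscale c _ (hd w)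
    rw [mul_left_comm] at this
    rw [hσK (d w) _ (hd0 w) this.1, this.2, hσK (d w) w (hd0 w) (hd w)]
    ring
  refine ⟨σK, ⟨?_, ?_, ?_⟩, ?_, ?_⟩
  · intro c w
    obtain ⟨⟨a, b⟩, hab⟩ := IsLocalization.surj (nonZeroDivisors R) c
    have hb : algebraMap R 𝔎 b ≠ 0 := hne (nonZeroDivisors.ne_zero b.2)
    apply mul_left_cancel₀ hb
    rw [← hsemiR, ← mul_assoc, ← map_mul, ← mul_pow, mul_comm (algebraMap R 𝔎 b), hab, hsemiR,
      ← hab]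
    ring
  · intro w
    -- `p = F (V 1)` acts on the target through the zeroth component of `V 1`, which is zero.
    have hpV : (p : WittVector p 𝔎) = WittVector.frobenius (WittVector.map (algebraMap R 𝔎)
        (verschiebung 1)) := by
      rw [map_verschiebung, frobenius_verschiebung, map_one, one_mul]
    have := hmul (verschiebung 1) _ (hd w)
    rw [← hpV, verschiebung_coeff_zero, map_zero, zero_mul, mul_left_comm] at this
    rw [hσK (d w) _ (hd0 w) this.1, this.2, mul_zero]
  · intro w
    have ht : WittVector.truncate n (verschiebung^[n] w) = 0 := by
      rw [← RingHom.mem_ker, mem_ker_truncate]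
      exact fun i hi => iterate_verschiebung_coeff_eq_zero _ hi
    have hs : IsSection n f (p * u) v (verschiebung^[n] w) := by
      rw [hsec, ht]
      exact zero_mem _
    rw [hσK' _ hs, hσ₀ _ hs]
    have : (⟨_, (hsec _).1 hs⟩ : wittDivSections p n f (p * u) hv) = 0 := Subtype.ext ht
    rw [this, map_zero, map_zero]
  · have ht : WittVector.truncate n (1 : WittVector p 𝔎) = wittFrob p
        (WittVector.truncate n (1 : WittVector p R)) := by
      rw [wittFrob_truncate, map_one, map_one, map_one, map_one]
    have hs : IsSection n f (p * u) v (1 : WittVector p 𝔎) := by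
      rw [hsec, ht]
      exact wittFrob_mem n f (p * u) hv _
    rw [hσK' _ hs, hσ₀ _ hs]
    have := h2 (WittVector.truncate n 1)
    rw [WittVector.coeff_truncate, WittVector.one_coeff_zero] at this
    rw [← map_one (algebraMap R 𝔎), ← this]
    congr 3
  · intro w hw
    rw [hσK' w hw, hσ₀ w hw]
    exact RingHom.mem_range_self _ _

theorem isQuasiFSplitPair_of_functional {n : ℕ} (hn : 0 < n) {f : R} {u v : ℕ} (hv : 0 < v)
    {σ : WittVector p (FractionRing R) →+ FractionRing R} (h : IsWittFunctional n σ)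
    (h1 : σ 1 = 1) (hσ : ∀ w, IsSection n f (p * u) v w → σ w ∈ baseSubring R) :
    IsQuasiFSplitPair p hn f u hv := by
  have hsec := fun w : WittVector p (FractionRing R) =>
    isSection_iff (n := n) (f := f) (u := p * u) hv (w := w)
  have hinj := IsFractionRing.injective R (FractionRing R)
  have hcongr : ∀ w w', WittVector.truncate n w = WittVector.truncate n w' → σ w = σ w' := by
    intro w w' hw
    have : w - w' ∈ RingHom.ker (WittVector.truncate (p := p) (R := 𝔎) n) := by
      rw [RingHom.mem_ker, map_sub, hw, sub_self]
    rw [mem_ker_truncate] at this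
    have h2 := h.map_verschiebung ((w - w').shift n)
    rw [← eq_iterate_verschiebung this, map_sub, sub_eq_zero] at h2
    exact h2
  have key : ∀ w : wittDivSections p n f (p * u) hv, ∃ r : R, ∀ x : WittVector p 𝔎,
      WittVector.truncate n x = w.1 → algebraMap R 𝔎 r = σ x := by
    intro w
    obtain ⟨x, hx⟩ := WittVector.truncate_surjective p n _ w.1
    obtain ⟨r, hr⟩ := hσ x ((hsec x).2 (by rw [hx]; exact w.2))
    exact ⟨r, fun y hy => by rw [hr, hcongr x y (hx.trans hy.symm)]⟩
  choose ρ hρ using key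
  have hsurj := WittVector.truncate_surjective p n (FractionRing R)
  have hp0 : ∀ c : WittVector p 𝔎, ∀ w, σ (WittVector.frobenius c * w) = c.coeff 0 * σ w := by
    intro c w
    obtain ⟨v, hv, -⟩ := exists_eq_teichmuller_add c
    conv_lhs => rw [hv]
    rw [map_add, frobenius_teichmuller, frobenius_verschiebung, add_mul, map_add, h.semilinear,
      mul_comm v, mul_assoc, h.map_p_mul, add_zero]
  refine ⟨AddMonoidHom.mk' ρ fun w w' => ?_, fun c w => ?_, fun c => ?_⟩
  · apply hinj
    obtain ⟨x, hx⟩ := hsurj w.1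
    obtain ⟨x', hx'⟩ := hsurj w'.1
    rw [map_add, hρ w x hx, hρ w' x' hx', ← map_add]
    exact hρ _ _ (by rw [map_add, hx, hx']; rfl)
  · apply hinj
    obtain ⟨x, hx⟩ := hsurj w.1
    obtain ⟨c, rfl⟩ := WittVector.truncate_surjective p n R c
    rw [AddMonoidHom.mk'_apply, map_mul, hρ w x hx,
      WittVector.coeff_truncate, hρ _ (WittVector.frobenius (WittVector.map (algebraMap R 𝔎) c) * x)
        (by rw [map_mul, ← wittFrob_truncate, hx]), hp0, map_coeff]
  · apply hinj
    obtain ⟨c, rfl⟩ := WittVector.truncate_surjective p n R c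
    rw [AddMonoidHom.mk'_apply, WittVector.coeff_truncate, hρ _ (WittVector.frobenius
      (WittVector.map (algebraMap R 𝔎) c) * 1) (by rw [mul_one, ← wittFrob_truncate]), hp0, h1,
      map_coeff, mul_one]

variable {n : ℕ} {f : R}

theorem isSection_pole (hf : f ≠ 0) {i : ℕ} (hi : i < n) {w : WittVector p (FractionRing R)}
    (hw : w ∈ wittOver p (baseSubring R)) :
    IsSection n f (p * (p ^ n - 2)) (p ^ n) (verschiebung^[i]
      (teichmuller p ((algebraMap R 𝔎 f ^ poleOrder p n i)⁻¹) * w)) := by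
  have hf' : algebraMap R 𝔎 f ≠ 0 :=
    (map_ne_zero_iff _ (IsFractionRing.injective R (FractionRing R))).2 hf
  have hle : poleOrder p n i * p ^ n ≤ p ^ (i + 1) * (p ^ n - 2) := by
    rw [poleOrder]
    split_ifs with h
    · rw [Nat.sub_mul, Nat.mul_sub, one_mul]
      refine Nat.sub_le_sub_left ?_ _
      obtain ⟨m, rfl⟩ : ∃ m, n = i + 1 + (m + 1) := ⟨n - i - 2, by omega⟩
      rw [pow_add p (i + 1)]
      refine Nat.mul_le_mul_left _ ?_
      exact hp.out.two_le.trans (Nat.le_self_pow (Nat.succ_ne_zero _) _)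
    · rw [show i + 1 = n by omega, mul_comm]
  intro j hj
  by_cases hij : j < i
  · rw [iterate_verschiebung_coeff_eq_zero _ hij]
    exact mem_divSections_of_mem (zero_mem _)
  · obtain ⟨l, rfl⟩ := Nat.exists_eq_add_of_le (not_lt.1 hij)
    rw [add_comm i l, iterate_verschiebung_coeff, teichmuller_mul_coeff]
    have hw' := mem_wittOver.1 hw l
    obtain ⟨m, hm⟩ := Nat.exists_eq_add_of_le (Nat.mul_le_mul_left (p ^ l) hle)
    have e : p ^ (l + i) * (p * (p ^ n - 2)) = poleOrder p n i * p ^ l * p ^ n + m := by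
      calc _ = p ^ l * (p ^ (i + 1) * (p ^ n - 2)) := by ring
        _ = _ := by rw [hm]; ring
    change _ * _ ∈ baseSubring R
    rw [mul_pow, ← pow_mul, inv_pow, ← pow_mul, e, pow_add, ← mul_assoc (poleOrder p n i),
      mul_right_comm, ← mul_assoc, inv_mul_cancel₀ (pow_ne_zero _ hf'), one_mul]
    exact mul_mem (pow_mem (RingHom.mem_range_self _ _) _) (pow_mem hw' _)

theorem mem_baseSubring_of_pow {a : FractionRing R} {v : ℕ} (hv : 0 < v)
    (h : a ^ v ∈ baseSubring R) : a ∈ baseSubring R := by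
  have h1 : IsIntegral R (a ^ v) := IsIntegrallyClosed.isIntegral_iff.2 h
  exact IsIntegrallyClosed.isIntegral_iff.1 ((IsIntegral.pow_iff hv).1 h1)

/-- A prime in the denominator of `a` would divide `f ^ m` to order at least `v`, but it divides
squarefree `f` at most once and `m < v`. -/
theorem mem_baseSubring_of_squarefree [UniqueFactorizationMonoid R] (hsq : Squarefree f)
    {a : FractionRing R} {v m : ℕ} (hv : m < v)
    (h : a ^ v * algebraMap R 𝔎 f ^ m ∈ baseSubring R) : a ∈ baseSubring R := by
  obtain ⟨c, d, hcd, rfl⟩ := IsFractionRing.exists_reduced_fraction (A := R) (K := FractionRing R) a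
  have hd : algebraMap R 𝔎 d ≠ 0 := IsFractionRing.to_map_ne_zero_of_mem_nonZeroDivisors d.2
  rw [IsFractionRing.mk'_eq_div] at h ⊢
  obtain ⟨e, he⟩ := h
  have hdvd : (d : R) ^ v ∣ c ^ v * f ^ m := by
    refine ⟨e, IsFractionRing.injective R 𝔎 ?_⟩
    rw [map_mul, map_mul, map_pow, map_pow, map_pow, he, div_pow,
      div_mul_eq_mul_div, mul_div_cancel₀ _ (pow_ne_zero _ hd)]
  have hdf : (d : R) ^ v ∣ f ^ m := by
    have hrel : IsRelPrime ((d : R) ^ v) (c ^ v) := (hcd.symm.pow_left).pow_right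
    exact hrel.dvd_of_dvd_mul_left hdvd
  have hunit : IsUnit (d : R) := by
    by_contra hnu
    obtain ⟨π, hπ, hπd⟩ := WfDvdMonoid.exists_irreducible_factor hnu (nonZeroDivisors.ne_zero d.2)
    have hπp := UniqueFactorizationMonoid.irreducible_iff_prime.1 hπ
    have h1 : π ^ v ∣ f ^ m := (pow_dvd_pow_of_dvd hπd v).trans hdf
    have h2 : emultiplicity π (f ^ m) ≤ m := by
      rw [emultiplicity_pow hπp]
      have h3 : emultiplicity π f ≤ 1 := by
        by_contra h4
        rw [not_le, ← Order.add_one_le_iff_of_not_isMax (by simp)] at h4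
        have h5 : π ^ 2 ∣ f := pow_dvd_of_le_emultiplicity (by simpa [one_add_one_eq_two] using h4)
        exact hπp.not_isUnit (hsq π (by rwa [← sq]))
      calc (m : ℕ∞) * emultiplicity π f ≤ m * 1 := by gcongr
        _ = m := mul_one _
    have h4 : (v : ℕ∞) ≤ m := (le_emultiplicity_of_pow_dvd h1).trans h2
    exact absurd (Nat.cast_le.1 h4) (by omega)
  obtain ⟨y, hy⟩ := hunit
  refine ⟨c * (y⁻¹ : Rˣ), ?_⟩
  rw [eq_div_iff hd, ← map_mul, mul_assoc, ← hy, Units.inv_mul, mul_one]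

/-- Converse to `isSection_pole`: for squarefree `f` the largest integral pole along `f` allowed by
the `ℚ`-divisor is `poleOrder`. A section is then split into terms `V ^ i [a_i]`. For `n = 1` there
is nothing to round. -/
theorem mem_of_isIntegralOn [UniqueFactorizationMonoid R] (hf : f ≠ 0)
    (hsq : 1 < n → Squarefree f) {σ : WittVector p (FractionRing R) →+ FractionRing R}
    (h : IsWittFunctional n σ)
    (hσ : IsIntegralOn (baseSubring R) σ (algebraMap R 𝔎 f) n) (w : WittVector p (FractionRing R))
    (hw : IsSection n f (p * (p ^ n - 2)) (p ^ n) w) : σ w ∈ baseSubring R := by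
  have hf' : algebraMap R 𝔎 f ≠ 0 :=
    (map_ne_zero_iff _ (IsFractionRing.injective R (FractionRing R))).2 hf
  have hcomp : ∀ i < n, ∀ a ∈ divSections f (p ^ i * (p * (p ^ n - 2))) (p ^ n),
      algebraMap R 𝔎 f ^ poleOrder p n i * a ∈ baseSubring R := by
    intro i hi a ha
    change _ * _ ∈ baseSubring R at ha
    rw [poleOrder]
    have hpn : 2 ≤ p ^ n := hp.out.two_le.trans (Nat.le_self_pow (by omega) _)
    split_ifs with hin
    · obtain ⟨m, rfl⟩ : ∃ m, n = i + 1 + (m + 1) := ⟨n - i - 2, by omega⟩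
      have h2 : 2 ≤ p ^ (m + 1) := hp.out.two_le.trans (Nat.le_self_pow (Nat.succ_ne_zero _) _)
      have hpi : 0 < p ^ (i + 1) := pow_pos hp.out.pos _
      have hle : 2 * p ^ (i + 1) ≤ p ^ (i + 1 + (m + 1)) := by
        rw [pow_add p (i + 1), mul_comm]; exact Nat.mul_le_mul_left _ h2
      -- With `P = p ^ n` and `Q = p ^ (i+1)`, the exponents satisfy `(Q - 1) P + (P - 2 Q) = Q (P -
      -- 2)`. The fractional part left after the pole `Q - 1` is `(P - 2 Q) / P < 1`.
      refine mem_baseSubring_of_squarefree (hsq (by omega))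
        (v := p ^ (i + 1 + (m + 1))) (m := p ^ (i + 1 + (m + 1)) - 2 * p ^ (i + 1)) (by omega) ?_
      have e : (p ^ (i + 1) - 1) * p ^ (i + 1 + (m + 1)) +
          (p ^ (i + 1 + (m + 1)) - 2 * p ^ (i + 1)) =
          p ^ i * (p * (p ^ (i + 1 + (m + 1)) - 2)) := by
        rw [← mul_assoc, ← pow_succ]
        generalize p ^ (i + 1 + (m + 1)) = P at *
        generalize p ^ (i + 1) = Q at *
        obtain ⟨Q, rfl⟩ : ∃ Q', Q = Q' + 1 := ⟨Q - 1, by omega⟩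
        obtain ⟨P, rfl⟩ := Nat.exists_eq_add_of_le hle
        rw [Nat.add_sub_cancel_left, Nat.add_sub_cancel,
          show 2 * (Q + 1) + P - 2 = 2 * Q + P by omega]
        ring
      rw [mul_pow, mul_right_comm, ← pow_mul, ← pow_add, e, mul_comm]
      exact ha
    · refine mem_baseSubring_of_pow (v := p ^ n) (by omega) ?_
      have e : (p ^ (i + 1) - 2) * p ^ n = p ^ i * (p * (p ^ n - 2)) := by
        rw [← mul_assoc, ← pow_succ, show i + 1 = n by omega, mul_comm]
      rw [mul_pow, ← pow_mul, e, mul_comm]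
      exact ha
  suffices H : ∀ m i, i + m = n → ∀ x : WittVector p 𝔎,
      (∀ j, i + j < n → x.coeff j ∈ divSections f (p ^ (i + j) * (p * (p ^ n - 2))) (p ^ n)) →
      σ (verschiebung^[i] x) ∈ baseSubring R from
    H n 0 (zero_add _) w fun j hj => by rw [zero_add] at hj ⊢; exact hw j hj
  intro m
  induction m with
  | zero =>
    intro i hi x _
    rw [h.map_verschiebung_of_le (by omega)]
    exact zero_mem _
  | succ m ih =>
    intro i hi x hx
    obtain ⟨v, hv, hvc⟩ := exists_eq_teichmuller_add x
    rw [hv, iterate_verschiebung_add, map_add, ← Function.iterate_succ_apply]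
    refine add_mem ?_ (ih (i + 1) (by omega) v fun j hj => ?_)
    · have h0 := hcomp i (by omega) _ (hx 0 (by omega))
      have e : teichmuller p (x.coeff 0) = teichmuller p
          ((algebraMap R 𝔎 f ^ poleOrder p n i)⁻¹) * teichmuller p
            (algebraMap R 𝔎 f ^ poleOrder p n i * x.coeff 0) := by
        rw [← map_mul, inv_mul_cancel_left₀ (pow_ne_zero _ hf')]
      rw [e]
      exact hσ i (by omega) _ (teichmuller_mem_wittOver h0)
    · rw [hvc, add_right_comm, add_assoc]
      exact hx (j + 1) (by omega)

end Bridge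
end NonSplit

namespace NonSplit
set_option linter.unusedSectionVars false
open MvPolynomial

/-! ### The trace on polynomials over a perfect field -/

section PolyTrace

variable {p : ℕ} [hp : Fact p.Prime] {ι : Type*} [Finite ι] {k : Type*} [Field k] [CharP k p]
  [PerfectRing k p]

/-- The exponent `(m, …, m)`. -/
noncomputable def constExp (ι : Type*) [Finite ι] (m : ℕ) : ι →₀ ℕ :=
  Finsupp.equivFunOnFinite.symm fun _ => m

@[simp]
theorem constExp_apply (m : ℕ) (j : ι) : constExp ι m j = m := rfl

theorem expShift_injective (p : ℕ) [hp : Fact p.Prime] :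
    Function.Injective fun m : ι →₀ ℕ => p • m + constExp ι (p - 1) := by
  intro m m' h
  ext j
  have := DFunLike.congr_fun h j
  simp only [Finsupp.add_apply, Finsupp.smul_apply, smul_eq_mul, add_left_inj] at this
  exact Nat.eq_of_mul_eq_mul_left hp.out.pos this

variable (p) in
/-- The underlying function of `polyTrace`. -/
noncomputable def polyTraceFun (a : MvPolynomial ι k) : MvPolynomial ι k :=
  ∑ m ∈ a.support.preimage _ (expShift_injective p).injOn,
    monomial m ((frobeniusEquiv k p).symm (coeff (p • m + constExp ι (p - 1)) a))

theorem coeff_polyTraceFun (a : MvPolynomial ι k) (m : ι →₀ ℕ) :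
    coeff m (polyTraceFun p a) =
      (frobeniusEquiv k p).symm (coeff (p • m + constExp ι (p - 1)) a) := by
  classical
  rw [polyTraceFun, coeff_sum]
  simp only [coeff_monomial]
  rw [Finset.sum_ite_eq']
  split_ifs with h
  · rfl
  · rw [Finset.mem_preimage, notMem_support_iff] at h
    rw [h, map_zero]

variable (p) in
/-- The `p⁻¹`-linear trace on polynomials, which takes `c x ^ (p m + p - 1)` to
`c ^ (1 / p) x ^ m` and kills all other monomials. -/
noncomputable def polyTrace : MvPolynomial ι k →+ MvPolynomial ι k :=
  AddMonoidHom.mk' (polyTraceFun p) fun a b => by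
    ext m
    rw [coeff_add, coeff_polyTraceFun, coeff_polyTraceFun, coeff_polyTraceFun, coeff_add, map_add]

theorem coeff_polyTrace (a : MvPolynomial ι k) (m : ι →₀ ℕ) :
    coeff m (polyTrace p a) =
      (frobeniusEquiv k p).symm (coeff (p • m + constExp ι (p - 1)) a) :=
  coeff_polyTraceFun a m

theorem coeff_polyTrace_pow (a : MvPolynomial ι k) (m : ι →₀ ℕ) :
    coeff m (polyTrace p a) ^ p = coeff (p • m + constExp ι (p - 1)) a := by
  rw [coeff_polyTrace, frobeniusEquiv_symm_pow_p]

theorem polyTrace_pow_mul (c a : MvPolynomial ι k) : polyTrace p (c ^ p * a) = c * polyTrace p a := by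
  induction c using MvPolynomial.induction_on' with
  | add c c' hc hc' => rw [add_pow_char, add_mul, map_add, hc, hc', add_mul]
  | monomial s r =>
    ext m
    rw [coeff_polyTrace, monomial_pow, coeff_monomial_mul', coeff_monomial_mul', coeff_polyTrace]
    have hiff : p • s ≤ p • m + constExp ι (p - 1) ↔ s ≤ m := by
      simp only [Finsupp.le_def, Finsupp.add_apply, Finsupp.smul_apply, smul_eq_mul,
        constExp_apply]
      refine forall_congr' fun j => ⟨fun h => ?_, fun h => ?_⟩
      · have := hp.out.pos
        by_contra hlt
        have : p * (m j + 1) ≤ p * s j := Nat.mul_le_mul_left _ (by omega)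
        rw [mul_add] at this
        omega
      · have := Nat.mul_le_mul_left p h
        omega
    simp only [hiff]
    split_ifs with h
    · rw [map_mul, frobeniusEquiv_symm_pow]
      congr 3
      ext j
      have := Nat.mul_le_mul_left p (h j)
      simp only [Finsupp.tsub_apply, Finsupp.add_apply, Finsupp.smul_apply, smul_eq_mul,
        constExp_apply, Nat.mul_sub]
      omega
    · rw [map_zero]

/-- The exponent with values `β j`. -/
noncomputable def finExp (β : ι → Fin p) : ι →₀ ℕ :=
  Finsupp.equivFunOnFinite.symm fun j => (β j : ℕ)

/-- The exponent with values `p - 1 - β j`. -/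
noncomputable def finExp' (β : ι → Fin p) : ι →₀ ℕ :=
  Finsupp.equivFunOnFinite.symm fun j => p - 1 - (β j : ℕ)

/-- The monomials with exponents below `p` form a basis over `p`-th powers, and the trace pairs `x ^
β` with `x ^ (p - 1 - β)`. -/
theorem polyTrace_expand [Fintype ι] [DecidableEq ι] (a : MvPolynomial ι k) :
    a = ∑ β : ι → Fin p,
      polyTrace p (monomial (finExp' β) 1 * a) ^ p * monomial (finExp β) 1 := by
  induction a using MvPolynomial.induction_on' with
  | add a b ha hb =>
    conv_lhs => rw [ha, hb]
    rw [← Finset.sum_add_distrib]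
    refine Finset.sum_congr rfl fun β _ => ?_
    rw [mul_add, map_add, add_pow_char, add_mul]
  | monomial m r =>
    have hp0 := hp.out.pos
    let β₀ : ι → Fin p := fun j => ⟨m j % p, Nat.mod_lt _ hp0⟩
    rw [Finset.sum_eq_single β₀]
    · set q : ι →₀ ℕ := Finsupp.equivFunOnFinite.symm fun j => m j / p with hq
      have hm : finExp' β₀ + m = p • q + constExp ι (p - 1) := by
        ext j
        have h1 := Nat.div_add_mod (m j) p
        have h2 := Nat.mod_lt (m j) hp0
        simp only [finExp', Finsupp.add_apply, Finsupp.smul_apply, smul_eq_mul, constExp_apply, hq,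
          Finsupp.equivFunOnFinite_symm_apply_apply, β₀]
        omega
      have hm' : p • q + finExp β₀ = m := by
        ext j
        have h1 := Nat.div_add_mod (m j) p
        simpa only [finExp, Finsupp.add_apply, Finsupp.smul_apply, smul_eq_mul, hq,
          Finsupp.equivFunOnFinite_symm_apply_apply, β₀] using h1
      have : polyTrace p (monomial (finExp' β₀) 1 * monomial m r) =
          monomial q ((frobeniusEquiv k p).symm r) := by
        ext l
        rw [monomial_mul, one_mul, hm, coeff_polyTrace, coeff_monomial, coeff_monomial]
        have : p • q + constExp ι (p - 1) = p • l + constExp ι (p - 1) ↔ q = l :=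
          (expShift_injective p).eq_iff
        simp only [this]
        split_ifs <;> simp
      rw [this, monomial_pow, frobeniusEquiv_symm_pow_p, monomial_mul, mul_one, hm']
    · intro β _ hβ
      have : polyTrace p (monomial (finExp' β) 1 * monomial m r) = 0 := by
        ext l
        rw [monomial_mul, coeff_polyTrace, coeff_monomial, if_neg, map_zero, coeff_zero]
        intro h
        refine hβ (funext fun j => Fin.ext ?_)
        have h1 := DFunLike.congr_fun h j
        have h2 := (β j).2
        simp only [finExp', Finsupp.add_apply, Finsupp.smul_apply, smul_eq_mul, constExp_apply,
          Finsupp.equivFunOnFinite_symm_apply_apply] at h1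
        have h3 : m j = β j + p * l j := by omega
        simp only [β₀]
        rw [h3, Nat.add_mul_mod_self_left, Nat.mod_eq_of_lt h2]
      rw [this, zero_pow hp.out.ne_zero, zero_mul]
    · simp

end PolyTrace

/-! ### Extending `p⁻¹`-linear maps to the fraction field -/

section Extension

variable {p : ℕ} [hp : Fact p.Prime] {A K : Type*} [CommRing A] [IsDomain A] [Field K]
  [Algebra A K] [IsFractionRing A K]

theorem exists_pow_mul_eq (y : K) :
    ∃ c a : A, c ≠ 0 ∧ algebraMap A K c ^ p * y = algebraMap A K a := by
  obtain ⟨⟨a, b⟩, hab⟩ := IsLocalization.surj (nonZeroDivisors A) y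
  refine ⟨b, b ^ (p - 1) * a, nonZeroDivisors.ne_zero b.2, ?_⟩
  rw [map_mul, ← hab, map_pow, ← mul_assoc, mul_right_comm, ← pow_succ,
    Nat.sub_add_cancel hp.out.one_le]

/-- A `p⁻¹`-linear map extends to the fraction field. -/
theorem exists_extend_trace (u : A →+ A) (hu : ∀ c a, u (c ^ p * a) = c * u a) :
    ∃ v : K →+ K, (∀ c y, v (c ^ p * y) = c * v y) ∧
      ∀ a, v (algebraMap A K a) = algebraMap A K (u a) := by
  have hne : ∀ {c : A}, c ≠ 0 → algebraMap A K c ≠ 0 := fun hc =>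
    (map_ne_zero_iff _ (IsFractionRing.injective A K)).2 hc
  choose d a hd ha using exists_pow_mul_eq (p := p) (A := A) (K := K)
  have huniq : ∀ (c b : A) (y : K), c ≠ 0 → algebraMap A K c ^ p * y = algebraMap A K b →
      algebraMap A K (u (a y)) / algebraMap A K (d y) =
        algebraMap A K (u b) / algebraMap A K c := by
    intro c b y hc h
    rw [div_eq_div_iff (hne (hd y)) (hne hc), ← map_mul, ← map_mul, mul_comm, ← hu,
      mul_comm (u b), ← hu]
    congr 2
    apply IsFractionRing.injective A K
    rw [map_mul, map_mul, map_pow, map_pow, ← ha, ← h]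
    ring
  let v : K →+ K := AddMonoidHom.mk'
    (fun y => algebraMap A K (u (a y)) / algebraMap A K (d y)) fun y z => by
      have h0 := mul_ne_zero (hd y) (hd z)
      have e1 : algebraMap A K (d y * d z) ^ p * y = algebraMap A K (d z ^ p * a y) := by
        rw [map_mul, map_mul, map_pow, ← ha]; ring
      have e2 : algebraMap A K (d y * d z) ^ p * z = algebraMap A K (d y ^ p * a z) := by
        rw [map_mul, map_mul, map_pow, ← ha]; ring
      have e3 : algebraMap A K (d y * d z) ^ p * (y + z) =
          algebraMap A K (d z ^ p * a y + d y ^ p * a z) := by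
        rw [mul_add, e1, e2, map_add]
      rw [huniq _ _ _ h0 e1, huniq _ _ _ h0 e2, huniq _ _ _ h0 e3, map_add, map_add, add_div]
  have hv : ∀ (c b : A) (y : K), c ≠ 0 → algebraMap A K c ^ p * y = algebraMap A K b →
      v y = algebraMap A K (u b) / algebraMap A K c := huniq
  refine ⟨v, fun c y => ?_, fun b => ?_⟩
  · obtain ⟨⟨e, b⟩, hc⟩ := IsLocalization.surj (nonZeroDivisors A) c
    have hb0 : (b : A) ≠ 0 := nonZeroDivisors.ne_zero b.2
    have e1 : algebraMap A K (b * d y) ^ p * (c ^ p * y) = algebraMap A K (e ^ p * a y) := by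
      simp only at hc
      rw [map_mul, map_mul, map_pow, ← hc, ← ha]; ring
    rw [hv _ _ _ (mul_ne_zero hb0 (hd y)) e1, hv _ _ _ (hd y) (ha y), hu, map_mul, map_mul, ← hc]
    have := hne hb0
    have := hne (hd y)
    field_simp
  · rw [hv 1 b _ one_ne_zero (by simp), map_one, div_one]

end Extension
end NonSplit

namespace NonSplit
set_option linter.unusedSectionVars false
open MvPolynomial

/-! ### The trace on the fraction field of the local ring at the origin -/

section Concrete

variable {N : ℕ} {k : Type*} [Field k]

local notation "𝔸" => MvPolynomial (Fin (N + 1)) k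

variable {R : Type*} [CommRing R] [IsDomain R] [Algebra (MvPolynomial (Fin (N + 1)) k) R]
  [hR : IsLocalization.AtPrime R (originIdeal N k)]

local notation "𝔎" => FractionRing R

variable (N k R) in
theorem isFractionRing_origin :
    IsFractionRing (MvPolynomial (Fin (N + 1)) k) (FractionRing R) := by
  have hinj : Function.Injective (algebraMap 𝔸 𝔎) := by
    rw [IsScalarTower.algebraMap_eq 𝔸 R 𝔎, RingHom.coe_comp]
    exact (IsFractionRing.injective R 𝔎).comp (IsLocalization.injective R
      (Ideal.primeCompl_le_nonZeroDivisors (originIdeal N k)))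
  have : FaithfulSMul 𝔸 𝔎 := (faithfulSMul_iff_algebraMap_injective _ _).2 hinj
  refine IsFractionRing.of_field _ _ fun z => ?_
  obtain ⟨a, b, hb, rfl⟩ := IsFractionRing.div_surjective (A := R) z
  obtain ⟨⟨a1, a2⟩, ha⟩ := IsLocalization.surj (originIdeal N k).primeCompl a
  obtain ⟨⟨b1, b2⟩, hb'⟩ := IsLocalization.surj (originIdeal N k).primeCompl b
  have h0 : ∀ c : (originIdeal N k).primeCompl, algebraMap 𝔸 𝔎 c ≠ 0 := fun c =>
    (map_ne_zero_iff _ hinj).2 fun h => c.2 (h ▸ (originIdeal N k).zero_mem)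
  have hbK : algebraMap R 𝔎 b ≠ 0 := IsFractionRing.to_map_ne_zero_of_mem_nonZeroDivisors hb
  have ha' := congrArg (algebraMap R 𝔎) ha
  have hb'' := congrArg (algebraMap R 𝔎) hb'
  rw [map_mul, ← IsScalarTower.algebraMap_apply, ← IsScalarTower.algebraMap_apply] at ha' hb''
  refine ⟨a1 * b2, a2 * b1, ?_⟩
  rw [map_mul, map_mul, ← ha', ← hb'']
  have := h0 a2
  have := h0 b2
  field_simp

attribute [local instance] isFractionRing_origin

theorem algebraMap_mem_baseSubring (a : MvPolynomial (Fin (N + 1)) k) :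
    algebraMap 𝔸 𝔎 a ∈ baseSubring R := by
  rw [IsScalarTower.algebraMap_apply _ R]
  exact RingHom.mem_range_self _ _

theorem algebraMap_inv_mem_baseSubring {a : MvPolynomial (Fin (N + 1)) k}
    (ha : constantCoeff a ≠ 0) : (algebraMap 𝔸 𝔎 a)⁻¹ ∈ baseSubring R := by
  have hu : IsUnit (algebraMap 𝔸 R a) :=
    IsLocalization.map_units R (⟨a, ha⟩ : (originIdeal N k).primeCompl)
  obtain ⟨v, hv⟩ := hu
  refine ⟨(v⁻¹ : Rˣ), eq_inv_of_mul_eq_one_left ?_⟩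
  rw [IsScalarTower.algebraMap_apply 𝔸 R 𝔎, ← hv, ← map_mul, Units.inv_mul, map_one]

theorem exists_mul_eq_of_mem {y : FractionRing R} (hy : y ∈ baseSubring R) :
    ∃ t a : MvPolynomial (Fin (N + 1)) k, constantCoeff t ≠ 0 ∧
      algebraMap 𝔸 𝔎 t * y = algebraMap 𝔸 𝔎 a := by
  obtain ⟨r, rfl⟩ := hy
  obtain ⟨⟨a, b⟩, hab⟩ := IsLocalization.surj (originIdeal N k).primeCompl r
  refine ⟨b, a, b.2, ?_⟩
  rw [IsScalarTower.algebraMap_apply 𝔸 R 𝔎, IsScalarTower.algebraMap_apply 𝔸 R 𝔎, ← hab, map_mul,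
    mul_comm]

theorem algebraMap_ne_zero_of_constantCoeff {t : MvPolynomial (Fin (N + 1)) k}
    (ht : constantCoeff t ≠ 0) : algebraMap 𝔸 𝔎 t ≠ 0 :=
  (map_ne_zero_iff _ (IsFractionRing.injective _ _)).2 fun h => ht (by rw [h, map_zero])

variable (N k R) in
/-- A trace on the fraction field of the local ring which restricts to `polyTrace`. -/
theorem exists_traceData (p : ℕ) [hp : Fact p.Prime] [CharP k p] [PerfectRing k p] :
    ∃ T : TraceData p (baseSubring R), ∀ a : MvPolynomial (Fin (N + 1)) k,
      T.u (algebraMap _ _ a) = algebraMap _ _ (polyTrace p a) := by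
  obtain ⟨u, hu, hua⟩ := exists_extend_trace (p := p) (K := 𝔎)
    (polyTrace p (ι := Fin (N + 1)) (k := k)) polyTrace_pow_mul
  refine ⟨⟨u, hu, ?_, Fin (N + 1) → Fin p, inferInstance,
    fun β => algebraMap (MvPolynomial (Fin (N + 1)) k) _ (monomial (finExp β) 1),
    fun β => algebraMap (MvPolynomial (Fin (N + 1)) k) _ (monomial (finExp' β) 1),
    fun _ => algebraMap_mem_baseSubring _, fun _ => algebraMap_mem_baseSubring _, ?_⟩, hua⟩
  · intro y hy
    obtain ⟨t, a, ht, hta⟩ := exists_mul_eq_of_mem (N := N) (k := k) hy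
    have h0 := algebraMap_ne_zero_of_constantCoeff (R := R) ht
    -- Writing `y = a / t` as `t ^ (p-1) a / t ^ p` lets the unit denominator leave the trace.
    have : u y = (algebraMap _ _ t)⁻¹ * algebraMap (MvPolynomial (Fin (N + 1)) k) _
        (polyTrace p (t ^ (p - 1) * a)) := by
      rw [eq_inv_mul_iff_mul_eq₀ h0, ← hu, ← hua, map_mul (algebraMap 𝔸 𝔎), ← hta, map_pow, ← mul_assoc, ← pow_succ,
        Nat.sub_add_cancel hp.out.one_le]
    rw [this]
    exact mul_mem (algebraMap_inv_mem_baseSubring ht) (algebraMap_mem_baseSubring _)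
  · intro y
    obtain ⟨c, a, hc, hca⟩ := exists_pow_mul_eq (p := p) (A := MvPolynomial (Fin (N + 1)) k) y
    have hc0 : algebraMap _ (FractionRing R) c ≠ 0 :=
      (map_ne_zero_iff _ (IsFractionRing.injective _ _)).2 hc
    apply mul_left_cancel₀ (pow_ne_zero p hc0)
    conv_lhs => rw [hca, polyTrace_expand (p := p) a]
    rw [map_sum, Finset.mul_sum]
    refine Finset.sum_congr rfl fun β _ => ?_
    rw [map_mul, map_pow, ← hua, map_mul, ← hca, mul_left_comm, hu, mul_pow, mul_assoc]

end Concrete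

/-! ### Construction of the section with `x_j ↦ [x_j]` -/

section SectionConstruction

open WittVector

variable {p : ℕ} [hp : Fact p.Prime]

/-- `W(L) / p`. -/
abbrev WittMod (p : ℕ) [Fact p.Prime] (L : Type*) [CommRing L] : Type _ :=
  WittVector p L ⧸ Ideal.span {(p : WittVector p L)}

theorem mk_frobenius_verschiebung {L : Type*} [CommRing L] (w : WittVector p L) :
    (Ideal.Quotient.mk _ (WittVector.frobenius (verschiebung w)) : WittMod p L) = 0 := by
  rw [Ideal.Quotient.eq_zero_iff_mem, Ideal.mem_span_singleton, frobenius_verschiebung]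
  exact dvd_mul_left _ _

/-- The ring homomorphism `c ↦ [c ^ p]` from `L` to `W(L) / p`. -/
noncomputable def frobSection (p : ℕ) [Fact p.Prime] (L : Type*) [CommRing L] [CharP L p] :
    L →+* WittMod p L where
  toFun c := Ideal.Quotient.mk _ (WittVector.frobenius (teichmuller p c))
  map_one' := by simp
  map_zero' := by simp
  map_mul' c d := by simp
  map_add' c d := by
    -- `[c] + [d]` and `[c + d]` differ by an element `V v`, and `F V v = p v` vanishes modulo `p`.
    obtain ⟨v, hv, -⟩ := exists_eq_teichmuller_add (teichmuller p c + teichmuller p d)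
    have h0 : (teichmuller p c + teichmuller p d).coeff 0 = c + d := by
      have := map_add (WittVector.constantCoeff (p := p) (R := L)) (teichmuller p c)
        (teichmuller p d)
      simpa only [WittVector.constantCoeff_apply, teichmuller_coeff_zero] using this
    rw [← map_add, ← map_add WittVector.frobenius, hv, map_add WittVector.frobenius,
      map_add (Ideal.Quotient.mk _), mk_frobenius_verschiebung, add_zero, h0]

/-- The ring homomorphism `W(L) / p → L`. -/
noncomputable def wittModCoeff (p : ℕ) [Fact p.Prime] (L : Type*) [CommRing L] [CharP L p] :
    WittMod p L →+* L :=
  Ideal.Quotient.lift _ WittVector.constantCoeff fun a ha => by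
    obtain ⟨b, rfl⟩ := Ideal.mem_span_singleton.1 ha
    rw [map_mul, map_natCast, CharP.cast_eq_zero, zero_mul]

@[simp]
theorem wittModCoeff_mk {L : Type*} [CommRing L] [CharP L p] (w : WittVector p L) :
    wittModCoeff p L (Ideal.Quotient.mk _ w) = w.coeff 0 := rfl

theorem isUnit_wittMod {L : Type*} [Field L] [CharP L p] {z : WittMod p L}
    (h : wittModCoeff p L z ≠ 0) : IsUnit z := by
  obtain ⟨w, rfl⟩ := Ideal.Quotient.mk_surjective z
  exact (isUnit_of_coeff_zero_ne_zero w h).map _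

variable {N : ℕ} {k : Type*} [Field k] [CharP k p] [PerfectRing k p]

local notation "𝔸" => MvPolynomial (Fin (N + 1)) k

variable {R : Type*} [CommRing R] [IsDomain R] [CharP R p]
  [Algebra (MvPolynomial (Fin (N + 1)) k) R]
  [hR : IsLocalization.AtPrime R (originIdeal N k)]

local notation "𝔎" => FractionRing R

attribute [local instance] isFractionRing_origin

variable (p N k R) in
/-- The ring homomorphism `k[x] → W(K) / p` which takes `x_j` to `[x_j]` and `c` to `[c]`. -/
noncomputable def polySection :
    MvPolynomial (Fin (N + 1)) k →+* WittMod p (FractionRing R) :=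
  -- Additivity modulo `p` is available for `c ↦ [c ^ p]`, so constants are first replaced by their
  -- `p`-th roots; this needs `k` perfect.
  eval₂Hom (((frobSection p 𝔎).comp ((algebraMap 𝔸 𝔎).comp C)).comp
    (frobeniusEquiv k p).symm.toRingHom) fun j =>
      Ideal.Quotient.mk _ (teichmuller p (algebraMap 𝔸 𝔎 (X j)))

theorem polySection_C (c : k) : polySection p N k R (C c) =
    Ideal.Quotient.mk _ (teichmuller p (algebraMap 𝔸 𝔎 (C c))) := by
  rw [polySection, eval₂Hom_C]
  change Ideal.Quotient.mk _ (WittVector.frobenius (teichmuller p (algebraMap 𝔸 𝔎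
    (C ((frobeniusEquiv k p).symm c))))) = _
  rw [frobenius_teichmuller, ← map_pow, ← map_pow, frobeniusEquiv_symm_pow_p]

theorem polySection_X (j : Fin (N + 1)) : polySection p N k R (X j) =
    Ideal.Quotient.mk _ (teichmuller p (algebraMap 𝔸 𝔎 (X j))) := by
  rw [polySection, eval₂Hom_X']

theorem wittModCoeff_polySection (a : MvPolynomial (Fin (N + 1)) k) :
    wittModCoeff p 𝔎 (polySection p N k R a) = algebraMap 𝔸 𝔎 a := by
  have : (wittModCoeff p 𝔎).comp (polySection p N k R) = algebraMap 𝔸 𝔎 := by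
    refine MvPolynomial.ringHom_ext (fun c => ?_) fun j => ?_
    · rw [RingHom.comp_apply, polySection_C, wittModCoeff_mk, teichmuller_coeff_zero]
    · rw [RingHom.comp_apply, polySection_X, wittModCoeff_mk, teichmuller_coeff_zero]
  exact DFunLike.congr_fun this a

theorem exists_lift_polySection (a : MvPolynomial (Fin (N + 1)) k) :
    ∃ w ∈ wittOver p (baseSubring R),
      Ideal.Quotient.mk _ w = polySection p N k R a := by
  induction a using MvPolynomial.induction_on with
  | C c => exact ⟨_, teichmuller_mem_wittOver (algebraMap_mem_baseSubring _),
      (polySection_C c).symm⟩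
  | add a b ha hb =>
    obtain ⟨w, hw, hw'⟩ := ha
    obtain ⟨v, hv, hv'⟩ := hb
    exact ⟨w + v, add_mem hw hv, by rw [map_add, map_add, hw', hv']⟩
  | mul_X a j ha =>
    obtain ⟨w, hw, hw'⟩ := ha
    exact ⟨_, mul_mem hw (teichmuller_mem_wittOver (algebraMap_mem_baseSubring (X j))),
      by rw [map_mul, map_mul, hw', polySection_X]⟩

variable (p N k R) in
-- A Witt vector over a field with nonzero zeroth component is a unit, so `polySection` extends to
-- `K`. For the local ring, `a / t = (t⁻¹) ^ p * (t ^ (p-1) a)`, where the first factor lifts to a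
-- Teichmüller element with integral components.
theorem exists_sectionData :
    ∃ s : SectionData p (baseSubring R), ∀ a : MvPolynomial (Fin (N + 1)) k,
      s.s (algebraMap _ _ a) = polySection p N k R a := by
  have hunit : ∀ y : nonZeroDivisors 𝔸, IsUnit (polySection p N k R y) := fun y => by
    refine isUnit_wittMod ?_
    rw [wittModCoeff_polySection]
    exact IsFractionRing.to_map_ne_zero_of_mem_nonZeroDivisors y.2
  let s : 𝔎 →+* WittMod p 𝔎 := IsLocalization.lift hunit
  have hs : ∀ a : 𝔸, s (algebraMap _ _ a) = polySection p N k R a := fun a =>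
    IsLocalization.lift_eq hunit a
  have hcomp : (wittModCoeff p 𝔎).comp s = RingHom.id 𝔎 := by
    refine IsLocalization.ringHom_ext (nonZeroDivisors 𝔸) (RingHom.ext fun a => ?_)
    rw [RingHom.comp_apply, RingHom.comp_apply, hs, wittModCoeff_polySection]
    rfl
  have hcoeff : ∀ (y : 𝔎) (w : WittVector p 𝔎), Ideal.Quotient.mk _ w = s y → w.coeff 0 = y := by
    intro y w h
    have := DFunLike.congr_fun hcomp y
    rw [RingHom.comp_apply, ← h, wittModCoeff_mk] at this
    exact this
  have hfrob : ∀ c : 𝔎, s (c ^ p) = Ideal.Quotient.mk _ (teichmuller p (c ^ p)) := by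
    -- The base `⊥` makes the lifting requirement trivial, so `isLift_teichmuller_pow` can be
    -- applied before lifts over the local ring are known.
    let s₀ : SectionData p (⊥ : Subring 𝔎) := ⟨s, hcoeff, fun y hy => by
      obtain ⟨m, rfl⟩ := Subring.mem_bot.1 hy
      exact ⟨m, intCast_mem _ _, by rw [map_intCast, map_intCast]⟩⟩
    exact fun c => (s₀.isLift_teichmuller_pow c).symm
  refine ⟨⟨s, hcoeff, fun y hy => ?_⟩, hs⟩
  obtain ⟨t, a, ht, hta⟩ := exists_mul_eq_of_mem (N := N) (k := k) hy
  have h0 := algebraMap_ne_zero_of_constantCoeff (R := R) ht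
  obtain ⟨w, hw, hw'⟩ := exists_lift_polySection (p := p) (R := R) (t ^ (p - 1) * a)
  refine ⟨teichmuller p ((algebraMap 𝔸 𝔎 t)⁻¹ ^ p) * w, mul_mem (teichmuller_mem_wittOver
    (pow_mem (algebraMap_inv_mem_baseSubring ht) _)) hw, ?_⟩
  rw [map_mul, hw', ← hfrob, ← hs, ← map_mul, map_mul (algebraMap 𝔸 𝔎), ← hta, map_pow, ← mul_assoc (_ ^ (p - 1)),
    ← pow_succ, Nat.sub_add_cancel hp.out.one_le, ← mul_assoc, ← mul_pow, inv_mul_cancel₀ h0,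
    one_pow, one_mul]

end SectionConstruction
end NonSplit

namespace NonSplit
set_option linter.unusedSectionVars false
open MvPolynomial

/-! ### Comparing `Δ(G)(b,0)` with the Witt vector `δ` -/

section Delta

open WittVector

variable {p : ℕ} [hp : Fact p.Prime] {N : ℕ} {k : Type*} [Field k] [CharP k p] [PerfectRing k p]
  (q : Fin (N + 1) → ℕ+) (b : Lam q → k)

/-- `Δ(G)(b, 0)`. -/
noncomputable def specDelta (p : ℕ) [Fact p.Prime] {N : ℕ} {k : Type*} [Field k]
    (q : Fin (N + 1) → ℕ+) (b : Lam q → k) : MvPolynomial (Fin (N + 1)) k :=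
  MvPolynomial.map (eval b) (deltaG q p k)

theorem map_univG {K K' : Type*} [CommRing K] [CommRing K'] (g : K →+* K') :
    MvPolynomial.map (MvPolynomial.map g) (univG q K) = univG q K' := by
  simp [univG, map_monomial]

theorem map_eval_univG {K : Type*} [CommRing K] (b : Lam q → K) :
    MvPolynomial.map (eval b) (univG q K) = specG q b := by
  simp [univG, specG, map_monomial]

local notation "𝔸" => MvPolynomial (Fin (N + 1)) k

variable {R : Type*} [CommRing R] [IsDomain R] [CharP R p]
  [Algebra (MvPolynomial (Fin (N + 1)) k) R]
  [hR : IsLocalization.AtPrime R (originIdeal N k)]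

local notation "𝔎" => FractionRing R

attribute [local instance] isFractionRing_origin

variable (p R) in
/-- The ring homomorphism `W(k)[s][x] → W(K)` which takes `s_α` to `[b_α]` and `x_j` to
`[x_j]`. -/
noncomputable def wittEval :
    MvPolynomial (Fin (N + 1)) (MvPolynomial (Lam q) (WittVector p k)) →+*
      WittVector p (FractionRing R) :=
  eval₂Hom (eval₂Hom (WittVector.map ((algebraMap 𝔸 𝔎).comp C))
    fun α => teichmuller p (algebraMap 𝔸 𝔎 (C (b α)))) fun j => teichmuller p (algebraMap 𝔸 𝔎 (X j))

/-- Two ring homomorphisms are compared on generators. On `W(k)` with `k` perfect, every `V v` is `V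
F v' = p v'`, so modulo `p` only the Teichmüller part survives. -/
theorem mk_wittEval (P : MvPolynomial (Fin (N + 1)) (MvPolynomial (Lam q) (WittVector p k))) :
    (Ideal.Quotient.mk _ (wittEval p q b R P) : WittMod p 𝔎) = polySection p N k R
      (MvPolynomial.map (eval b) (MvPolynomial.map (MvPolynomial.map WittVector.constantCoeff) P)) := by
  have : (Ideal.Quotient.mk (Ideal.span {(p : WittVector p 𝔎)})).comp (wittEval p q b R) =
      (polySection p N k R).comp ((MvPolynomial.map (eval b)).comp
        (MvPolynomial.map (MvPolynomial.map WittVector.constantCoeff))) := by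
    refine MvPolynomial.ringHom_ext' (MvPolynomial.ringHom_ext (fun w => ?_) fun α => ?_)
      fun j => ?_
    · simp only [wittEval, RingHom.comp_apply, eval₂Hom_C, map_C, eval_C, polySection_C]
      obtain ⟨v, hv, -⟩ := exists_eq_teichmuller_add w
      obtain ⟨v', rfl⟩ := (WittVector.frobenius_bijective p k).2 v
      conv_lhs => rw [hv]
      rw [verschiebung_frobenius, map_add, map_add, map_teichmuller, map_mul, map_natCast, map_mul]
      have : (Ideal.Quotient.mk (Ideal.span {(p : WittVector p 𝔎)})) (p : WittVector p 𝔎) = 0 :=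
        Ideal.Quotient.eq_zero_iff_mem.2 (Ideal.mem_span_singleton_self _)
      rw [this, mul_zero, add_zero]
      rfl
    · simp only [wittEval, RingHom.comp_apply, eval₂Hom_C, eval₂Hom_X', map_C, map_X, eval_X,
        polySection_C]
    · simp only [wittEval, RingHom.comp_apply, eval₂Hom_X', map_X, polySection_X]
  exact DFunLike.congr_fun this P

theorem frobenius_wittEval
    (P : MvPolynomial (Fin (N + 1)) (MvPolynomial (Lam q) (WittVector p k))) :
    WittVector.frobenius (wittEval p q b R P) = wittEval p q b R (phi q p k P) := by
  have : (WittVector.frobenius (p := p) (R := 𝔎)).comp (wittEval p q b R) =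
      (wittEval p q b R).comp (phi q p k) := by
    refine MvPolynomial.ringHom_ext' (MvPolynomial.ringHom_ext (fun w => ?_) fun α => ?_)
      fun j => ?_
    · simp only [wittEval, phi, RingHom.comp_apply, eval₂Hom_C]
      ext i
      simp only [coeff_frobenius_charP, map_coeff, map_pow]
    · simp only [wittEval, phi, RingHom.comp_apply, eval₂Hom_C, eval₂Hom_X', map_pow,
        frobenius_teichmuller]
    · simp only [wittEval, phi, RingHom.comp_apply, eval₂Hom_X', map_pow,
        frobenius_teichmuller]
  exact DFunLike.congr_fun this P

theorem wittEval_univG_mem :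
    wittEval p q b R (univG q (WittVector p k)) ∈ wittOver p (baseSubring R) := by
  rw [univG, map_sum]
  refine Subring.sum_mem _ fun α _ => ?_
  rw [wittEval, coe_eval₂Hom, eval₂_monomial, eval₂Hom_X']
  refine Subring.mul_mem _ (teichmuller_mem_wittOver
    (algebraMap_mem_baseSubring (R := R) (C (b α)))) ?_
  exact Subring.prod_mem _ fun j _ => Subring.pow_mem _ (teichmuller_mem_wittOver
    (algebraMap_mem_baseSubring (R := R) (X j))) _

/-- `wittEval` intertwines `phi` with the Witt vector Frobenius, hence carries `G̃ ^ p - φ(G̃) = p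
D` to `S ^ p - F S = p Z`. -/
theorem exists_isDelta (s : SectionData p (baseSubring R))
    (hs : ∀ a : MvPolynomial (Fin (N + 1)) k, s.s (algebraMap _ _ a) = polySection p N k R a) :
    ∃ δ, IsDelta s (algebraMap 𝔸 𝔎 (specG q b)) (algebraMap 𝔸 𝔎 (specDelta p q b)) δ := by
  have hS : s.IsLift (wittEval p q b R (univG q (WittVector p k))) (algebraMap 𝔸 𝔎 (specG q b)) := by
    rw [SectionData.IsLift, mk_wittEval, hs, map_univG, map_eval_univG]
  have hD := Classical.choose_spec (exists_delta q p k)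
  have hZ : s.IsLift (wittEval p q b R (Classical.choose (exists_delta q p k)))
      (algebraMap 𝔸 𝔎 (specDelta p q b)) := by
    rw [SectionData.IsLift, mk_wittEval, hs]
    rfl
  have h0 : (teichmuller p (algebraMap 𝔸 𝔎 (specG q b)) -
      wittEval p q b R (univG q (WittVector p k))).coeff 0 = 0 := by
    have := map_sub (WittVector.constantCoeff (p := p) (R := 𝔎))
      (teichmuller p (algebraMap 𝔸 𝔎 (specG q b))) (wittEval p q b R (univG q (WittVector p k)))
    simp only [WittVector.constantCoeff_apply] at this
    rw [this, hS.coeff_zero, teichmuller_coeff_zero, sub_self]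
  obtain ⟨δ, hδ, hδc⟩ := exists_verschiebung_eq h0
  refine ⟨δ, ?_, _, _, hS, hZ, ?_, ?_⟩
  · rw [mem_wittOver]
    intro i
    rw [hδc]
    exact mem_wittOver.1 (Subring.sub_mem _ (teichmuller_mem_wittOver
      (algebraMap_mem_baseSubring (R := R) (specG q b)))
      (wittEval_univG_mem q b)) _
  · rw [← hδ]; ring
  · have h := congrArg (wittEval p q b R) hD
    rw [map_sub, map_pow, map_nsmul, nsmul_eq_mul] at h
    rw [frobenius_wittEval, ← h]

end Delta
end NonSplit

namespace NonSplit
set_option linter.unusedSectionVars false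
open MvPolynomial

/-! ### The splitting criterion, over the local ring and then in polynomials -/

section Main

variable {p : ℕ} [hp : Fact p.Prime]

theorem isQuasiFSplitPair_iff_chain {R : Type*} [CommRing R] [IsDomain R] [IsIntegrallyClosed R]
    [UniqueFactorizationMonoid R] [CharP R p] {f : R} (hf : f ≠ 0)
    (T : TraceData p (baseSubring R)) (s : SectionData p (baseSubring R))
    {Δ : FractionRing R} {δ : WittVector p (FractionRing R)}
    (hδ : IsDelta s (algebraMap R (FractionRing R) f) Δ δ) (hΔ : Δ ∈ baseSubring R) {n : ℕ}
    (hn : 0 < n) (hv : 0 < p ^ n) :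
    IsQuasiFSplitPair p hn f (p ^ n - 2) hv ↔
      ∃ r, ChainCond T (algebraMap R (FractionRing R) f) Δ n r ∧
        T.u (algebraMap R (FractionRing R) f ^ (p - 2) * r 0) ≠ 0 ∧
        (T.u (algebraMap R (FractionRing R) f ^ (p - 2) * r 0))⁻¹ ∈ baseSubring R := by
  have hf' : algebraMap R (FractionRing R) f ≠ 0 :=
    (map_ne_zero_iff _ (IsFractionRing.injective R (FractionRing R))).2 hf
  have hfB : algebraMap R (FractionRing R) f ∈ baseSubring R := RingHom.mem_range_self _ _
  constructor
  · intro h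
    obtain ⟨σ, hσ, hσ1, hσB⟩ := h.exists_functional hn hv
    obtain ⟨τ, hτ⟩ := hσ.exists_represents T s
    have hInt : IsIntegralOn (baseSubring R) σ (algebraMap R (FractionRing R) f) n :=
      fun i hi w hw => hσB _ (isSection_pole hf hi hw)
    obtain ⟨r, hr, hr0⟩ := (hInt.starCond hδ hf' hfB hσ hτ).exists_chain hf' hfB hΔ
    refine ⟨r, hr, ?_⟩
    rw [← hr0, ← hτ.map_one hn, hσ1]
    exact ⟨one_ne_zero, by rw [inv_one]; exact one_mem _⟩
  · rintro ⟨r, hr, h0, hinv⟩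
    have hs := hr.starCond
    set τ : ℕ → FractionRing R := fun i => algebraMap R (FractionRing R) f ^ (p ^ (i + 1) - 2) * r i
      with hτdef
    have hτ0 : τ 0 = algebraMap R (FractionRing R) f ^ (p - 2) * r 0 := by simp [hτdef]
    rw [← hτ0] at h0 hinv
    -- If `g * g` divides `f`, then `g` divides `u (τ 0)`, which is a unit.
    have hsq : 1 < n → Squarefree f := by
      intro hn1 g hg
      obtain ⟨e, he⟩ := hg
      obtain ⟨a, ⟨a, rfl⟩, ha'⟩ := hs.trace_of_sq_dvd hδ hf' hΔ hn1
        (g := algebraMap R (FractionRing R) g) (e := algebraMap R (FractionRing R) e)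
        (RingHom.mem_range_self _ _) (RingHom.mem_range_self _ _) (by rw [he, map_mul, map_mul])
      obtain ⟨c, hc⟩ := hinv
      refine IsUnit.of_mul_eq_one (a * c) (IsFractionRing.injective R (FractionRing R) ?_)
      rw [map_mul, map_mul, hc, ← mul_assoc, ← ha', mul_inv_cancel₀ h0, map_one]
    obtain ⟨Θ, hΘ, hΘτ⟩ := exists_functional T s n τ hs.trace_eq_zero
    have hInt := hs.isIntegralOn hδ hf' hfB hΘ hΘτ
    -- The functional sends `1` to the unit `u (τ 0)`, so it is divided by that unit.
    refine isQuasiFSplitPair_of_functional hn hv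
      (σ := (AddMonoidHom.mulLeft (T.u (τ 0))⁻¹).comp Θ) ⟨?_, ?_, ?_⟩ ?_ ?_
    · intro c w
      rw [AddMonoidHom.comp_apply, hΘ.semilinear]
      exact mul_left_comm _ _ _
    · intro w
      rw [AddMonoidHom.comp_apply, hΘ.map_p_mul, map_zero]
    · intro w
      rw [AddMonoidHom.comp_apply, hΘ.map_verschiebung, map_zero]
    · rw [AddMonoidHom.comp_apply, hΘτ.map_one hn]
      exact inv_mul_cancel₀ h0
    · intro w hw
      exact mul_mem hinv (mem_of_isIntegralOn hf hsq hΘ hInt w hw)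

variable {N : ℕ} {k : Type*} [Field k] [CharP k p] [PerfectRing k p]

/-- The polynomial form of `ChainCond`. -/
structure PolyChain (p : ℕ) [Fact p.Prime] {N : ℕ} {k : Type*} [Field k] [CharP k p]
    [PerfectRing k p] (f Δ : MvPolynomial (Fin (N + 1)) k) (n : ℕ)
    (r : ℕ → MvPolynomial (Fin (N + 1)) k) : Prop where
  step : ∀ i, i + 1 < n → ∃ d, r i = f * d - polyTrace p (f ^ (p - 2) * Δ * r (i + 1))
  trace_eq_zero : ∀ i, i + 1 < n → polyTrace p (f ^ (p - 2) * r (i + 1)) = 0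
  ne_zero : constantCoeff (polyTrace p (f ^ (p - 2) * r 0)) ≠ 0

local notation "𝔸" => MvPolynomial (Fin (N + 1)) k

variable {R : Type*} [CommRing R] [IsDomain R] [CharP R p]
  [Algebra (MvPolynomial (Fin (N + 1)) k) R]
  [hR : IsLocalization.AtPrime R (originIdeal N k)]

local notation "𝔎" => FractionRing R

attribute [local instance] isFractionRing_origin

theorem exists_common_denominator (n : ℕ) (y : ℕ → FractionRing R)
    (hy : ∀ i < n, y i ∈ baseSubring R) :
    ∃ c : MvPolynomial (Fin (N + 1)) k, constantCoeff c ≠ 0 ∧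
      ∀ i < n, ∃ a, algebraMap 𝔸 𝔎 c * y i = algebraMap 𝔸 𝔎 a := by
  induction n with
  | zero => exact ⟨1, by simp, by simp⟩
  | succ n ih =>
    obtain ⟨c, hc, h⟩ := ih fun i hi => hy i (by omega)
    obtain ⟨t, a, ht, hta⟩ := exists_mul_eq_of_mem (N := N) (k := k) (hy n (by omega))
    refine ⟨c * t, by rw [map_mul]; exact mul_ne_zero hc ht, fun i hi => ?_⟩
    rcases Nat.lt_succ_iff_lt_or_eq.1 hi with hi | rfl
    · obtain ⟨a', ha'⟩ := h i hi
      exact ⟨t * a', by rw [map_mul, map_mul, ← ha']; ring⟩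
    · exact ⟨c * a, by rw [map_mul, map_mul, ← hta]; ring⟩

theorem constantCoeff_ne_zero_of_inv_mem {a : MvPolynomial (Fin (N + 1)) k} (ha : a ≠ 0)
    (h : (algebraMap 𝔸 𝔎 a)⁻¹ ∈ baseSubring R) : constantCoeff a ≠ 0 := by
  obtain ⟨t, c, ht, htc⟩ := exists_mul_eq_of_mem (N := N) (k := k) h
  have h0 : algebraMap 𝔸 𝔎 a ≠ 0 := (map_ne_zero_iff _ (IsFractionRing.injective 𝔸 𝔎)).2 ha
  have : t = c * a := by
    apply IsFractionRing.injective 𝔸 𝔎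
    rw [map_mul, ← htc, inv_mul_cancel_right₀ h0]
  intro h1
  rw [this, map_mul, h1, mul_zero] at ht
  exact ht rfl

/-- The chain relations are preserved by `r_i ↦ c ^ p ^ (i+1) r_i`, since each trace takes one
`p`-th root of the scaling factor. Hence one common denominator `c`, a unit at the origin, clears
the whole chain. -/
theorem exists_chain_iff_polyChain {T : TraceData p (baseSubring R)}
    (hT : ∀ a : MvPolynomial (Fin (N + 1)) k,
      T.u (algebraMap 𝔸 𝔎 a) = algebraMap 𝔸 𝔎 (polyTrace p a))
    (f Δ : MvPolynomial (Fin (N + 1)) k) {n : ℕ} (hn : 0 < n) :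
    (∃ r, ChainCond T (algebraMap 𝔸 𝔎 f) (algebraMap 𝔸 𝔎 Δ) n r ∧
        T.u (algebraMap 𝔸 𝔎 f ^ (p - 2) * r 0) ≠ 0 ∧
        (T.u (algebraMap 𝔸 𝔎 f ^ (p - 2) * r 0))⁻¹ ∈ baseSubring R) ↔
      ∃ r, PolyChain p f Δ n r := by
  have hinj := IsFractionRing.injective 𝔸 𝔎
  constructor
  · rintro ⟨r, hr, h0, hinv⟩
    have hstep : ∀ i, ∃ d ∈ baseSubring R, i + 1 < n → r i = algebraMap 𝔸 𝔎 f * d -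
        T.u (algebraMap 𝔸 𝔎 f ^ (p - 2) * algebraMap 𝔸 𝔎 Δ * r (i + 1)) := by
      intro i
      by_cases hi : i + 1 < n
      · obtain ⟨d, hd, hd'⟩ := hr.step i hi
        exact ⟨d, hd, fun _ => hd'⟩
      · exact ⟨0, zero_mem _, fun h => absurd h hi⟩
    choose d hd hd' using hstep
    obtain ⟨c₁, hc₁, h₁⟩ := exists_common_denominator (N := N) (k := k) n r hr.mem
    obtain ⟨c₂, hc₂, h₂⟩ := exists_common_denominator (N := N) (k := k) n d fun i _ => hd i
    set c := c₁ * c₂ with hcdef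
    have hcc : constantCoeff c ≠ 0 := by rw [map_mul]; exact mul_ne_zero hc₁ hc₂
    have hpow : ∀ i, c ^ p ^ (i + 1) = c ^ (p ^ (i + 1) - 1) * (c₁ * c₂) := fun i => by
      rw [← hcdef, ← pow_succ, Nat.sub_add_cancel (pow_pos hp.out.pos _)]
    have hr' : ∀ i, ∃ a, i < n → algebraMap 𝔸 𝔎 c ^ p ^ (i + 1) * r i = algebraMap 𝔸 𝔎 a := by
      intro i
      by_cases hi : i < n
      · obtain ⟨a, ha⟩ := h₁ i hi
        refine ⟨c ^ (p ^ (i + 1) - 1) * c₂ * a, fun _ => ?_⟩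
        rw [← map_pow, hpow, map_mul, map_mul, map_mul, map_mul, ← ha]
        ring
      · exact ⟨0, fun h => absurd h hi⟩
    have hd'' : ∀ i, ∃ a, i < n → algebraMap 𝔸 𝔎 c ^ p ^ (i + 1) * d i = algebraMap 𝔸 𝔎 a := by
      intro i
      by_cases hi : i < n
      · obtain ⟨a, ha⟩ := h₂ i hi
        refine ⟨c ^ (p ^ (i + 1) - 1) * c₁ * a, fun _ => ?_⟩
        rw [← map_pow, hpow, map_mul, map_mul, map_mul, map_mul, ← ha]
        ring
      · exact ⟨0, fun h => absurd h hi⟩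
    choose ρ hρ using hr'
    choose e he using hd''
    have htr : ∀ i, i < n → ∀ z : 𝔸, algebraMap 𝔸 𝔎 (polyTrace p (z * ρ i)) =
        algebraMap 𝔸 𝔎 c ^ p ^ i * T.u (algebraMap 𝔸 𝔎 z * r i) := by
      intro i hi z
      rw [← hT, map_mul (algebraMap 𝔸 𝔎), ← hρ i hi, ← T.map_pow_mul, ← pow_mul, ← pow_succ]
      congr 1
      ring
    refine ⟨ρ, fun i hi => ⟨e i, hinj ?_⟩, fun i hi => hinj ?_, ?_⟩
    · rw [map_sub, htr (i + 1) hi, ← hρ i (by omega), hd' i hi, map_mul (algebraMap 𝔸 𝔎) f,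
        ← he i (by omega), map_mul (algebraMap 𝔸 𝔎) (f ^ (p - 2)), map_pow (algebraMap 𝔸 𝔎) f]
      ring
    · rw [htr (i + 1) hi, map_pow, hr.trace_eq_zero i hi, mul_zero, map_zero]
    · have h := htr 0 hn (f ^ (p - 2))
      rw [pow_zero, pow_one, map_pow] at h
      have hc0 : algebraMap 𝔸 𝔎 c ≠ 0 := algebraMap_ne_zero_of_constantCoeff (R := R) hcc
      refine constantCoeff_ne_zero_of_inv_mem (R := R) ?_ ?_
      · intro h'
        rw [h', map_zero] at h
        exact (mul_ne_zero hc0 h0) h.symm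
      · rw [h, mul_inv]
        exact mul_mem (algebraMap_inv_mem_baseSubring (R := R) hcc) hinv
  · rintro ⟨r, hr⟩
    refine ⟨fun i => algebraMap 𝔸 𝔎 (r i), ⟨fun i _ => algebraMap_mem_baseSubring _,
      fun i hi => ?_, fun i hi => ?_⟩, ?_⟩
    · obtain ⟨d, hd⟩ := hr.step i hi
      refine ⟨algebraMap 𝔸 𝔎 d, algebraMap_mem_baseSubring _, ?_⟩
      rw [hd, map_sub, ← hT]
      simp only [map_mul, map_pow]
    · rw [← map_pow, ← map_mul, hT, hr.trace_eq_zero i hi, map_zero]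
    · rw [← map_pow, ← map_mul, hT]
      exact ⟨algebraMap_ne_zero_of_constantCoeff (R := R) hr.ne_zero,
        algebraMap_inv_mem_baseSubring (R := R) hr.ne_zero⟩

/-- The criterion for quasi-`F`-splitting in terms of polynomials. -/
theorem isQuasiFSplitPair_iff_polyChain [IsIntegrallyClosed R] [UniqueFactorizationMonoid R]
    (q : Fin (N + 1) → ℕ+) (b : Lam q → k) (hb : specG q b ≠ 0) {n : ℕ} (hn : 0 < n)
    (hv : 0 < p ^ n) :
    IsQuasiFSplitPair p hn (algebraMap (MvPolynomial (Fin (N + 1)) k) R (specG q b)) (p ^ n - 2) hv ↔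
      ∃ r, PolyChain p (specG q b) (specDelta p q b) n r := by
  obtain ⟨T, hT⟩ := exists_traceData N k R p
  obtain ⟨s, hs⟩ := exists_sectionData p N k R
  obtain ⟨δ, hδ⟩ := exists_isDelta (p := p) q b s hs
  rw [IsScalarTower.algebraMap_apply 𝔸 R 𝔎] at hδ
  have hf : algebraMap 𝔸 R (specG q b) ≠ 0 :=
    (map_ne_zero_iff _ (IsLocalization.injective R
      (Ideal.primeCompl_le_nonZeroDivisors (originIdeal N k)))).2 hb
  rw [isQuasiFSplitPair_iff_chain hf T s hδ (algebraMap_mem_baseSubring _) hn hv,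
    ← exists_chain_iff_polyChain hT _ _ hn, ← IsScalarTower.algebraMap_apply]

end Main
end NonSplit

namespace NonSplit
set_option linter.unusedSectionVars false
open MvPolynomial

/-! ### Differentiation with respect to the coefficients -/

section CoeffDerivation

variable {ι σ S : Type*} [CommRing S]

/-- The derivation of `S[s][x]` which applies `∂/∂s_i` to all coefficients. -/
noncomputable def coeffDeriv (i : σ) : Derivation ℤ (MvPolynomial ι (MvPolynomial σ S))
    (MvPolynomial ι (MvPolynomial σ S)) := by
  classical
  have hc : ∀ (P : MvPolynomial ι (MvPolynomial σ S)) (m : ι →₀ ℕ),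
      coeff m (∑ l ∈ P.support, monomial l (pderiv i (coeff l P))) = pderiv i (coeff m P) := by
    intro P m
    rw [coeff_sum]
    simp only [coeff_monomial]
    rw [Finset.sum_ite_eq']
    split_ifs with h
    · rfl
    · rw [notMem_support_iff.1 h, map_zero]
  exact Derivation.mk' (AddMonoidHom.toIntLinearMap (AddMonoidHom.mk'
    (fun P => ∑ l ∈ P.support, monomial l (pderiv i (coeff l P))) fun P Q => by
      ext1 m
      rw [coeff_add, hc, hc, hc, coeff_add, map_add])) fun P Q => by
    ext1 m
    simp only [AddMonoidHom.coe_toIntLinearMap, AddMonoidHom.mk'_apply, smul_eq_mul, coeff_add]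
    rw [hc, coeff_mul, coeff_mul, mul_comm Q, coeff_mul, map_sum, ← Finset.sum_add_distrib]
    refine Finset.sum_congr rfl fun x _ => ?_
    rw [Derivation.leibniz, hc, hc, smul_eq_mul, smul_eq_mul, mul_comm (coeff x.2 Q)]

theorem coeff_coeffDeriv (i : σ) (P : MvPolynomial ι (MvPolynomial σ S)) (m : ι →₀ ℕ) :
    coeff m (coeffDeriv i P) = pderiv i (coeff m P) := by
  classical
  change coeff m (∑ l ∈ P.support, monomial l (pderiv i (coeff l P))) = _
  rw [coeff_sum]
  simp only [coeff_monomial]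
  rw [Finset.sum_ite_eq']
  split_ifs with h
  · rfl
  · rw [notMem_support_iff.1 h, map_zero]

theorem coeffDeriv_monomial (i : σ) (m : ι →₀ ℕ) (c : MvPolynomial σ S) :
    coeffDeriv i (monomial m c) = monomial m (pderiv i c) := by
  classical
  ext1 l
  rw [coeff_coeffDeriv, coeff_monomial, coeff_monomial]
  split_ifs <;> simp

theorem coeffDeriv_map {S' : Type*} [CommRing S'] (g : S →+* S') (i : σ)
    (P : MvPolynomial ι (MvPolynomial σ S)) :
    coeffDeriv i (MvPolynomial.map (MvPolynomial.map g) P) =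
      MvPolynomial.map (MvPolynomial.map g) (coeffDeriv i P) := by
  ext1 l
  rw [coeff_coeffDeriv, coeff_map, coeff_map, coeff_coeffDeriv, pderiv_map]

end CoeffDerivation

/-! ### Degree and derivatives of `Δ(G)` -/

section Universal

variable {p : ℕ} [hp : Fact p.Prime] {N : ℕ} {k : Type*} [Field k]
  (q : Fin (N + 1) → ℕ+)

/-- The weights `q_j` as natural numbers. -/
def natWeight (j : Fin (N + 1)) : ℕ := q j

theorem weight_natWeight (m : Fin (N + 1) →₀ ℕ) :
    Finsupp.weight (natWeight q) m = ∑ j, (q j : ℕ) * m j := by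
  rw [Finsupp.weight_apply, Finsupp.sum_fintype _ _ (by simp)]
  exact Finset.sum_congr rfl fun j _ => by simp [mul_comm, natWeight]

theorem weight_constExp (c : ℕ) :
    Finsupp.weight (natWeight q) (constExp _ c) = c * ∑ j, (q j : ℕ) := by
  simp [weight_natWeight, Finset.mul_sum, mul_comm]

theorem weight_eq_zero {m : Fin (N + 1) →₀ ℕ} (h : Finsupp.weight (natWeight q) m = 0) : m = 0 := by
  rw [weight_natWeight, Finset.sum_eq_zero_iff] at h
  ext j
  have := h j (Finset.mem_univ _)
  simpa using this

theorem isWeightedHomogeneous_lam {K : Type*} [CommRing K] (α : Lam q) (c : K) :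
    IsWeightedHomogeneous (natWeight q) (monomial α.1 c) (∑ j, (q j : ℕ)) :=
  isWeightedHomogeneous_monomial _ _ _ ((weight_natWeight q _).trans α.2)

theorem isWeightedHomogeneous_specG {K : Type*} [CommRing K] (b : Lam q → K) :
    IsWeightedHomogeneous (natWeight q) (specG q b) (∑ j, (q j : ℕ)) :=
  IsWeightedHomogeneous.sum _ _ _ fun α _ => isWeightedHomogeneous_lam q α _

theorem isWeightedHomogeneous_univG (K : Type*) [CommRing K] :
    IsWeightedHomogeneous (natWeight q) (univG q K) (∑ j, (q j : ℕ)) :=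
  isWeightedHomogeneous_specG q _

theorem coeffDeriv_univG (K : Type*) [CommRing K] (α : Lam q) :
    coeffDeriv α (univG q K) = monomial α.1 1 := by
  classical
  rw [univG, map_sum, Finset.sum_eq_single α]
  · rw [coeffDeriv_monomial, pderiv_X_self]
  · intro β _ h
    rw [coeffDeriv_monomial, pderiv_X_of_ne h, map_zero]
  · simp

theorem phi_univG : phi q p k (univG q (WittVector p k)) =
    ∑ α : Lam q, monomial (p • α.1) (X α ^ p) := by
  rw [univG, map_sum]
  refine Finset.sum_congr rfl fun α _ => ?_
  rw [phi, coe_eval₂Hom, eval₂_monomial, monomial_eq, Finsupp.prod_fintype _ _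
    (by simp), Finsupp.prod_fintype _ _ (by simp)]
  simp [← pow_mul]

variable [CharP k p]

theorem nsmul_injective_witt {a b : MvPolynomial (Fin (N + 1)) (MvPolynomial (Lam q) (WittVector p k))}
    (h : p • a = p • b) : a = b := by
  have h0 : (C (C (p : WittVector p k)) :
      MvPolynomial (Fin (N + 1)) (MvPolynomial (Lam q) (WittVector p k))) ≠ 0 := by
    rw [Ne, C_eq_zero, C_eq_zero]
    exact WittVector.p_nonzero p k
  refine mul_left_cancel₀ h0 ?_
  simpa [nsmul_eq_mul] using h

theorem isWeightedHomogeneous_deltaG :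
    IsWeightedHomogeneous (natWeight q) (deltaG q p k) (p * ∑ j, (q j : ℕ)) := by
  have hD := Classical.choose_spec (exists_delta q p k)
  set D := Classical.choose (exists_delta q p k) with hDdef
  have h1 : IsWeightedHomogeneous (natWeight q) (p • D) (p * ∑ j, (q j : ℕ)) := by
    rw [← hD, phi_univG, ← smul_eq_mul]
    refine ((isWeightedHomogeneous_univG q _).pow p).sub ?_
    refine IsWeightedHomogeneous.sum _ _ _ fun α _ => isWeightedHomogeneous_monomial _ _ _ ?_
    rw [map_nsmul, weight_natWeight, α.2]
  intro m hm
  refine h1 (d := m) fun h => hm ?_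
  have h2 : D.coeff m = 0 := by
    have h0 : (C (p : WittVector p k) : MvPolynomial (Lam q) (WittVector p k)) ≠ 0 := by
      rw [Ne, C_eq_zero]
      exact WittVector.p_nonzero p k
    refine (mul_eq_zero.1 ?_).resolve_left h0
    rw [coeff_smul, nsmul_eq_mul] at h
    simpa using h
  rw [deltaG, coeff_map, ← hDdef, h2, map_zero]

/-- Differentiate `p D = G̃ ^ p - φ(G̃)` over `W(k)`, where `p` cancels, and only then reduce modulo
`p`. -/
theorem coeffDeriv_deltaG (α : Lam q) : coeffDeriv α (deltaG q p k) =
    univG q k ^ (p - 1) * monomial α.1 1 - monomial (p • α.1) (X α ^ (p - 1)) := by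
  classical
  have hD := Classical.choose_spec (exists_delta q p k)
  set D := Classical.choose (exists_delta q p k) with hDdef
  have h1 : coeffDeriv α D = univG q (WittVector p k) ^ (p - 1) * monomial α.1 1 -
      monomial (p • α.1) (X α ^ (p - 1)) := by
    refine nsmul_injective_witt q ?_
    rw [← map_nsmul, ← hD, map_sub, Derivation.leibniz_pow, phi_univG, map_sum,
      Finset.sum_eq_single α, coeffDeriv_monomial, coeffDeriv_univG, Derivation.leibniz_pow,
      pderiv_X_self, nsmul_sub, smul_eq_mul, smul_eq_mul, mul_one, ← map_nsmul]
    · intro β _ h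
      rw [coeffDeriv_monomial, Derivation.leibniz_pow, pderiv_X_of_ne h]
      simp
    · simp
  rw [deltaG, coeffDeriv_map, ← hDdef, h1, map_sub, map_mul, map_pow, map_univG, map_monomial,
    map_monomial]
  simp

end Universal
end NonSplit

namespace NonSplit
set_option linter.unusedSectionVars false
open MvPolynomial

/-! ### The recursion behind `G_n` and its weighted degree -/

section FedderSeq

variable {p : ℕ} [hp : Fact p.Prime]

/-- The sequence `g_0 = f ^ (p - 2)`, `g_{n + 1} = f ^ (p - 2) Δ g_n ^ p`. -/
def fedderSeq {B : Type*} [CommRing B] (p : ℕ) (f Δ : B) : ℕ → B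
  | 0 => f ^ (p - 2)
  | n + 1 => f ^ (p - 2) * Δ * fedderSeq p f Δ n ^ p

theorem map_fedderSeq {B B' : Type*} [CommRing B] [CommRing B'] (φ : B →+* B') (f Δ : B) (n : ℕ) :
    φ (fedderSeq p f Δ n) = fedderSeq p (φ f) (φ Δ) n := by
  induction n with
  | zero => simp [fedderSeq]
  | succ n ih => simp [fedderSeq, ih]

/-- From `p ^ (n+1) - 1 = (p - 1) (1 + p + ⋯ + p ^ n)`. This form of the exponent exhibits the
recursion of `fedderSeq`. -/
theorem geom_exponent {p : ℕ} (hp : 2 ≤ p) (n : ℕ) :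
    p ^ (n + 1) - (∑ i ∈ Finset.Ico 1 (n + 1), p ^ i) - 2 =
      (p - 2) * ∑ i ∈ Finset.range (n + 1), p ^ i := by
  obtain ⟨e, rfl⟩ := Nat.exists_eq_add_of_le hp
  have h1 : ∑ i ∈ Finset.range (n + 1), (2 + e) ^ i =
      1 + ∑ i ∈ Finset.Ico 1 (n + 1), (2 + e) ^ i := by
    rw [Finset.range_eq_Ico, Finset.sum_eq_sum_Ico_succ_bot (Nat.succ_pos n), pow_zero]
  have h2 : (1 + e) * ∑ i ∈ Finset.range (n + 1), (2 + e) ^ i + 1 = (2 + e) ^ (n + 1) := by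
    induction n + 1 with
    | zero => simp
    | succ m ih => rw [Finset.sum_range_succ, pow_succ, mul_add]; nlinarith
  rw [show 2 + e - 2 = e by omega, ← h2]
  rw [h1]
  generalize ∑ i ∈ Finset.Ico 1 (n + 1), (2 + e) ^ i = S
  have : (1 + e) * (1 + S) + 1 = e * (1 + S) + S + 2 := by ring
  omega

theorem fedderSeq_eq {B : Type*} [CommRing B] (f Δ : B) (n : ℕ) :
    fedderSeq p f Δ n = f ^ ((p - 2) * ∑ i ∈ Finset.range (n + 1), p ^ i) *
      Δ ^ (∑ i ∈ Finset.range n, p ^ i) := by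
  have hs : ∀ n, ∑ i ∈ Finset.range (n + 1), p ^ i = 1 + p * ∑ i ∈ Finset.range n, p ^ i := by
    intro n
    rw [Finset.sum_range_succ', Finset.mul_sum, add_comm]
    simp [pow_succ']
  induction n with
  | zero => simp [fedderSeq]
  | succ n ih =>
    rw [fedderSeq, ih, hs (n + 1), hs n]
    ring

variable {N : ℕ} {k : Type*} [Field k] (q : Fin (N + 1) → ℕ+)

theorem polyG_succ (n : ℕ) :
    polyG q p k (n + 1) = fedderSeq p (univG q k) (deltaG q p k) n := by
  rw [polyG, geom_exponent hp.out.two_le, fedderSeq_eq, Nat.add_sub_cancel]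

variable (p) in
/-- `G_{n + 1}(b, 0)`. -/
noncomputable def specSeq (b : Lam q → k) (n : ℕ) : MvPolynomial (Fin (N + 1)) k :=
  fedderSeq p (specG q b) (specDelta p q b) n

theorem map_eval_polyG (b : Lam q → k) (n : ℕ) :
    MvPolynomial.map (eval b) (polyG q p k (n + 1)) = specSeq p q b n := by
  rw [polyG_succ, map_fedderSeq, map_eval_univG]
  rfl

theorem eval_polyH (b : Lam q → k) (n : ℕ) :
    eval b (polyH q p k (n + 1)) =
      coeff (constExp _ (p ^ (n + 1) - 1)) (specG q b * specSeq p q b n) := by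
  rw [polyH, ← map_eval_polyG, ← map_eval_univG, ← map_mul, coeff_map]
  rfl

variable [CharP k p]

theorem isWeightedHomogeneous_specDelta (b : Lam q → k) :
    IsWeightedHomogeneous (natWeight q) (specDelta p q b) (p * ∑ j, (q j : ℕ)) := by
  intro m hm
  refine isWeightedHomogeneous_deltaG (p := p) (k := k) q (d := m) fun h => hm ?_
  rw [specDelta, coeff_map, h, map_zero]

theorem isWeightedHomogeneous_specSeq (b : Lam q → k) (n : ℕ) :
    IsWeightedHomogeneous (natWeight q) (specSeq p q b n)
      ((p ^ (n + 1) - 2) * ∑ j, (q j : ℕ)) := by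
  have h2 := hp.out.two_le
  induction n with
  | zero =>
    rw [zero_add, pow_one]
    exact (isWeightedHomogeneous_specG q b).pow (p - 2)
  | succ n ih =>
    have := (((isWeightedHomogeneous_specG q b).pow (p - 2)).mul
      (isWeightedHomogeneous_specDelta (p := p) q b)).mul (ih.pow p)
    have h3 : 2 ≤ p ^ (n + 1) := h2.trans (Nat.le_self_pow (Nat.succ_ne_zero n) p)
    have h4 : p * 2 ≤ p ^ (n + 1 + 1) := by
      rw [pow_succ' p (n + 1)]
      exact Nat.mul_le_mul_left p h3
    rw [smul_eq_mul, smul_eq_mul, ← mul_assoc, ← add_mul, ← add_mul, Nat.mul_sub, ← pow_succ',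
      show p - 2 + p + (p ^ (n + 1 + 1) - p * 2) = p ^ (n + 1 + 1) - 2 by omega] at this
    exact this

theorem isWeightedHomogeneous_specSeq_mul (b : Lam q → k) (n : ℕ)
    {a : MvPolynomial (Fin (N + 1)) k}
    (ha : IsWeightedHomogeneous (natWeight q) a (∑ j, (q j : ℕ))) :
    IsWeightedHomogeneous (natWeight q) (specSeq p q b n * a)
      ((p ^ (n + 1) - 1) * ∑ j, (q j : ℕ)) := by
  have h2 := hp.out.two_le
  have h3 : 2 ≤ p ^ (n + 1) := h2.trans (Nat.le_self_pow (Nat.succ_ne_zero n) p)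
  convert (isWeightedHomogeneous_specSeq (p := p) q b n).mul ha using 1
  rw [← Nat.succ_mul]
  congr 1
  omega

end FedderSeq

/-! ### Coefficients at the extreme monomial -/

section Coefficients

variable {p : ℕ} [hp : Fact p.Prime] {N : ℕ} {k : Type*} [Field k]
  (q : Fin (N + 1) → ℕ+)

/-- `z` already has the full weighted degree of the monomial, and the weights are positive, so only
the constant term of `y` can contribute. -/
theorem coeff_constExp_mul {z : MvPolynomial (Fin (N + 1)) k} {c : ℕ}
    (hz : IsWeightedHomogeneous (natWeight q) z (c * ∑ j, (q j : ℕ)))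
    (y : MvPolynomial (Fin (N + 1)) k) :
    coeff (constExp _ c) (z * y) = coeff (constExp _ c) z * constantCoeff y := by
  classical
  rw [coeff_mul, Finset.sum_eq_single (constExp _ c, 0)]
  · rfl
  · rintro ⟨m, l⟩ hml hne
    rw [Finset.HasAntidiagonal.mem_antidiagonal] at hml
    by_contra h
    have h1 := hz (left_ne_zero_of_mul h)
    have h2 := congrArg (Finsupp.weight (natWeight q)) hml
    rw [map_add, h1, weight_constExp] at h2
    have h3 : l = 0 := weight_eq_zero q (by simpa using h2)
    subst h3
    simp only [add_zero] at hml
    exact hne (by simp [hml])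
  · intro h
    exact absurd (Finset.HasAntidiagonal.mem_antidiagonal.2 (add_zero _)) h

/-- The coefficients `coeff_{(x_0 ⋯ x_N) ^ (p ^ (n + 1) - 1)} (G_{n + 1}(b, 0) x ^ α)`. -/
noncomputable def jacCoeff (p : ℕ) [Fact p.Prime] {N : ℕ} {k : Type*} [Field k]
    (q : Fin (N + 1) → ℕ+) (b : Lam q → k) (n : ℕ) (α : Lam q) : k :=
  coeff (constExp _ (p ^ (n + 1) - 1)) (specSeq p q b n * monomial α.1 1)

theorem coeff_specSeq_mul_specG (b : Lam q → k) (n : ℕ) (a : Lam q → k) :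
    coeff (constExp _ (p ^ (n + 1) - 1)) (specSeq p q b n * specG q a) =
      ∑ α, a α * jacCoeff p q b n α := by
  rw [specG, Finset.mul_sum, coeff_sum]
  refine Finset.sum_congr rfl fun α _ => ?_
  rw [jacCoeff, ← coeff_C_mul, mul_left_comm, C_mul_monomial, mul_one]

variable [CharP k p]

/-- By weighted homogeneity only the degree `d` part of `a`, supported on `Lam q`, reaches the
extreme monomial. -/
theorem coeff_specSeq_mul (b : Lam q → k) (n : ℕ) (a : MvPolynomial (Fin (N + 1)) k) :
    coeff (constExp _ (p ^ (n + 1) - 1)) (specSeq p q b n * a) =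
      ∑ α : Lam q, coeff α.1 a * jacCoeff p q b n α := by
  classical
  induction a using MvPolynomial.induction_on' with
  | add a a' ha ha' =>
    rw [mul_add, coeff_add, ha, ha', ← Finset.sum_add_distrib]
    exact Finset.sum_congr rfl fun α _ => by rw [coeff_add, add_mul]
  | monomial m c =>
    by_cases hm : ∑ j, (q j : ℕ) * m j = ∑ j, (q j : ℕ)
    · obtain ⟨β, rfl⟩ : ∃ β : Lam q, β.1 = m := ⟨⟨m, hm⟩, rfl⟩
      rw [Finset.sum_eq_single β]
      · rw [coeff_monomial, if_pos rfl, jacCoeff, ← coeff_C_mul, mul_left_comm, C_mul_monomial,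
          mul_one]
      · intro γ _ h
        rw [coeff_monomial, if_neg fun h' => h (Subtype.ext h'.symm), zero_mul]
      · simp
    · rw [Finset.sum_eq_zero]
      · by_contra h
        have h2 := hp.out.two_le
        have h3 : 2 ≤ p ^ (n + 1) := h2.trans (Nat.le_self_pow (Nat.succ_ne_zero n) p)
        have h4 := ((isWeightedHomogeneous_specSeq (p := p) q b n).mul
          (isWeightedHomogeneous_monomial (natWeight q) m c rfl)) h
        rw [weight_constExp, weight_natWeight,
          show p ^ (n + 1) - 1 = (p ^ (n + 1) - 2) + 1 by omega, add_mul, one_mul] at h4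
        exact hm (Nat.add_left_cancel h4).symm
      · intro α _
        rw [coeff_monomial, if_neg, zero_mul]
        rintro rfl
        exact hm α.2

variable [PerfectRing k p]

theorem expShift_constExp (c : ℕ) :
    p • constExp (Fin (N + 1)) (p ^ c - 1) + constExp _ (p - 1) = constExp _ (p ^ (c + 1) - 1) := by
  ext j
  have h1 := hp.out.pos
  have h2 : 0 < p ^ c := pow_pos h1 c
  simp only [Finsupp.add_apply, Finsupp.smul_apply, smul_eq_mul, constExp_apply, Nat.mul_sub,
    pow_succ', mul_one]
  have : p ≤ p * p ^ c := Nat.le_mul_of_pos_right _ h2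
  omega

theorem coeff_pow_mul {z : MvPolynomial (Fin (N + 1)) k} {c : ℕ}
    (hz : IsWeightedHomogeneous (natWeight q) z ((p ^ c - 1) * ∑ j, (q j : ℕ)))
    (y : MvPolynomial (Fin (N + 1)) k) :
    coeff (constExp _ (p ^ (c + 1) - 1)) (z ^ p * y) =
      (coeff (constExp _ (p ^ c - 1)) z * constantCoeff (polyTrace p y)) ^ p := by
  rw [← expShift_constExp, ← coeff_polyTrace_pow, polyTrace_pow_mul, coeff_constExp_mul q hz]

theorem coeff_iterate_polyTrace (z : MvPolynomial (Fin (N + 1)) k) (m : Fin (N + 1) →₀ ℕ) (c : ℕ) :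
    coeff m ((polyTrace p)^[c] z) ^ p ^ c = coeff (p ^ c • m + constExp _ (p ^ c - 1)) z := by
  induction c generalizing z with
  | zero =>
    have : constExp (Fin (N + 1)) 0 = 0 := by ext j; rfl
    simp [this]
  | succ c ih =>
    rw [Function.iterate_succ_apply, pow_succ, pow_mul, ih, coeff_polyTrace_pow, smul_add,
      ← mul_smul, ← pow_succ', add_assoc, expShift_constExp, ← pow_succ]

end Coefficients

/-! ### The Jacobian rows at a common zero of the earlier `H_i` -/

section Jacobian

variable {p : ℕ} [hp : Fact p.Prime] {N : ℕ} {k : Type*} [Field k] [CharP k p]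
  (q : Fin (N + 1) → ℕ+)

theorem coeffDeriv_mul_polyG_one (α : Lam q) :
    coeffDeriv α (univG q k * polyG q p k 1) = -(polyG q p k 1 * monomial α.1 1) := by
  have h2 := hp.out.two_le
  have hc : ((p : ℕ) : MvPolynomial (Fin (N + 1)) (MvPolynomial (Lam q) k)) = 0 :=
    CharP.cast_eq_zero _ p
  rw [polyG_succ, fedderSeq, ← pow_succ', Derivation.leibniz_pow, coeffDeriv_univG,
    Nat.add_sub_cancel, nsmul_eq_mul, show p - 2 + 1 = p - 1 by omega,
    Nat.cast_sub hp.out.one_le, hc, smul_eq_mul]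
  push_cast
  ring

/-- With `g = G_{n+1}`, the product is `g ^ p * (G ^ (p-1) Δ)`, and `g ^ p` is constant for the
derivation. The two correction terms come from the derivative of `Δ`. -/
theorem coeffDeriv_mul_polyG (n : ℕ) (α : Lam q) :
    coeffDeriv α (univG q k * polyG q p k (n + 2)) = -(polyG q p k (n + 2) * monomial α.1 1) +
      (univG q k * polyG q p k (n + 1)) ^ p * (univG q k ^ (p - 2) * monomial α.1 1) -
      (polyG q p k (n + 1) * monomial α.1 1) ^ p * (C (X α ^ (p - 1)) * univG q k ^ (p - 1)) := by
  have h2 := hp.out.two_le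
  have hc : ((p : ℕ) : MvPolynomial (Fin (N + 1)) (MvPolynomial (Lam q) k)) = 0 :=
    CharP.cast_eq_zero _ p
  rw [polyG_succ, polyG_succ, fedderSeq]
  set G := univG q k with hG
  set g := fedderSeq p G (deltaG q p k) n
  have e1 : G * (G ^ (p - 2) * deltaG q p k * g ^ p) = g ^ p * (G ^ (p - 1) * deltaG q p k) := by
    rw [show p - 1 = p - 2 + 1 by omega]; ring
  have e2 : coeffDeriv α (g ^ p) = 0 := by
    rw [Derivation.leibniz_pow, nsmul_eq_mul, hc, zero_mul]
  have e3 : monomial (p • α.1) (X α ^ (p - 1)) =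
      (monomial α.1 1 : MvPolynomial (Fin (N + 1)) (MvPolynomial (Lam q) k)) ^ p *
        C (X α ^ (p - 1)) := by
    rw [monomial_pow, one_pow, mul_comm, C_mul_monomial, mul_one]
  rw [e1, Derivation.leibniz, e2, Derivation.leibniz, Derivation.leibniz_pow, coeffDeriv_univG,
    coeffDeriv_deltaG, show p - 1 - 1 = p - 2 by omega, nsmul_eq_mul,
    Nat.cast_sub hp.out.one_le, hc, e3]
  simp only [smul_eq_mul]
  obtain ⟨e, rfl⟩ := Nat.exists_eq_add_of_le h2
  rw [show 2 + e - 1 = e + 1 by omega, show 2 + e - 2 = e by omega]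
  push_cast
  ring

variable [PerfectRing k p]

/-- At the extreme monomial, the first correction term of `coeffDeriv_mul_polyG` carries the factor
`H_n(b)` and the second a `p`-th root of `H_1(b)`; both vanish. -/
theorem eval_pderiv_polyH (b : Lam q → k) (n : ℕ)
    (h : ∀ i < n, eval b (polyH q p k (i + 1)) = 0) (α : Lam q) :
    eval b (pderiv α (polyH q p k (n + 1))) = -jacCoeff p q b n α := by
  have h2 := hp.out.two_le
  have key : eval b (pderiv α (polyH q p k (n + 1))) = coeff (constExp _ (p ^ (n + 1) - 1))
      (MvPolynomial.map (eval b) (coeffDeriv α (univG q k * polyG q p k (n + 1)))) := by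
    rw [coeff_map, coeff_coeffDeriv]
    rfl
  rw [key]
  cases n with
  | zero =>
    rw [coeffDeriv_mul_polyG_one, map_neg, map_mul, map_eval_polyG, map_monomial, map_one, coeff_neg]
    rfl
  | succ n =>
    rw [coeffDeriv_mul_polyG]
    simp only [map_sub, map_add, map_neg, map_mul, map_pow, map_C, map_monomial, map_one,
      map_eval_polyG, map_eval_univG, coeff_sub, coeff_add, coeff_neg, eval_X]
    have hw : IsWeightedHomogeneous (natWeight q) (specG q b * specSeq p q b n)
        ((p ^ (n + 1) - 1) * ∑ j, (q j : ℕ)) := by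
      rw [mul_comm]
      exact isWeightedHomogeneous_specSeq_mul q b n (isWeightedHomogeneous_specG q b)
    have h0 : constantCoeff (polyTrace p (C (b α) ^ (p - 1) * specG q b ^ (p - 1))) = 0 := by
      have hH := h 0 (Nat.succ_pos n)
      rw [eval_polyH, specSeq, fedderSeq, ← pow_succ', show p - 2 + 1 = p - 1 by omega] at hH
      refine pow_eq_zero_iff hp.out.ne_zero |>.1 ?_
      rw [constantCoeff_eq, coeff_polyTrace_pow, ← C_pow, coeff_C_mul, smul_zero, zero_add]
      simp only [zero_add, pow_one] at hH
      rw [hH, mul_zero]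
    rw [coeff_pow_mul q hw, coeff_pow_mul q
      (isWeightedHomogeneous_specSeq_mul q b n (isWeightedHomogeneous_lam q α 1)),
      ← eval_polyH, h n (Nat.lt_succ_self n), h0, zero_mul, mul_zero,
      zero_pow hp.out.ne_zero, add_zero, sub_zero]
    rfl

end Jacobian
end NonSplit

namespace NonSplit
set_option linter.unusedSectionVars false
open MvPolynomial

/-! ### Chains and iterated traces -/

section IteratedTrace

variable {p : ℕ} [hp : Fact p.Prime] {N : ℕ} {k : Type*} [Field k] [CharP k p] [PerfectRing k p]

local notation "𝔸" => MvPolynomial (Fin (N + 1)) k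

/-- The additive map `a ↦ u ^ (n + 1) (g_n a)`, where `u` is the trace. -/
noncomputable def iterTrace (p : ℕ) [Fact p.Prime] {N : ℕ} {k : Type*} [Field k] [CharP k p]
    [PerfectRing k p] (f Δ : MvPolynomial (Fin (N + 1)) k) (n : ℕ)
    (a : MvPolynomial (Fin (N + 1)) k) : MvPolynomial (Fin (N + 1)) k :=
  (polyTrace p)^[n + 1] (fedderSeq p f Δ n * a)

theorem iterTrace_zero (f Δ a : 𝔸) : iterTrace p f Δ 0 a = polyTrace p (f ^ (p - 2) * a) := rfl

theorem iterTrace_succ (f Δ a : 𝔸) (n : ℕ) :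
    iterTrace p f Δ (n + 1) a = iterTrace p f Δ n (polyTrace p (f ^ (p - 2) * Δ * a)) := by
  rw [iterTrace, iterTrace, Function.iterate_succ_apply, fedderSeq, ← polyTrace_pow_mul]
  congr 2
  ring

theorem iterTrace_sub (f Δ a a' : 𝔸) (n : ℕ) :
    iterTrace p f Δ n (a - a') = iterTrace p f Δ n a - iterTrace p f Δ n a' := by
  rw [iterTrace, mul_sub, iterate_map_sub]
  rfl

theorem iterTrace_neg (f Δ a : 𝔸) (n : ℕ) :
    iterTrace p f Δ n (-a) = -iterTrace p f Δ n a := by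
  rw [iterTrace, mul_neg, iterate_map_neg]
  rfl

theorem iterTrace_iterate (f Δ a : 𝔸) (n t : ℕ) :
    iterTrace p f Δ n ((fun r => -polyTrace p (f ^ (p - 2) * Δ * r))^[t] a) =
      (-1) ^ t * iterTrace p f Δ (n + t) a := by
  induction t generalizing n with
  | zero => simp
  | succ t ih =>
    rw [Function.iterate_succ_apply', iterTrace_neg, ← iterTrace_succ, ih, pow_succ,
      show n + 1 + t = n + (t + 1) by omega]
    ring

/-- Start with `a` at place `h`, apply `r ↦ -u (f ^ (p-2) Δ r)` downwards, and put zero above. The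
trace conditions become the vanishing of `iterTrace` in lower orders. If `h < n`, the relation at
place `h` requires `f ∣ a`. -/
theorem polyChain_of_iterTrace {f Δ a : 𝔸} {h n : ℕ} (hn : h ≤ n)
    (h0 : ∀ i < h, iterTrace p f Δ i a = 0) (hne : constantCoeff (iterTrace p f Δ h a) ≠ 0)
    (ha : h = n ∨ f ∣ a) : ∃ r, PolyChain p f Δ (n + 1) r := by
  refine ⟨fun j => if j ≤ h then (fun r => -polyTrace p (f ^ (p - 2) * Δ * r))^[h - j] a else 0,
    fun i hi => ?_, fun i hi => ?_, ?_⟩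
  · rcases lt_trichotomy i h with hih | rfl | hih
    · refine ⟨0, ?_⟩
      rw [if_pos hih.le, if_pos (Nat.succ_le_of_lt hih),
        show h - i = h - (i + 1) + 1 by omega, Function.iterate_succ_apply', mul_zero, zero_sub]
    · obtain ⟨d, rfl⟩ := ha.resolve_left (by omega)
      exact ⟨d, by simp⟩
    · refine ⟨0, ?_⟩
      rw [if_neg (by omega), if_neg (by omega)]
      simp
  · split_ifs with hih
    · rw [← iterTrace_zero f Δ, iterTrace_iterate, h0 _ (by omega), mul_zero]
    · rw [mul_zero, map_zero]
  · rw [if_pos (Nat.zero_le _), ← iterTrace_zero f Δ, iterTrace_iterate, map_mul, Nat.sub_zero,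
      zero_add]
    refine mul_ne_zero ?_ hne
    simp

/-- Applying `iterTrace` of order `i` to the chain relation moves along the diagonal `(i, j) → (i +
1, j + 1)` up to sign; the term `f * d` has no constant coefficient by hypothesis. -/
theorem PolyChain.iterTrace_iff {f Δ : 𝔸} {n : ℕ} {r : ℕ → 𝔸} (hr : PolyChain p f Δ (n + 1) r)
    (hf : ∀ i < n, ∀ d, constantCoeff (iterTrace p f Δ i (f * d)) = 0) {i j t : ℕ}
    (hj : j + t ≤ n) (hi : i + t ≤ n) :
    constantCoeff (iterTrace p f Δ i (r j)) = 0 ↔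
      constantCoeff (iterTrace p f Δ (i + t) (r (j + t))) = 0 := by
  induction t with
  | zero => rfl
  | succ t ih =>
    obtain ⟨d, hd⟩ := hr.step (j + t) (by omega)
    rw [ih (by omega) (by omega), hd, iterTrace_sub, ← iterTrace_succ, map_sub,
      hf _ (by omega), zero_sub, neg_eq_zero]
    rfl

variable (q : Fin (N + 1) → ℕ+) (b : Lam q → k)

theorem constantCoeff_iterTrace_pow (n : ℕ) (a : 𝔸) :
    constantCoeff (iterTrace p (specG q b) (specDelta p q b) n a) ^ p ^ (n + 1) =
      coeff (constExp _ (p ^ (n + 1) - 1)) (specSeq p q b n * a) := by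
  rw [constantCoeff_eq, iterTrace, coeff_iterate_polyTrace, smul_zero, zero_add]
  rfl

theorem constantCoeff_iterTrace_eq_zero_iff (n : ℕ) (a : 𝔸) :
    constantCoeff (iterTrace p (specG q b) (specDelta p q b) n a) = 0 ↔
      coeff (constExp _ (p ^ (n + 1) - 1)) (specSeq p q b n * a) = 0 := by
  rw [← constantCoeff_iterTrace_pow, pow_eq_zero_iff (pow_pos hp.out.pos _).ne']

/-- For an argument homogeneous of degree `d`, the iterated trace is a constant, so one coefficient
decides. -/
theorem iterTrace_specG_eq_zero {a : Lam q → k} {n : ℕ}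
    (h : coeff (constExp _ (p ^ (n + 1) - 1)) (specSeq p q b n * specG q a) = 0) :
    iterTrace p (specG q b) (specDelta p q b) n (specG q a) = 0 := by
  ext m
  rw [coeff_zero]
  by_cases hm : m = 0
  · rw [hm, ← constantCoeff_eq, constantCoeff_iterTrace_eq_zero_iff, h]
  · refine (pow_eq_zero_iff (pow_pos hp.out.pos (n + 1)).ne').1 ?_
    rw [iterTrace, coeff_iterate_polyTrace]
    by_contra hne
    have h1 := isWeightedHomogeneous_specSeq_mul (p := p) q b n (isWeightedHomogeneous_specG q a) hne
    rw [map_add, weight_constExp, map_nsmul, Nat.add_eq_right, smul_eq_mul, mul_eq_zero] at h1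
    exact hm (weight_eq_zero q (h1.resolve_left (pow_pos hp.out.pos _).ne'))

theorem constantCoeff_iterTrace_specG_mul {n : ℕ} (h : eval b (polyH q p k (n + 1)) = 0) (d : 𝔸) :
    constantCoeff (iterTrace p (specG q b) (specDelta p q b) n (specG q b * d)) = 0 := by
  rw [constantCoeff_iterTrace_eq_zero_iff, ← mul_assoc, coeff_constExp_mul q
    (isWeightedHomogeneous_specSeq_mul q b n (isWeightedHomogeneous_specG q b)), mul_comm (specSeq _ _ _ _),
    ← eval_polyH, h, zero_mul]

/-- If one of `H_1, …, H_{n + 1}` does not vanish at `b`, there is a chain. -/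
theorem exists_polyChain_of_polyH_ne_zero {n h : ℕ} (hn : h ≤ n)
    (hh : eval b (polyH q p k (h + 1)) ≠ 0) :
    ∃ r, PolyChain p (specG q b) (specDelta p q b) (n + 1) r := by
  classical
  have hex : ∃ i, eval b (polyH q p k (i + 1)) ≠ 0 := ⟨h, hh⟩
  -- `G(b)` is placed at the first nonvanishing `H`, so all lower orders vanish. It is divisible by
  -- `f = G(b)`, so the chain can be continued by zero.
  refine polyChain_of_iterTrace (h := Nat.find hex) (a := specG q b)
    ((Nat.find_min' hex hh).trans hn) (fun i hi => ?_) ?_ (Or.inr dvd_rfl)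
  · have := not_not.1 (Nat.find_min hex hi)
    rw [eval_polyH, mul_comm] at this
    exact iterTrace_specG_eq_zero q b this
  · have := Nat.find_spec hex
    rw [eval_polyH, mul_comm] at this
    rwa [Ne, constantCoeff_iterTrace_eq_zero_iff]

theorem exists_polyChain_iff {n : ℕ} (hH : ∀ i < n, eval b (polyH q p k (i + 1)) = 0) :
    (∃ r, PolyChain p (specG q b) (specDelta p q b) (n + 1) r) ↔
      ∃ a : Lam q → k, (∀ i < n, ∑ α, a α * jacCoeff p q b i α = 0) ∧
        ∑ α, a α * jacCoeff p q b n α ≠ 0 := by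
  constructor
  · rintro ⟨r, hr⟩
    have hf : ∀ i < n, ∀ d, constantCoeff (iterTrace p (specG q b) (specDelta p q b) i
        (specG q b * d)) = 0 := fun i hi d => constantCoeff_iterTrace_specG_mul q b (hH i hi) d
    -- The vector is the degree `d` part of the last term `r n`. The diagonal from `(0, n - i)` to
    -- `(i, n)` turns the trace conditions into orthogonality, and that from `(0, 0)` to `(n, n)`
    -- turns the unit condition into nonvanishing.
    refine ⟨fun α => coeff α.1 (r n), fun i hi => ?_, ?_⟩
    · rw [← coeff_specSeq_mul, ← constantCoeff_iterTrace_eq_zero_iff]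
      have := (hr.iterTrace_iff hf (i := 0) (j := n - i) (t := i) (by omega) (by omega)).1
      rw [zero_add, Nat.sub_add_cancel hi.le] at this
      refine this ?_
      rw [iterTrace_zero, show n - i = n - i - 1 + 1 by omega, hr.trace_eq_zero _ (by omega),
        map_zero]
    · rw [← coeff_specSeq_mul, Ne, ← constantCoeff_iterTrace_eq_zero_iff]
      have := (hr.iterTrace_iff hf (i := 0) (j := 0) (t := n) (by omega) (by omega)).2
      rw [zero_add] at this
      exact fun h => hr.ne_zero (this h)
  · rintro ⟨a, ha0, ha⟩
    refine polyChain_of_iterTrace (h := n) (a := specG q a) le_rfl (fun i hi => ?_) ?_ (Or.inl rfl)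
    · refine iterTrace_specG_eq_zero q b ?_
      rw [coeff_specSeq_mul_specG, ha0 i hi]
    · rwa [Ne, constantCoeff_iterTrace_eq_zero_iff, coeff_specSeq_mul_specG]

end IteratedTrace
end NonSplit

namespace NonSplit
set_option linter.unusedSectionVars false
open MvPolynomial

/-! ### Minors and separation of rows by linear functionals -/

section Minors

variable {K : Type*} [Field K] {Λ : Type*} [Fintype Λ]

theorem linearIndependent_row_iff_exists_minor {n : ℕ} (M : Matrix (Fin n) Λ K) :
    LinearIndependent K M.row ↔ ∃ e : Fin n ↪ Λ, (M.submatrix id e).det ≠ 0 := by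
  constructor
  · intro h
    have hr := h.rank_matrix
    rw [Matrix.rank_eq_finrank_span_cols, Fintype.card_fin] at hr
    obtain ⟨κ, a, ha, hspan, hli⟩ := exists_linearIndependent' K M.col
    have : Fintype κ := Fintype.ofInjective a ha
    rw [← hspan, finrank_span_eq_card hli] at hr
    let e : Fin n ≃ κ := (Fintype.equivFinOfCardEq hr).symm
    refine ⟨⟨a ∘ e, ha.comp e.injective⟩, ?_⟩
    rw [← isUnit_iff_ne_zero, ← Matrix.isUnit_iff_isUnit_det,
      ← Matrix.linearIndependent_cols_iff_isUnit]
    exact hli.comp e e.injective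
  · rintro ⟨e, he⟩
    have h := Matrix.linearIndependent_rows_of_det_ne_zero he
    exact LinearIndependent.of_comp (LinearMap.funLeft K K e) h

theorem exists_dot_iff_notMem_span {ι : Type*} (v : ι → Λ → K) (w : Λ → K) :
    (∃ a : Λ → K, (∀ i, ∑ l, a l * v i l = 0) ∧ ∑ l, a l * w l ≠ 0) ↔
      w ∉ Submodule.span K (Set.range v) := by
  classical
  constructor
  · rintro ⟨a, ha, hw⟩ hmem
    refine hw ?_
    have hle : Submodule.span K (Set.range v) ≤
        LinearMap.ker (Fintype.linearCombination K (M := K) a) := by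
      rw [Submodule.span_le]
      rintro _ ⟨i, rfl⟩
      rw [SetLike.mem_coe, LinearMap.mem_ker, Fintype.linearCombination_apply, ← ha i]
      exact Finset.sum_congr rfl fun l _ => mul_comm _ _
    have := hle hmem
    rw [LinearMap.mem_ker, Fintype.linearCombination_apply] at this
    rw [← this]
    exact Finset.sum_congr rfl fun l _ => mul_comm _ _
  · intro h
    obtain ⟨φ, hφ, hker⟩ := Submodule.exists_le_ker_of_notMem h
    have hdot : ∀ x : Λ → K, ∑ l, φ (Pi.single l 1) * x l = φ x := by
      intro x
      conv_rhs => rw [pi_eq_sum_univ' x, map_sum]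
      refine Finset.sum_congr rfl fun l _ => ?_
      rw [map_smul, smul_eq_mul, mul_comm]
    refine ⟨fun l => φ (Pi.single l 1), fun i => ?_, ?_⟩
    · rw [hdot]
      exact hker (Submodule.subset_span ⟨i, rfl⟩)
    · rwa [hdot]

/-- Independence means that each row lies outside the span of its predecessors, which by duality
means that a vector orthogonal to them detects it. -/
theorem linearIndependent_fin_iff (v : ℕ → Λ → K) (n : ℕ) :
    LinearIndependent K (fun i : Fin n => v i) ↔ ∀ m < n, ∃ a : Λ → K,
      (∀ i < m, ∑ l, a l * v i l = 0) ∧ ∑ l, a l * v m l ≠ 0 := by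
  induction n with
  | zero => simp
  | succ n ih =>
    have h1 : Fin.init (fun i : Fin (n + 1) => v i) = fun i : Fin n => v i := rfl
    rw [linearIndependent_finSucc', h1, ih, Fin.val_last, ← exists_dot_iff_notMem_span,
      Nat.forall_lt_succ_right]
    refine and_congr_right fun _ => exists_congr fun a => and_congr_left fun _ => ?_
    exact ⟨fun h i hi => h ⟨i, hi⟩, fun h i => h i i.2⟩

end Minors

/-! ### Comparison of `Z_n` with the existence of chains -/

section Main

variable {p : ℕ} [hp : Fact p.Prime] {N : ℕ} {k : Type*} [Field k] [CharP k p] [PerfectRing k p]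
  (q : Fin (N + 1) → ℕ+) (b : Lam q → k)

theorem mem_locusZ_iff_minors (n : ℕ) : b ∈ locusZ q p k n ↔
    (∀ i < n, eval b (polyH q p k (i + 1)) = 0) ∧
      ∀ e : Fin n ↪ Lam q, eval b ((jacobianL q p k n).submatrix id e).det = 0 := by
  rw [locusZ, mem_zeroLocus_iff]
  have haev : ∀ P : MvPolynomial (Lam q) k, aeval b P = eval b P := fun P => by
    rw [aeval_eq_eval]
  simp only [haev]
  constructor
  · intro h
    exact ⟨fun i hi => h _ (Ideal.mem_sup_left (Ideal.subset_span ⟨⟨i, hi⟩, rfl⟩)),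
      fun e => h _ (Ideal.mem_sup_right (Ideal.subset_span ⟨e, rfl⟩))⟩
  · rintro ⟨h1, h2⟩
    have hle : Ideal.span (Set.range fun i : Fin n => polyH q p k ((i : ℕ) + 1)) ⊔
        Ideal.span (Set.range fun e : Fin n ↪ Lam q =>
          ((jacobianL q p k n).submatrix id e).det) ≤ RingHom.ker (eval b) := by
      refine sup_le (Ideal.span_le.2 ?_) (Ideal.span_le.2 ?_)
      · rintro _ ⟨i, rfl⟩
        exact h1 i i.2
      · rintro _ ⟨e, rfl⟩
        exact h2 e
    exact fun P hP => hle hP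

/-- Once all `H_i` vanish at `b`, the Jacobian there is minus the matrix of `jacCoeff`, and
vanishing of the maximal minors is dependence of its rows. -/
theorem mem_locusZ_iff (n : ℕ) : b ∈ locusZ q p k n ↔
    (∀ i < n, eval b (polyH q p k (i + 1)) = 0) ∧
      ¬ LinearIndependent k fun i : Fin n => jacCoeff p q b i := by
  rw [mem_locusZ_iff_minors]
  refine and_congr_right fun hH => ?_
  have hJ : (jacobianL q p k n).map (eval b) =
      Matrix.of fun (i : Fin n) α => -jacCoeff p q b i α := by
    ext i α
    exact eval_pderiv_polyH q b i (fun j hj => hH j (hj.trans i.2)) α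
  have hneg : LinearIndependent k (fun i : Fin n => jacCoeff p q b i) ↔
      LinearIndependent k ((jacobianL q p k n).map (eval b)).row := by
    rw [hJ]
    constructor
    · intro h
      exact h.map' (-LinearMap.id) (by rw [LinearMap.ker_neg, LinearMap.ker_id])
    · intro h
      exact LinearIndependent.of_comp (-LinearMap.id) h
  rw [hneg, linearIndependent_row_iff_exists_minor]
  push Not
  refine forall_congr' fun e => ?_
  rw [RingHom.map_det, RingHom.mapMatrix_apply, Matrix.submatrix_map]

theorem mem_locusZ_of_not_polyChain {n : ℕ}
    (h : ¬ ∃ r, PolyChain p (specG q b) (specDelta p q b) (n + 1) r) :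
    b ∈ locusZ q p k (n + 1) := by
  have hH : ∀ i < n + 1, eval b (polyH q p k (i + 1)) = 0 := by
    intro i hi
    by_contra hne
    exact h (exists_polyChain_of_polyH_ne_zero q b (Nat.le_of_lt_succ hi) hne)
  refine (mem_locusZ_iff q b _).2 ⟨hH, fun hli => h ?_⟩
  exact (exists_polyChain_iff q b fun i hi => hH i (by omega)).2
    ((linearIndependent_fin_iff _ _).1 hli n (Nat.lt_succ_self n))

/-- Dependence only says that some row lies in the span of its predecessors, so failure may occur at
an index below `n`. -/
theorem exists_not_polyChain_of_mem_locusZ {n : ℕ} (h : b ∈ locusZ q p k n) :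
    ∃ m < n, ¬ ∃ r, PolyChain p (specG q b) (specDelta p q b) (m + 1) r := by
  obtain ⟨hH, hli⟩ := (mem_locusZ_iff q b n).1 h
  by_contra! hall
  refine hli ((linearIndependent_fin_iff _ _).2 fun m hm => ?_)
  exact (exists_polyChain_iff q b fun i hi => hH i (by omega)).1 (hall m hm)

end Main
end NonSplit

theorem theorem3p9 (p : ℕ) [Fact p.Prime] {k : Type*} [Field k] [IsAlgClosed k] [CharP k p]
    {N : ℕ} (q : Fin (N + 1) → ℕ+) (b : NonSplit.Lam q → k) (hb : NonSplit.specG q b ≠ 0) :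
    NonSplit.tau q p b =
      NonSplit.nsIndex p
        (algebraMap (MvPolynomial (Fin (N + 1)) k) (NonSplit.OriginRing N k)
          (NonSplit.specG q b)) := by
  apply le_antisymm
  · refine le_sInf ?_
    rintro _ ⟨n, hn, rfl, hsplit⟩
    refine sInf_le ⟨n, hn, rfl, ?_⟩
    rw [NonSplit.isQuasiFSplitPair_iff_polyChain q b hb] at hsplit
    obtain ⟨m, rfl⟩ := Nat.exists_eq_succ_of_ne_zero hn.ne'
    exact NonSplit.mem_locusZ_of_not_polyChain q b hsplit
  · refine le_sInf ?_
    rintro _ ⟨n, hn, rfl, hZ⟩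
    obtain ⟨m, hm, h⟩ := NonSplit.exists_not_polyChain_of_mem_locusZ q b hZ
    -- The failing index `m + 1 ≤ n` need not be `n` itself, which suffices for the infimum.
    refine le_trans (sInf_le ⟨m + 1, Nat.succ_pos m, rfl, ?_⟩)
      (Nat.cast_le.2 (Nat.succ_le_of_lt hm))
    rwa [NonSplit.isQuasiFSplitPair_iff_polyChain q b hb]
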